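/- **Setting.** Let $M=\langle\mathcal S,\mathcal A,\mathcal P,\gamma\rangle$ be a discounted MDP with Polish state and action spaces, $\gamma\in(0,1)$, where $\mathcal P(\cdot,\cdot\mid s,a)$ is the joint law of the reward, with values in $[0,1]$, and the next state. Let $\pi$ be a policy and $\mu_\pi$ a stationary distribution of the induced Markov chain of states. Let $\phi:\mathcal S\to\mathbb R^d$ be measurable with $\|\phi(s)\|\le 1$ for all $s$, let $\Sigma_\phi=\mathbb E_{s\sim\mu_\pi}[\phi(s)\phi(s)^\top]$, and assume that its smallest eigenvalue $\lambda_{\min}$ is positive. Let $K\ge(1-\gamma)^{-1}$ be an integer, $\iota_K=(K(1-\gamma))^{-1}$ and $x_k=k\iota_K$ for $0\le k\le K$. For $\theta=(\theta(0),\dots,\theta(K-1))\in\mathbb R^{dK}$ and $s\in\mathcal S$ let $\eta_\theta(s)=\sum_{k=0}^Kp_k(s;\theta)\delta_{x_k}$ be the signed measure with $p_0+\dots+p_k=\phi(s)^\top\theta(k)+\frac{k+1}{K+1}$ for $k<K$ and total mass $1$. For fields of signed measures on $[0,(1-\gamma)^{-1}]$ with distribution functions $F_{\eta(s)}(x)=\eta(s)([0,x])$,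 let $\ell_{2,\mu_\pi}(\eta_1,\eta_2)^2=\mathbb E_{s\sim\mu_\pi}\int_0^{(1-\gamma)^{-1}}(F_{\eta_1(s)}-F_{\eta_2(s)})^2dx$ and $W_{1,\mu_\pi}(\eta_1,\eta_2)^2=\mathbb E_{s\sim\mu_\pi}\big(\int_0^{(1-\gamma)^{-1}}|F_{\eta_1(s)}-F_{\eta_2(s)}|dx\big)^2$. Let $\theta^\star$ solve the linear-categorical projected Bellman equation: $\eta_{\theta^\star}$ minimizes $\ell_{2,\mu_\pi}(\mathcal T^\pi\eta_{\theta^\star},\eta_\theta)$ over $\theta\in\mathbb R^{dK}$, where $[\mathcal T^\pi\eta](s)=\mathbb E[(x\mapsto r+\gamma x)_\#\eta(s')\mid s]$. Put $\mathcal L(\theta)=W_{1,\mu_\pi}(\eta_\theta,\eta_{\theta^\star})$, $\|\theta\|_{V_1}=\frac{1}{\sqrt K(1-\gamma)}\|\theta\|_{I_K\otimes\Sigma_\phi}$, where $\|\theta\|_B=\sqrt{\theta^\top B\theta}$, and $\|\theta\|_{V_2}=\frac{1}{\sqrt K(1-\gamma)}\|\theta\|$. **Algorithm (Linear-CTD).**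 Fix $\theta_0\in\mathbb R^{dK}$ and $\alpha\in(0,(1-\sqrt\gamma)/76)$. From i.i.d. samples $s_t\sim\mu_\pi$, $a_t\sim\pi(\cdot\mid s_t)$, $(r_t,s_t')\sim\mathcal P(\cdot,\cdot\mid s_t,a_t)$, $t\ge1$, put $\theta_t=\theta_{t-1}-\alpha(A_t\theta_{t-1}-b_t)$ with $$A_t=I_K\otimes(\phi(s_t)\phi(s_t)^\top)-(C\tilde G(r_t)C^{-1})\otimes(\phi(s_t)\phi(s_t')^\top),\qquad b_t=\tfrac1{K+1}\Big[C\Big(\sum_{j=0}^Kg_j(r_t)-\mathbf 1_K\Big)\Big]\otimes\phi(s_t),$$ where $C\in\mathbb R^{K\times K}$ is the lower triangular all-ones matrix, $g_j(r)=\big((1-|r+\gamma x_j-x_k|/\iota_K)_+\big)_{k=0}^{K-1}$ and $\tilde G(r)$ has the columns $g_j(r)-g_K(r)$, $0\le j<K$. For even $T\ge2$ let $\bar\theta_T=(T/2+1)^{-1}\sum_{t=T/2}^T\theta_t$. Write $\log_+x=\max\{0,\log x\}$ for $x>0$ and $\log_+0=0$. **Statement.** $\mathcal L(\bar\theta_T)$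 is square integrable for every even $T\ge2$, and the following hold. (1) There is a universal constant $C_0>0$ such that for all $\varepsilon>0$ and even $T\ge2$, if $$T\ge C_0\Bigg[\frac{\|\theta^\star\|_{V_1}^2+1}{\varepsilon^2(1-\gamma)^2\lambda_{\min}}\Big(1+\frac{\alpha}{(1-\gamma)\lambda_{\min}}\Big)+\frac{\|\theta^\star\|_{V_1}+1}{\varepsilon\sqrt\alpha(1-\gamma)^{3/2}\lambda_{\min}}+\frac{1}{\alpha(1-\gamma)\lambda_{\min}}\log_+\!\Big(C_0\,\frac{\|\theta_0-\theta^\star\|_{V_2}}{\varepsilon}\cdot\frac{1}{T\sqrt\alpha(1-\gamma)\sqrt{\lambda_{\min}}}\Big(\frac1{\sqrt\alpha}+\frac1{\sqrt{(1-\gamma)\lambda_{\min}}}\Big)\Big)\Bigg],$$ then $\mathbb E^{1/2}[\mathcal L(\bar\theta_T)^2]\le\varepsilon$. (2) Consequently, with a step size $\alpha\simeq(1-\gamma)\lambda_{\min}$ the sample complexity is $\tilde O\big((\varepsilon^{-2}+\lambda_{\min}^{-1})(1-\gamma)^{-2}\lambda_{\min}^{-1}(\|\theta^\star\|_{V_1}^2+1)\big)$: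 for all $0<c_1\le c_2$ there is $C'>0$, depending only on $c_1,c_2$, such that if $c_1(1-\gamma)\lambda_{\min}\le\alpha\le c_2(1-\gamma)\lambda_{\min}$, $\varepsilon>0$ and $T\ge2$ is even with $$T\ge C'\,(\varepsilon^{-2}+\lambda_{\min}^{-1})(1-\gamma)^{-2}\lambda_{\min}^{-1}\big(\|\theta^\star\|_{V_1}^2+1\big)\log\!\Big(2+\frac{\|\theta_0-\theta^\star\|_{V_2}}{\varepsilon}\Big),$$ then $\mathbb E^{1/2}[\mathcal L(\bar\theta_T)^2]\le\varepsilon$. -/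

import Mathlib

open MeasureTheory ProbabilityTheory Set
open scoped Kronecker Matrix

namespace LinearCTD

/-- A discounted Markov decision process: `P (s, a)` is the joint law of the reward and of the
next state, rewards lie in `[0, 1]`, and `γ ∈ (0, 1)` is the discount factor. -/
structure MDP (S A : Type*) [MeasurableSpace S] [MeasurableSpace A] where
  P : Kernel (S × A) (ℝ × S)
  isMarkov : IsMarkovKernel P
  reward_mem : ∀ sa, ∀ᵐ q ∂(P sa), q.1 ∈ Icc (0 : ℝ) 1
  γ : ℝ
  γ_pos : 0 < γ
  γ_lt_one : γ < 1

attribute [instance] MDP.isMarkov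

/-- The Euclidean norm of a coordinate vector. -/
noncomputable def euclNorm {n : Type*} [Fintype n] (v : n → ℝ) : ℝ := ‖WithLp.toLp 2 v‖

/-- The weighted norm `‖v‖_B = √(vᵀ B v)`. -/
noncomputable def weightedNorm {n : Type*} [Fintype n] (B : Matrix n n ℝ) (v : n → ℝ) : ℝ :=
  √(v ⬝ᵥ (B *ᵥ v))

section Bellman

variable {S A : Type*} [MeasurableSpace S] [MeasurableSpace A]

/-- The law of `(r, s')` given `s`, where `a ∼ π(· | s)` and `(r, s') ∼ P(·, · | s, a)`. -/
noncomputable def stepKernel (M : MDP S A) (pol : Kernel S A) : Kernel S (ℝ × S) :=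
  (pol ⊗ₖ M.P).snd

/-- The transition kernel of the Markov chain of states under the policy. -/
noncomputable def stateKernel (M : MDP S A) (pol : Kernel S A) : Kernel S S :=
  (stepKernel M pol).snd

/-- The law of one sample `(s, a, r, s')` of the generative model:
`s ∼ μ`, `a ∼ π(· | s)`, `(r, s') ∼ P(·, · | s, a)`. -/
noncomputable def sampleLaw (M : MDP S A) (pol : Kernel S A) (μ : Measure S) :
    Measure (S × (A × (ℝ × S))) :=
  μ ⊗ₘ (pol ⊗ₖ M.P)

/-- `ζ` is the image of the field of signed measures `η` under the distributional Bellman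
operator: `ζ(s) = E[(b_{r,γ})_# η(s')]` with `b_{r,γ}(x) = r + γ x`, where `(r, s')` is the reward
and the next state from `s`. -/
def IsBellmanImage (M : MDP S A) (pol : Kernel S A) (η ζ : S → SignedMeasure ℝ) : Prop :=
  ∀ s, ∀ B : Set ℝ, MeasurableSet B →
    ζ s B = ∫ q, ((η q.2).map (fun x : ℝ => q.1 + M.γ * x)) B ∂(stepKernel M pol s)

end Bellman

section Distances

variable {S : Type*} [MeasurableSpace S]

/-- The cumulative distribution function `F_ν(x) = ν([0, x])`. -/
noncomputable def cdf (ν : SignedMeasure ℝ) (x : ℝ) : ℝ := ν (Icc 0 x)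

/-- The squared Cramér distance on signed measures supported in `[0, (1 - γ)⁻¹]`. -/
noncomputable def cramerSq (γ : ℝ) (ν₁ ν₂ : SignedMeasure ℝ) : ℝ :=
  ∫ x in (0 : ℝ)..(1 - γ)⁻¹, (cdf ν₁ x - cdf ν₂ x) ^ 2

/-- The `1`-Wasserstein distance on signed measures supported in `[0, (1 - γ)⁻¹]`. -/
noncomputable def wass (γ : ℝ) (ν₁ ν₂ : SignedMeasure ℝ) : ℝ :=
  ∫ x in (0 : ℝ)..(1 - γ)⁻¹, |cdf ν₁ x - cdf ν₂ x|

/-- The `μ`-weighted Cramér distance. -/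
noncomputable def cramerW (γ : ℝ) (μ : Measure S) (η₁ η₂ : S → SignedMeasure ℝ) : ℝ :=
  √(∫ s, cramerSq γ (η₁ s) (η₂ s) ∂μ)

/-- The `μ`-weighted `1`-Wasserstein distance. -/
noncomputable def wassW (γ : ℝ) (μ : Measure S) (η₁ η₂ : S → SignedMeasure ℝ) : ℝ :=
  √(∫ s, (wass γ (η₁ s) (η₂ s)) ^ 2 ∂μ)

end Distances

/-- The gap `ι_K = (K (1 - γ))⁻¹` between adjacent support points. -/
noncomputable def gap (γ : ℝ) (K : ℕ) : ℝ := ((K : ℝ) * (1 - γ))⁻¹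

/-- The support points `x_k = k ι_K`. -/
noncomputable def gridPt (γ : ℝ) (K : ℕ) (k : ℕ) : ℝ := (k : ℝ) * gap γ K

section Param

variable {S : Type*} {d K : ℕ}

/-- `F_{j-1}(s; θ)` for `0 ≤ j ≤ K + 1`, where `F_{-1} = 0`, `F_K = 1` and
`F_k(s; θ) = φ(s)ᵀ θ(k) + (k + 1) / (K + 1)` for `0 ≤ k < K`. -/
noncomputable def cdfValue (φ : S → Fin d → ℝ) (θ : Fin K × Fin d → ℝ) (s : S) (j : ℕ) : ℝ :=
  if j = 0 then 0
  else if h : j - 1 < K then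
    φ s ⬝ᵥ (fun i => θ (⟨j - 1, h⟩, i)) + (j : ℝ) / ((K : ℝ) + 1)
  else 1

/-- The linear-categorical parametrization: `η_θ(s)` is the signed measure
`∑_{k = 0}^{K} p_k(s; θ) δ_{x_k}` with `p_k = F_k - F_{k-1}`. -/
noncomputable def etaOf (γ : ℝ) (φ : S → Fin d → ℝ) (θ : Fin K × Fin d → ℝ) (s : S) :
    SignedMeasure ℝ :=
  ∑ k ∈ Finset.range (K + 1),
    (cdfValue φ θ s (k + 1) - cdfValue φ θ s k) •
      (Measure.dirac (gridPt γ K k)).toSignedMeasure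

variable {A : Type*} [MeasurableSpace S] [MeasurableSpace A]

/-- `θ` parametrizes a solution of the linear-categorical projected Bellman equation: `η_θ` is the
projection, in the `μ`-weighted Cramér distance, of the Bellman image of `η_θ` onto the space of
all linear-categorical parametrized fields. -/
def IsProjectedFixedPoint (M : MDP S A) (pol : Kernel S A) (μ : Measure S)
    (φ : S → Fin d → ℝ) (θ : Fin K × Fin d → ℝ) : Prop :=
  ∃ ζ : S → SignedMeasure ℝ, IsBellmanImage M pol (etaOf M.γ φ θ) ζ ∧
    ∀ θ' : Fin K × Fin d → ℝ,
      cramerW M.γ μ ζ (etaOf M.γ φ θ) ≤ cramerW M.γ μ ζ (etaOf M.γ φ θ')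

/-- The feature covariance matrix `Σ_φ = E_{s ∼ μ}[φ(s) φ(s)ᵀ]`. -/
noncomputable def featCov (μ : Measure S) (φ : S → Fin d → ℝ) : Matrix (Fin d) (Fin d) ℝ :=
  Matrix.of fun i j => ∫ s, φ s i * φ s j ∂μ

/-- The smallest eigenvalue of `Σ_φ`. -/
noncomputable def lamMin (μ : Measure S) (φ : S → Fin d → ℝ) : ℝ :=
  sInf (spectrum ℝ (featCov μ φ))

/-- `‖θ‖_{V₁} = (√K (1 - γ))⁻¹ ‖θ‖_{I_K ⊗ Σ_φ}`. -/
noncomputable def normV1 (γ : ℝ) (μ : Measure S) (φ : S → Fin d → ℝ)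
    (θ : Fin K × Fin d → ℝ) : ℝ :=
  1 / (√(K : ℝ) * (1 - γ)) *
    weightedNorm ((1 : Matrix (Fin K) (Fin K) ℝ) ⊗ₖ featCov μ φ) θ

/-- `‖θ‖_{V₂} = (√K (1 - γ))⁻¹ ‖θ‖`. -/
noncomputable def normV2 (γ : ℝ) (θ : Fin K × Fin d → ℝ) : ℝ :=
  1 / (√(K : ℝ) * (1 - γ)) * euclNorm θ

/-- The loss `L(θ) = W_{1,μ}(η_θ, η_{θ*})`. -/
noncomputable def loss (γ : ℝ) (μ : Measure S) (φ : S → Fin d → ℝ)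
    (θstar θ : Fin K × Fin d → ℝ) : ℝ :=
  wassW γ μ (etaOf γ φ θ) (etaOf γ φ θstar)

end Param

section Algorithm

/-- The lower triangular all-ones matrix `C`. -/
def cumMat (K : ℕ) : Matrix (Fin K) (Fin K) ℝ :=
  Matrix.of fun i j => if j ≤ i then 1 else 0

/-- `g_{j,k}(r) = (1 - |(r + γ x_j - x_k) / ι_K|)₊`. -/
noncomputable def gCoef (γ : ℝ) (K : ℕ) (r : ℝ) (j k : ℕ) : ℝ :=
  max (1 - |(r + γ * gridPt γ K j - gridPt γ K k) / gap γ K|) 0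

/-- `g_j(r) = (g_{j,k}(r))_{0 ≤ k < K}`. -/
noncomputable def gVec (γ : ℝ) (K : ℕ) (r : ℝ) (j : ℕ) : Fin K → ℝ :=
  fun k => gCoef γ K r j k

/-- `G̃(r)`, whose columns are `g_j(r) - g_K(r)` for `0 ≤ j < K`. -/
noncomputable def gTilde (γ : ℝ) (K : ℕ) (r : ℝ) : Matrix (Fin K) (Fin K) ℝ :=
  Matrix.of fun k j => gVec γ K r j k - gVec γ K r K k

variable {S A : Type*} {d K : ℕ}

/-- `A = I_K ⊗ (φ(s) φ(s)ᵀ) - (C G̃(r) C⁻¹) ⊗ (φ(s) φ(s')ᵀ)` for a sample `(s, a, r, s')`. -/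
noncomputable def updMat (γ : ℝ) (K : ℕ) (φ : S → Fin d → ℝ) (x : S × (A × (ℝ × S))) :
    Matrix (Fin K × Fin d) (Fin K × Fin d) ℝ :=
  (1 : Matrix (Fin K) (Fin K) ℝ) ⊗ₖ Matrix.vecMulVec (φ x.1) (φ x.1) -
    (cumMat K * gTilde γ K x.2.2.1 * (cumMat K)⁻¹) ⊗ₖ
      Matrix.vecMulVec (φ x.1) (φ x.2.2.2)

/-- `b = (K + 1)⁻¹ [C (∑_{j = 0}^{K} g_j(r) - 1_K)] ⊗ φ(s)` for a sample `(s, a, r, s')`. -/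
noncomputable def updVec (γ : ℝ) (K : ℕ) (φ : S → Fin d → ℝ) (x : S × (A × (ℝ × S))) :
    Fin K × Fin d → ℝ :=
  fun ki => ((K : ℝ) + 1)⁻¹ *
    (cumMat K *ᵥ ((∑ j ∈ Finset.range (K + 1), gVec γ K x.2.2.1 j) - 1)) ki.1 * φ x.1 ki.2

/-- The iterates of `Linear-CTD`: `θ_t = θ_{t-1} - α (A_t θ_{t-1} - b_t)` for `t ≥ 1`, where
`(A_t, b_t)` is computed from the `t`-th sample `X t`. -/
noncomputable def iterate (γ α : ℝ) (φ : S → Fin d → ℝ) (θ₀ : Fin K × Fin d → ℝ)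
    (X : ℕ → S × (A × (ℝ × S))) : ℕ → Fin K × Fin d → ℝ
  | 0 => θ₀
  | t + 1 =>
    iterate γ α φ θ₀ X t -
      α • (updMat γ K φ (X (t + 1)) *ᵥ iterate γ α φ θ₀ X t - updVec γ K φ (X (t + 1)))

/-- The tail average `θ̄_T = (T / 2 + 1)⁻¹ ∑_{t = T/2}^{T} θ_t`, used for even `T`. -/
noncomputable def tailAvg (γ α : ℝ) (φ : S → Fin d → ℝ) (θ₀ : Fin K × Fin d → ℝ)
    (X : ℕ → S × (A × (ℝ × S))) (T : ℕ) : Fin K × Fin d → ℝ :=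
  ((T : ℝ) / 2 + 1)⁻¹ • ∑ t ∈ Finset.Icc (T / 2) T, iterate γ α φ θ₀ X t

end Algorithm

end LinearCTD

open LinearCTD

universe u v w

/-!
`Linear-CTD` is stochastic approximation for the linear system `𝔼[A] θ = 𝔼[b]`, and three facts
about this system give the result.

* The matrix `C G̃(r) C⁻¹` acts on differences of distribution functions, given by their values on
  the cells of the grid: `ramp (k + 1 - u)` is the mean of the distribution function of `δ_u` over
  the `k`-th cell, and the entries of the matrix are the differences `ramp (k + 1 - u_j) - ramp (k + 1 - u_{j+1})`
  along the shifted support points `u_j` (`cumMat_conj_gTilde`). They are nonnegative, the rows sum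
  to at most `1` and the columns to `γ`, so Schur's test bounds the operator norm by `√γ`
  (`sum_sq_transMat_mulVec_le`). As `μ` is stationary, `φ(s)` and `φ(s')` have the same law, hence
  `⟪θ, 𝔼[A] θ⟫ ≥ (1 - √γ) ‖θ‖²` and `𝔼 ‖A θ‖² ≤ 4 ‖θ‖²` in the norm on the right given by
  `I ⊗ Σ_φ` (`isStableNoise`). No factor of `K` is lost.
* The residual `b - A θ⋆` is centred (`integral_residual_eq_zero`). By summation by parts it is the
  mean over the cells of the difference between the distribution functions of the Bellman backup
  and `η_{θ⋆}`, times `φ(s)`; its expectation is, up to a factor, the gradient at `θ⋆` of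
  the quadratic function that `θ⋆` minimizes. As `|b|² ≤ 4 K (1 - γ)²`, the residual has second moment
  `O(K (1 - γ)² (‖θ⋆‖_{V₁}² + 1))`.
* By the Cauchy–Schwarz inequality, the squared loss is at most the form of `I ⊗ Σ_φ` at
  `θ - θ⋆`, divided by `K (1 - γ)²` (`loss_sq_le`).

For the tail average (`IsErrorProcess.integral_form_average_le`), the recursion is summed over the
window: the mean operator applied to the sum of the errors is `α⁻¹` times the difference of the end
points plus a martingale. The mean squared error of an iterate decays geometrically to the
stationary level, and a Lyapunov function that combines the squared error and the squared martingale
bounds the latter. Coercivity of the mean operator turns this into a bound on the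
averaged error (`integral_loss_sq_le`). The sample size in part (1) makes each of its three terms at
most `ε² / 3` (`error_bound_le`). Part (2) follows from part (1), since for `α` of order
`(1 - γ) λ_min` its sample size dominates that of part (1) (`sample_size_le`).
-/

namespace LinearCTD

set_option linter.unusedSectionVars false

/-! ### The matrix `C G̃(r) C⁻¹` -/

/-- The clamp of a real number to `[0, 1]`. For a point `u` of `[0, K]`, in units of the gap,
`ramp (k + 1 - u)` is the value on the `k`-th cell of the distribution function of the projection
of `δ_u` to the grid. -/
noncomputable def ramp (y : ℝ) : ℝ := max 0 (min 1 y)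

lemma ramp_nonneg (y : ℝ) : 0 ≤ ramp y := le_max_left _ _

lemma ramp_le_one (y : ℝ) : ramp y ≤ 1 := max_le zero_le_one (min_le_left _ _)

lemma ramp_mono : Monotone ramp := fun _ _ h => max_le_max le_rfl (min_le_min le_rfl h)

lemma ramp_of_nonpos {y : ℝ} (h : y ≤ 0) : ramp y = 0 := by
  rw [ramp, max_eq_left]; exact (min_le_right _ _).trans h

lemma ramp_of_one_le {y : ℝ} (h : 1 ≤ y) : ramp y = 1 := by
  rw [ramp, min_eq_left h, max_eq_right zero_le_one]

lemma ramp_add_tent (y : ℝ) : ramp y + max (1 - |y|) 0 = ramp (y + 1) := by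
  unfold ramp
  rcases abs_cases y with ⟨h, h'⟩ | ⟨h, h'⟩ <;> rw [h] <;>
  simp only [max_def, min_def] <;> split_ifs <;> linarith

/-- The first `k + 1` tent coefficients of the point `u` telescope to the distribution function of
its projection. -/
lemma sum_tent {u : ℝ} (hu : 0 ≤ u) (k : ℕ) :
    ∑ l ∈ Finset.range (k + 1), max (1 - |u - l|) 0 = ramp (k + 1 - u) := by
  induction k with
  | zero =>
    have := ramp_add_tent (-u)
    rw [ramp_of_nonpos (by linarith)] at this
    simp only [zero_add, Finset.range_one, Finset.sum_singleton, Nat.cast_zero, sub_zero]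
    rw [abs_neg] at this
    rw [← zero_add (max _ _), this]; ring_nf
  | succ n ih =>
    rw [Finset.sum_range_succ, ih, abs_sub_comm]
    have := ramp_add_tent ((n + 1 : ℕ) - u)
    push_cast at this ⊢
    rw [this]; ring_nf

lemma sum_ramp_cell {u : ℝ} (hu : 0 ≤ u) (n : ℕ) :
    ∑ k ∈ Finset.range n, ramp (k + 1 - u) = max 0 (n - u) := by
  induction n with
  | zero => simp [hu]
  | succ n ih =>
    rw [Finset.sum_range_succ, ih]
    unfold ramp
    push_cast
    simp only [max_def, min_def]; split_ifs <;> linarith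

lemma sum_ramp_nat (m n : ℕ) :
    ∑ j ∈ Finset.range n, ramp ((m : ℝ) - j) = (min m n : ℕ) := by
  induction n with
  | zero => simp
  | succ n ih =>
    rw [Finset.sum_range_succ, ih]
    rcases le_or_gt m n with h | h
    · rw [ramp_of_nonpos (by simpa using h), min_eq_left h, min_eq_left (by omega), add_zero]
    · have h1 : (n : ℝ) + 1 ≤ m := by exact_mod_cast h
      rw [ramp_of_one_le (by linarith), min_eq_right h.le, min_eq_right (by omega)]
      push_cast; rfl

/-- The position `(r + γ x_j) / ι_K` of the shifted support point, in units of the gap. -/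
noncomputable def shiftPos (γ : ℝ) (K : ℕ) (r : ℝ) (j : ℕ) : ℝ :=
  r * (K * (1 - γ)) + γ * j

section

variable {γ r : ℝ} {K : ℕ}

lemma gCoef_eq (hK : 0 < (K : ℝ) * (1 - γ)) (j k : ℕ) :
    gCoef γ K r j k = max (1 - |shiftPos γ K r j - k|) 0 := by
  have e : (r + γ * gridPt γ K j - gridPt γ K k) / gap γ K = shiftPos γ K r j - k := by
    unfold gridPt gap shiftPos
    rw [div_inv_eq_mul]
    have := mul_inv_cancel₀ hK.ne'
    linear_combination (γ * j - k) * this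
  rw [gCoef, e]

lemma shiftPos_nonneg (hK : 0 < (K : ℝ) * (1 - γ)) (hγ : 0 ≤ γ) (hr : 0 ≤ r) (j : ℕ) :
    0 ≤ shiftPos γ K r j := by
  unfold shiftPos; positivity

lemma shiftPos_le (hK : 0 < (K : ℝ) * (1 - γ)) (hγ : 0 ≤ γ) (hr : r ≤ 1) {j : ℕ} (hj : j ≤ K) :
    shiftPos γ K r j ≤ K := by
  unfold shiftPos
  have h : (j : ℝ) ≤ K := by exact_mod_cast hj
  nlinarith

lemma shiftPos_mono (hγ : 0 ≤ γ) : Monotone (shiftPos γ K r) := by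
  intro i j h
  unfold shiftPos
  have h : (i : ℝ) ≤ j := by exact_mod_cast h
  nlinarith

/-- The matrix with the entries `F_k(δ_{u_j}) - F_k(δ_{u_{j+1}})`, where `F_k(δ_u)` is the value
on the `k`-th cell of the distribution function of the projection of `δ_u` to the grid, and `u_j`
are the shifted support points. It is the matrix `C G̃(r) C⁻¹`. -/
noncomputable def transMat (γ : ℝ) (K : ℕ) (r : ℝ) : Matrix (Fin K) (Fin K) ℝ :=
  Matrix.of fun k j =>
    ramp (k + 1 - shiftPos γ K r j) - ramp (k + 1 - shiftPos γ K r (j + 1))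

lemma cumMat_mulVec (v : Fin K → ℝ) (f : ℕ → ℝ) (hv : ∀ l : Fin K, v l = f l) (k : Fin K) :
    (cumMat K *ᵥ v) k = ∑ l ∈ Finset.range (k + 1), f l := by
  have h1 : (cumMat K *ᵥ v) k = ∑ l : Fin K, if (l : ℕ) ≤ k then f l else 0 := by
    simp only [Matrix.mulVec, dotProduct, cumMat, Matrix.of_apply, ite_mul, one_mul, zero_mul,
      Fin.le_def, hv]
  rw [h1, Fin.sum_univ_eq_sum_range (fun l => if l ≤ (k : ℕ) then f l else 0) K,
    ← Finset.sum_filter]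
  congr 1
  ext l; simp only [Finset.mem_filter, Finset.mem_range]; omega

lemma cumMat_mulVec_gVec (hK : 0 < (K : ℝ) * (1 - γ)) (hγ : 0 ≤ γ) (hr : 0 ≤ r) (j : ℕ)
    (k : Fin K) :
    (cumMat K *ᵥ gVec γ K r j) k = ramp (k + 1 - shiftPos γ K r j) := by
  rw [cumMat_mulVec (gVec γ K r j) (fun l => gCoef γ K r j l) (fun _ => rfl),
    ← sum_tent (shiftPos_nonneg hK hγ hr j)]
  simp only [gCoef_eq hK]

lemma isUnit_det_cumMat (K : ℕ) : IsUnit (cumMat K).det := by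
  rw [Matrix.det_of_isLowerTriangular]
  · simp [cumMat]
  · intro i j h
    have : i < j := h
    simp [cumMat, not_le.mpr this]

/-- The relation `(C G̃) = (C G̃ C⁻¹) C`, without the inverse: the `j`-th column on either side is
`C (g_j - g_K)`, which on the right is a telescoping sum over `i ≥ j`. -/
lemma cumMat_mul_gTilde (hK : 0 < (K : ℝ) * (1 - γ)) (hγ : 0 ≤ γ) (hr : 0 ≤ r) :
    cumMat K * gTilde γ K r = transMat γ K r * cumMat K := by
  ext k j
  have h1 : (cumMat K * gTilde γ K r) k j
      = (cumMat K *ᵥ gVec γ K r j) k - (cumMat K *ᵥ gVec γ K r K) k := by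
    simp only [Matrix.mul_apply, Matrix.mulVec, dotProduct, gTilde, Matrix.of_apply, mul_sub,
      Finset.sum_sub_distrib]
  have h2 : (transMat γ K r * cumMat K) k j = ∑ i ∈ Finset.Ico (j : ℕ) K,
      (ramp (k + 1 - shiftPos γ K r i) - ramp (k + 1 - shiftPos γ K r (i + 1))) := by
    simp only [Matrix.mul_apply, transMat, cumMat, Matrix.of_apply, mul_ite, mul_one, mul_zero,
      Fin.le_def]
    rw [Fin.sum_univ_eq_sum_range (fun i => if (j : ℕ) ≤ i then
      (ramp (k + 1 - shiftPos γ K r i) - ramp (k + 1 - shiftPos γ K r (i + 1))) else 0) K,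
      ← Finset.sum_filter]
    congr 1
    ext l; simp only [Finset.mem_filter, Finset.mem_range, Finset.mem_Ico]; omega
  rw [h1, h2, cumMat_mulVec_gVec hK hγ hr, cumMat_mulVec_gVec hK hγ hr]
  have h3 := Finset.sum_Ico_sub (fun i => ramp (k + 1 - shiftPos γ K r i)) j.2.le
  rw [← neg_sub, ← h3, ← Finset.sum_neg_distrib]
  simp

lemma cumMat_conj_gTilde (hK : 0 < (K : ℝ) * (1 - γ)) (hγ : 0 ≤ γ) (hr : 0 ≤ r) :
    cumMat K * gTilde γ K r * (cumMat K)⁻¹ = transMat γ K r := by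
  rw [cumMat_mul_gTilde hK hγ hr, Matrix.mul_assoc, Matrix.mul_nonsing_inv _ (isUnit_det_cumMat K),
    Matrix.mul_one]

/-- The squared operator norm of `C G̃(r) C⁻¹` is at most `γ`, by Schur's test: its entries are
nonnegative, its rows sum to at most `1` and its columns to `γ`. -/
lemma sum_sq_transMat_mulVec_le (hK : 0 < (K : ℝ) * (1 - γ)) (hγ : 0 ≤ γ) (hr : r ∈ Icc (0 : ℝ) 1)
    (w : Fin K → ℝ) :
    ∑ k, (transMat γ K r *ᵥ w) k ^ 2 ≤ γ * ∑ k, w k ^ 2 := by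
  have hnn : ∀ k j, 0 ≤ transMat γ K r k j := fun k j => by
    simp only [transMat, Matrix.of_apply, sub_nonneg]
    exact ramp_mono (by linarith [shiftPos_mono (K := K) (r := r) hγ (Nat.le_succ j)])
  have hrow : ∀ k, ∑ j, transMat γ K r k j ≤ 1 := fun k => by
    simp only [transMat, Matrix.of_apply]
    rw [Fin.sum_univ_eq_sum_range (fun j => ramp (k + 1 - shiftPos γ K r j) -
      ramp (k + 1 - shiftPos γ K r (j + 1))) K, Finset.sum_range_sub']
    linarith [ramp_nonneg (k + 1 - shiftPos γ K r K), ramp_le_one (k + 1 - shiftPos γ K r 0)]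
  have hcol : ∀ j, ∑ k, transMat γ K r k j = γ := fun j => by
    simp only [transMat, Matrix.of_apply, Finset.sum_sub_distrib]
    rw [Fin.sum_univ_eq_sum_range (fun k => ramp (k + 1 - shiftPos γ K r j)) K,
      Fin.sum_univ_eq_sum_range (fun k => ramp (k + 1 - shiftPos γ K r (j + 1))) K,
      sum_ramp_cell (shiftPos_nonneg hK hγ hr.1 _), sum_ramp_cell (shiftPos_nonneg hK hγ hr.1 _),
      max_eq_right (sub_nonneg.2 (shiftPos_le hK hγ hr.2 j.2.le)),
      max_eq_right (sub_nonneg.2 (shiftPos_le hK hγ hr.2 j.2))]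
    unfold shiftPos; push_cast; ring
  have hcs : ∀ k, (transMat γ K r *ᵥ w) k ^ 2 ≤ ∑ j, transMat γ K r k j * w j ^ 2 := fun k => by
    have h := Finset.sum_sq_le_sum_mul_sum_of_sq_le_mul Finset.univ
      (r := fun j => transMat γ K r k j * w j) (f := fun j => transMat γ K r k j)
      (g := fun j => transMat γ K r k j * w j ^ 2) (fun j _ => hnn k j)
      (fun j _ => mul_nonneg (hnn k j) (sq_nonneg _)) (fun j _ => le_of_eq (by ring))
    refine h.trans (mul_le_of_le_one_left ?_ (hrow k))
    exact Finset.sum_nonneg fun j _ => mul_nonneg (hnn k j) (sq_nonneg _)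
  calc ∑ k, (transMat γ K r *ᵥ w) k ^ 2 ≤ ∑ k, ∑ j, transMat γ K r k j * w j ^ 2 :=
        Finset.sum_le_sum fun k _ => hcs k
    _ = ∑ j, (∑ k, transMat γ K r k j) * w j ^ 2 := by
        rw [Finset.sum_comm]; simp only [Finset.sum_mul]
    _ = γ * ∑ k, w k ^ 2 := by simp only [hcol, Finset.mul_sum]

lemma cumMat_mulVec_sum_gVec (hK : 0 < (K : ℝ) * (1 - γ)) (hγ : 0 ≤ γ) (hr : 0 ≤ r) (k : Fin K) :
    (cumMat K *ᵥ ((∑ j ∈ Finset.range (K + 1), gVec γ K r j) - 1)) k =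
      ∑ j ∈ Finset.range (K + 1), ramp (k + 1 - shiftPos γ K r j) - (k + 1) := by
  rw [Matrix.mulVec_sub, Pi.sub_apply, Matrix.mulVec_sum, Finset.sum_apply,
    cumMat_mulVec 1 (fun _ => 1) (fun _ => rfl)]
  simp only [cumMat_mulVec_gVec hK hγ hr]
  simp

/-- The image of the uniform distribution on the grid is within `O(1 - γ)` of it: each support
point moves by at most `K (1 - γ)` cells. -/
lemma abs_cumMat_mulVec_sum_gVec_le (hK : 1 ≤ (K : ℝ) * (1 - γ)) (hγ : 0 ≤ γ) (hγ1 : γ < 1)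
    (hr : r ∈ Icc (0 : ℝ) 1) (k : Fin K) :
    |(cumMat K *ᵥ ((∑ j ∈ Finset.range (K + 1), gVec γ K r j) - 1)) k| ≤ 2 * (K * (1 - γ)) := by
  have hK0 : 0 < (K : ℝ) * (1 - γ) := by linarith
  rw [cumMat_mulVec_sum_gVec hK0 hγ hr.1]
  -- The sum is compared with those for the grid shifted by `±L` whole cells, which are explicit
  -- because the ramps are `0` or `1` there.
  set L := ⌈(K : ℝ) * (1 - γ)⌉₊
  have hL1 : (K : ℝ) * (1 - γ) ≤ L := Nat.le_ceil _
  have hL2 : (L : ℝ) ≤ 2 * (K * (1 - γ)) := by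
    have := (Nat.ceil_lt_add_one hK0.le).le
    change (L : ℝ) ≤ _ at this
    linarith
  have hpos : ∀ j ∈ Finset.range (K + 1), |shiftPos γ K r j - j| ≤ L := fun j hj => by
    have hj : (j : ℝ) ≤ K := by exact_mod_cast Nat.lt_succ_iff.1 (Finset.mem_range.1 hj)
    have e : shiftPos γ K r j - j = r * (K * (1 - γ)) - (1 - γ) * j := by unfold shiftPos; ring
    have h0 : 0 ≤ (1 - γ) * (j : ℝ) := mul_nonneg (by linarith) (by positivity)
    have h1 : (1 - γ) * (j : ℝ) ≤ K * (1 - γ) := by nlinarith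
    have h2 : 0 ≤ r * (K * (1 - γ)) := mul_nonneg hr.1 hK0.le
    have h3 : r * (K * (1 - γ)) ≤ K * (1 - γ) := mul_le_of_le_one_left hK0.le hr.2
    rw [e, abs_le]; constructor <;> linarith
  refine le_trans (abs_le.2 ⟨?_, ?_⟩) hL2
  · rcases le_total L (k + 1) with h | h
    · have h1 : ∑ j ∈ Finset.range (K + 1), ramp (((k + 1 - L : ℕ) : ℝ) - j) ≤
          ∑ j ∈ Finset.range (K + 1), ramp (k + 1 - shiftPos γ K r j) :=
        Finset.sum_le_sum fun j hj => ramp_mono (by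
          have := (abs_le.1 (hpos j hj)).2
          push_cast [Nat.cast_sub h]; linarith)
      rw [sum_ramp_nat, min_eq_left (by have := k.2; omega)] at h1
      push_cast [Nat.cast_sub h] at h1
      linarith
    · have h1 : (k : ℝ) + 1 ≤ L := by exact_mod_cast h
      have h2 : 0 ≤ ∑ j ∈ Finset.range (K + 1), ramp (k + 1 - shiftPos γ K r j) :=
        Finset.sum_nonneg fun _ _ => ramp_nonneg _
      linarith
  · have h1 : ∑ j ∈ Finset.range (K + 1), ramp (k + 1 - shiftPos γ K r j) ≤
        ∑ j ∈ Finset.range (K + 1), ramp (((k + 1 + L : ℕ) : ℝ) - j) :=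
      Finset.sum_le_sum fun j hj => ramp_mono (by
        have := (abs_le.1 (hpos j hj)).1
        push_cast; linarith)
    rw [sum_ramp_nat] at h1
    have h2 : ((min (k + 1 + L) (K + 1) : ℕ) : ℝ) ≤ (k + 1 + L : ℕ) := by
      exact_mod_cast min_le_left _ _
    push_cast at h1 h2
    linarith

end

/-! ### Averaged linear stochastic approximation -/

section StochasticApproximation

variable {𝒳 E : Type*} [MeasurableSpace 𝒳] [NormedAddCommGroup E] [InnerProductSpace ℝ E]
  [CompleteSpace E] [SecondCountableTopology E] [MeasurableSpace E] [BorelSpace E]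

/-- The random linear operator `A x` and the centred noise `ξ x`, where `x ∼ ρ`, are bounded by
`c`, and the mean of `A` dominates the quadratic form `q` up to the factor `κ`, which in turn
controls the second moment of `A` and lies between `lam ‖·‖²` and `‖·‖²`. The noise has second
moment at most `v`. The bound `c` only serves integrability and enters no estimate. -/
structure IsStableNoise (ρ : Measure 𝒳) (A : 𝒳 → E →ₗ[ℝ] E) (ξ : 𝒳 → E) (q : E → ℝ)
    (κ lam v c : ℝ) : Prop where
  measurable_op : Measurable fun p : 𝒳 × E => A p.1 p.2
  measurable_noise : Measurable ξ
  norm_op_le : ∀ᵐ x ∂ρ, ∀ u, ‖A x u‖ ≤ c * ‖u‖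
  norm_noise_le : ∀ᵐ x ∂ρ, ‖ξ x‖ ≤ c
  integral_noise : ∫ x, ξ x ∂ρ = 0
  integral_noise_sq_le : ∫ x, ‖ξ x‖ ^ 2 ∂ρ ≤ v
  measurable_form : Measurable q
  form_le : ∀ u, q u ≤ ‖u‖ ^ 2
  le_form : ∀ u, lam * ‖u‖ ^ 2 ≤ q u
  mul_form_le : ∀ u, κ * q u ≤ ∫ x, inner ℝ u (A x u) ∂ρ
  integral_op_sq_le : ∀ u, ∫ x, ‖A x u‖ ^ 2 ∂ρ ≤ 4 * q u

lemma integrable_of_norm_le {Ω : Type*} [MeasurableSpace Ω] {P : Measure Ω} [IsFiniteMeasure P]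
    {f : Ω → E} (hf : Measurable f) (h : ∃ R : ℝ, ∀ᵐ ω ∂P, ‖f ω‖ ≤ R) : Integrable f P :=
  h.elim fun R hR => .of_bound hf.aestronglyMeasurable R hR

lemma integrable_norm_sq_of_norm_le {Ω : Type*} [MeasurableSpace Ω] {P : Measure Ω}
    [IsFiniteMeasure P] {f : Ω → E} (hf : Measurable f) (h : ∃ R : ℝ, ∀ᵐ ω ∂P, ‖f ω‖ ≤ R) :
    Integrable (fun ω => ‖f ω‖ ^ 2) P := by
  obtain ⟨R, hR⟩ := h
  refine .of_bound (hf.norm.pow_const 2).aestronglyMeasurable (R ^ 2) ?_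
  filter_upwards [hR] with ω h
  rw [Real.norm_of_nonneg (by positivity)]
  gcongr

section OneStep

namespace IsStableNoise

variable {ρ : Measure 𝒳} [IsProbabilityMeasure ρ] {A : 𝒳 → E →ₗ[ℝ] E} {ξ : 𝒳 → E} {q : E → ℝ}
  {κ lam v c : ℝ} (h : IsStableNoise ρ A ξ q κ lam v c)

include h

lemma measurable_op_apply (u : E) : Measurable fun x => A x u :=
  h.measurable_op.comp (measurable_id.prodMk measurable_const)

lemma op_bound (u : E) : ∃ R : ℝ, ∀ᵐ x ∂ρ, ‖A x u‖ ≤ R :=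
  ⟨_, h.norm_op_le.mono fun _ hx => hx u⟩

lemma integrable_op (u : E) : Integrable (fun x => A x u) ρ :=
  integrable_of_norm_le (h.measurable_op_apply u) (h.op_bound u)

lemma integrable_noise : Integrable ξ ρ :=
  integrable_of_norm_le h.measurable_noise ⟨_, h.norm_noise_le⟩

lemma integrable_op_sq (u : E) : Integrable (fun x => ‖A x u‖ ^ 2) ρ :=
  integrable_norm_sq_of_norm_le (h.measurable_op_apply u) (h.op_bound u)

lemma integrable_noise_sq : Integrable (fun x => ‖ξ x‖ ^ 2) ρ :=
  integrable_norm_sq_of_norm_le h.measurable_noise ⟨_, h.norm_noise_le⟩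

lemma step_bound (α : ℝ) (u : E) :
    ∃ R : ℝ, ∀ᵐ x ∂ρ, ‖u - α • (A x u - ξ x)‖ ≤ R := by
  refine ⟨‖u‖ + |α| * (c * ‖u‖ + c), ?_⟩
  filter_upwards [h.norm_op_le, h.norm_noise_le] with x h1 h2
  refine (norm_sub_le _ _).trans ?_
  rw [norm_smul, Real.norm_eq_abs]
  have := (norm_sub_le (A x u) (ξ x)).trans (add_le_add (h1 u) h2)
  gcongr

/-- One step of the iteration decreases the mean squared error, up to the noise. -/
lemma integral_step_sq_le {α : ℝ} (hα : 0 ≤ α) (hακ : 8 * α ≤ κ) (hlam : 0 ≤ lam) (u : E) :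
    ∫ x, ‖u - α • (A x u - ξ x)‖ ^ 2 ∂ρ ≤ ‖u‖ ^ 2 - α * κ * q u + 2 * α ^ 2 * v := by
  have hq : 0 ≤ q u := le_trans (by positivity) (h.le_form u)
  have i1 : Integrable (fun x => inner ℝ u (A x u)) ρ := (h.integrable_op u).const_inner u
  have i2 : Integrable (fun x => inner ℝ u (ξ x)) ρ := h.integrable_noise.const_inner u
  have hm : Measurable fun x => u - α • (A x u - ξ x) :=
    measurable_const.sub (((h.measurable_op_apply u).sub h.measurable_noise).const_smul α)
  have e0 : Integrable (fun x => ‖u‖ ^ 2 - 2 * α * inner ℝ u (A x u)) ρ :=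
    (integrable_const _).sub (i1.const_mul _)
  have e1 : Integrable (fun x => ‖u‖ ^ 2 - 2 * α * inner ℝ u (A x u) +
      2 * α * inner ℝ u (ξ x)) ρ := e0.add (i2.const_mul _)
  have e2 : Integrable (fun x => ‖u‖ ^ 2 - 2 * α * inner ℝ u (A x u) + 2 * α * inner ℝ u (ξ x) +
      2 * α ^ 2 * ‖A x u‖ ^ 2) ρ := e1.add ((h.integrable_op_sq u).const_mul _)
  calc ∫ x, ‖u - α • (A x u - ξ x)‖ ^ 2 ∂ρ
      ≤ ∫ x, (‖u‖ ^ 2 - 2 * α * inner ℝ u (A x u) + 2 * α * inner ℝ u (ξ x) +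
          2 * α ^ 2 * ‖A x u‖ ^ 2 + 2 * α ^ 2 * ‖ξ x‖ ^ 2) ∂ρ := by
        refine integral_mono (integrable_norm_sq_of_norm_le hm (h.step_bound α u))
          (e2.add (h.integrable_noise_sq.const_mul _)) fun x => ?_
        have hs := norm_sub_sq_real u (α • (A x u - ξ x))
        rw [inner_smul_right, inner_sub_right, norm_smul, mul_pow, Real.norm_eq_abs, sq_abs] at hs
        have h2 : ‖A x u - ξ x‖ ^ 2 ≤ 2 * ‖A x u‖ ^ 2 + 2 * ‖ξ x‖ ^ 2 := by
          have := norm_sub_le (A x u) (ξ x)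
          nlinarith [sq_nonneg (‖A x u‖ - ‖ξ x‖), norm_nonneg (A x u - ξ x)]
        simp only
        rw [hs]
        nlinarith [mul_le_mul_of_nonneg_left h2 (sq_nonneg α)]
    _ = ‖u‖ ^ 2 - 2 * α * ∫ x, inner ℝ u (A x u) ∂ρ + 2 * α ^ 2 * ∫ x, ‖A x u‖ ^ 2 ∂ρ +
          2 * α ^ 2 * ∫ x, ‖ξ x‖ ^ 2 ∂ρ := by
        rw [integral_add e2 (h.integrable_noise_sq.const_mul _),
          integral_add e1 ((h.integrable_op_sq u).const_mul _),
          integral_add e0 (i2.const_mul _), integral_sub (integrable_const _) (i1.const_mul _)]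
        simp only [integral_const_mul]
        rw [integral_inner h.integrable_noise, h.integral_noise, inner_zero_right]
        simp
    _ ≤ ‖u‖ ^ 2 - α * κ * q u + 2 * α ^ 2 * v := by
        have h1 := mul_le_mul_of_nonneg_left (h.mul_form_le u) hα
        have h2 := mul_le_mul_of_nonneg_left (h.integral_op_sq_le u) (sq_nonneg α)
        have h3 := mul_le_mul_of_nonneg_left h.integral_noise_sq_le (sq_nonneg α)
        have h4 := mul_le_mul_of_nonneg_right hακ (mul_nonneg hα hq)
        nlinarith

lemma increment_bound (u : E) :
    ∃ R : ℝ, ∀ᵐ x ∂ρ, ‖(∫ y, A y u ∂ρ) - A x u + ξ x‖ ≤ R := by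
  refine ⟨‖∫ y, A y u ∂ρ‖ + c * ‖u‖ + c, ?_⟩
  filter_upwards [h.norm_op_le, h.norm_noise_le] with x h1 h2
  exact (norm_add_le _ _).trans (add_le_add ((norm_sub_le _ _).trans
    (add_le_add le_rfl (h1 u))) h2)

/-- The centred increment is orthogonal to the past `s`, and its second moment is bounded through
the quadratic form. -/
lemma integral_add_increment_sq_le (u s : E) :
    ∫ x, ‖s + ((∫ y, A y u ∂ρ) - A x u + ξ x)‖ ^ 2 ∂ρ ≤ ‖s‖ ^ 2 + 2 * v + 8 * q u := by
  set a := ∫ y, A y u ∂ρ with ha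
  -- The variance of `A u` is bounded by its second moment: `-2 ‖a‖²` is dropped after the
  -- integration.
  have i1 : Integrable (fun x => a - A x u + ξ x) ρ :=
    ((integrable_const a).sub (h.integrable_op u)).add h.integrable_noise
  have hz : ∫ x, (a - A x u + ξ x) ∂ρ = 0 := by
    have e : Integrable (fun x => a - A x u) ρ := (integrable_const a).sub (h.integrable_op u)
    rw [integral_add e h.integrable_noise, integral_sub (integrable_const a) (h.integrable_op u),
      h.integral_noise]
    simp [← ha]
  have i2 : Integrable (fun x => inner ℝ s (a - A x u + ξ x)) ρ := i1.const_inner s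
  have i3 : Integrable (fun x => inner ℝ a (A x u)) ρ := (h.integrable_op u).const_inner a
  have hm : Measurable fun x => s + (a - A x u + ξ x) :=
    measurable_const.add ((measurable_const.sub (h.measurable_op_apply u)).add h.measurable_noise)
  have hb : ∃ R : ℝ, ∀ᵐ x ∂ρ, ‖s + (a - A x u + ξ x)‖ ≤ R := by
    obtain ⟨R, hR⟩ := h.increment_bound u
    exact ⟨‖s‖ + R, hR.mono fun x hx => (norm_add_le _ _).trans (add_le_add le_rfl hx)⟩
  have e0 : Integrable (fun x => ‖s‖ ^ 2 + 2 * inner ℝ s (a - A x u + ξ x)) ρ :=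
    (integrable_const _).add (i2.const_mul _)
  have e1 : Integrable (fun x => ‖s‖ ^ 2 + 2 * inner ℝ s (a - A x u + ξ x) +
      2 * ‖ξ x‖ ^ 2) ρ := e0.add (h.integrable_noise_sq.const_mul _)
  have e2 : Integrable (fun x => ‖s‖ ^ 2 + 2 * inner ℝ s (a - A x u + ξ x) +
      2 * ‖ξ x‖ ^ 2 + 2 * ‖A x u‖ ^ 2) ρ := e1.add ((h.integrable_op_sq u).const_mul _)
  have e3 : Integrable (fun x => 2 * ‖a‖ ^ 2 - 4 * inner ℝ a (A x u)) ρ :=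
    (integrable_const _).sub (i3.const_mul _)
  calc ∫ x, ‖s + (a - A x u + ξ x)‖ ^ 2 ∂ρ
      ≤ ∫ x, (‖s‖ ^ 2 + 2 * inner ℝ s (a - A x u + ξ x) + 2 * ‖ξ x‖ ^ 2 + 2 * ‖A x u‖ ^ 2 +
          (2 * ‖a‖ ^ 2 - 4 * inner ℝ a (A x u))) ∂ρ := by
        refine integral_mono (integrable_norm_sq_of_norm_le hm hb) (e2.add e3) fun x => ?_
        have h1 := norm_add_sq_real s (a - A x u + ξ x)
        have h2 := norm_sub_sq_real a (A x u)
        have h3 : ‖a - A x u + ξ x‖ ^ 2 ≤ 2 * ‖a - A x u‖ ^ 2 + 2 * ‖ξ x‖ ^ 2 := by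
          have := norm_add_le (a - A x u) (ξ x)
          nlinarith [sq_nonneg (‖a - A x u‖ - ‖ξ x‖), norm_nonneg (a - A x u + ξ x)]
        simp only
        linarith
    _ = ‖s‖ ^ 2 + 2 * ∫ x, ‖ξ x‖ ^ 2 ∂ρ + 2 * ∫ x, ‖A x u‖ ^ 2 ∂ρ - 2 * ‖a‖ ^ 2 := by
        rw [integral_add e2 e3, integral_add e1 ((h.integrable_op_sq u).const_mul _),
          integral_add e0 (h.integrable_noise_sq.const_mul _),
          integral_add (integrable_const _) (i2.const_mul _),
          integral_sub (integrable_const _) (i3.const_mul _)]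
        simp only [integral_const_mul]
        rw [integral_inner i1, hz, inner_zero_right, integral_inner (h.integrable_op u), ← ha,
          real_inner_self_eq_norm_sq]
        simp only [integral_const, probReal_univ, smul_eq_mul, one_mul]
        ring
    _ ≤ ‖s‖ ^ 2 + 2 * v + 8 * q u := by
        have h2 := h.integral_op_sq_le u
        have h3 := h.integral_noise_sq_le
        nlinarith [sq_nonneg ‖a‖]

/-- The mean operator is invertible with a quantitative bound in terms of the form. -/
lemma form_le_norm_sq (hκ : 0 < κ) (hlam : 0 < lam) (u : E) :
    κ ^ 2 * lam * q u ≤ ‖∫ x, A x u ∂ρ‖ ^ 2 := by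
  have hq : 0 ≤ q u := le_trans (by positivity) (h.le_form u)
  have h1 := h.mul_form_le u
  rw [integral_inner (h.integrable_op u)] at h1
  have h2 : κ * q u ≤ ‖u‖ * ‖∫ x, A x u ∂ρ‖ := h1.trans (real_inner_le_norm _ _)
  rcases hq.eq_or_lt with h0 | h0
  · rw [← h0, mul_zero]; positivity
  · have h3 : (κ * q u) ^ 2 ≤ (‖u‖ * ‖∫ x, A x u ∂ρ‖) ^ 2 :=
      pow_le_pow_left₀ (by positivity) h2 2
    have h4 : lam * (κ * q u) ^ 2 ≤ q u * ‖∫ x, A x u ∂ρ‖ ^ 2 := by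
      calc lam * (κ * q u) ^ 2 ≤ lam * (‖u‖ * ‖∫ x, A x u ∂ρ‖) ^ 2 := by gcongr
        _ = (lam * ‖u‖ ^ 2) * ‖∫ x, A x u ∂ρ‖ ^ 2 := by ring
        _ ≤ _ := mul_le_mul_of_nonneg_right (h.le_form u) (sq_nonneg _)
    refine le_of_mul_le_mul_left ?_ h0
    linarith [h4, show lam * (κ * q u) ^ 2 = q u * (κ ^ 2 * lam * q u) by ring]

end IsStableNoise

end OneStep

end StochasticApproximation

section Past

variable {Ω 𝒳 𝒵 : Type*} [MeasurableSpace 𝒳] [m𝒵 : MeasurableSpace 𝒵]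

/-- The information in the samples `X 0, …, X t`. -/
@[reducible] def past (X : ℕ → Ω → 𝒳) (t : ℕ) : MeasurableSpace Ω :=
  ⨆ i ∈ Iic t, MeasurableSpace.comap (X i) inferInstance

lemma past_mono (X : ℕ → Ω → 𝒳) : Monotone (past X) := fun _ _ h =>
  biSup_mono fun _ hi => le_trans hi h

lemma measurable_past (X : ℕ → Ω → 𝒳) (t : ℕ) : Measurable[past X t] (X t) :=
  Measurable.of_comap_le (le_biSup (fun i => MeasurableSpace.comap (X i) inferInstance)
    (mem_Iic.2 le_rfl))

variable [mΩ : MeasurableSpace Ω]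

lemma past_le {X : ℕ → Ω → 𝒳} (hX : ∀ t, Measurable (X t)) (t : ℕ) : past X t ≤ mΩ :=
  iSup₂_le fun i _ => (hX i).comap_le

lemma indepFun_of_measurable_past {P : Measure Ω} {X : ℕ → Ω → 𝒳} (hX : ∀ t, Measurable (X t))
    (hind : iIndepFun X P) {t : ℕ} {Z : Ω → 𝒵} (hZ : Measurable[past X t] Z) :
    IndepFun Z (X (t + 1)) P := by
  rw [IndepFun_iff_Indep]
  have h := indep_iSup_of_disjoint (fun i => (hX i).comap_le)
    ((iIndepFun_iff_iIndep _ X P).1 hind) (S := Iic t) (T := {t + 1}) (by simp)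
  rw [iSup_singleton] at h
  exact indep_of_indep_of_le_left h hZ.comap_le

/-- Integrating out a sample that is independent of the past. -/
lemma integral_le_of_indepFun {P : Measure Ω} [IsProbabilityMeasure P] {ρ : Measure 𝒳}
    [IsProbabilityMeasure ρ]
    {Z : Ω → 𝒵} {Y : Ω → 𝒳} (hZ : Measurable Z) (hY : Measurable Y) (hind : IndepFun Z Y P)
    (hYρ : P.map Y = ρ) {F : 𝒵 × 𝒳 → ℝ} (hF : Measurable F)
    (hFi : Integrable (fun ω => F (Z ω, Y ω)) P) {G : 𝒵 → ℝ}
    (hG : Measurable G) (hGi : Integrable (fun ω => G (Z ω)) P)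
    (hFG : ∀ z, ∫ x, F (z, x) ∂ρ ≤ G z) :
    ∫ ω, F (Z ω, Y ω) ∂P ≤ ∫ ω, G (Z ω) ∂P := by
  have hmap := (indepFun_iff_map_prod_eq_prod_map_map hZ.aemeasurable hY.aemeasurable).1 hind
  rw [hYρ] at hmap
  have : IsProbabilityMeasure (P.map Z) := Measure.isProbabilityMeasure_map hZ.aemeasurable
  have hi : Integrable F ((P.map Z).prod ρ) := by
    rw [← hmap, integrable_map_measure hF.aestronglyMeasurable (hZ.prodMk hY).aemeasurable]
    exact hFi
  calc ∫ ω, F (Z ω, Y ω) ∂P = ∫ p, F p ∂((P.map Z).prod ρ) := by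
        rw [← hmap, integral_map (hZ.prodMk hY).aemeasurable hF.aestronglyMeasurable]
    _ = ∫ z, ∫ x, F (z, x) ∂ρ ∂(P.map Z) := integral_prod _ hi
    _ ≤ ∫ z, G z ∂(P.map Z) := by
        refine integral_mono hi.integral_prod_left ?_ hFG
        rwa [integrable_map_measure hG.aestronglyMeasurable hZ.aemeasurable]
    _ = ∫ ω, G (Z ω) ∂P := integral_map hZ.aemeasurable hG.aestronglyMeasurable

end Past

section Recursion

variable {Ω 𝒳 E : Type*} [MeasurableSpace 𝒳] [NormedAddCommGroup E] [InnerProductSpace ℝ E]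
  [CompleteSpace E] [SecondCountableTopology E] [MeasurableSpace E] [BorelSpace E]
  [mΩ : MeasurableSpace Ω] {P : Measure Ω} [IsProbabilityMeasure P]
  {ρ : Measure 𝒳} [IsProbabilityMeasure ρ] {A : 𝒳 → E →ₗ[ℝ] E} {ξ : 𝒳 → E} {q : E → ℝ}
  {κ lam v c α : ℝ} {X : ℕ → Ω → 𝒳} {Δ : ℕ → Ω → E}

/-- The sum of the centred increments `Ā Δ_i - A_{i+1} Δ_i + ξ_{i+1}` for `n₀ ≤ i < t`. -/
noncomputable def incrementSum (ρ : Measure 𝒳) (A : 𝒳 → E →ₗ[ℝ] E) (ξ : 𝒳 → E)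
    (X : ℕ → Ω → 𝒳) (Δ : ℕ → Ω → E) (n₀ t : ℕ) (ω : Ω) : E :=
  ∑ i ∈ Finset.Ico n₀ t, ((∫ y, A y (Δ i ω) ∂ρ) - A (X (i + 1) ω) (Δ i ω) + ξ (X (i + 1) ω))

/-- The process `Δ` is driven by independent samples `X t ∼ ρ`, starts at a constant and
satisfies `Δ_{t+1} = Δ_t - α (A_{t+1} Δ_t - ξ_{t+1})`. -/
structure IsErrorProcess (P : Measure Ω) (ρ : Measure 𝒳) (A : 𝒳 → E →ₗ[ℝ] E) (ξ : 𝒳 → E) (α : ℝ)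
    (X : ℕ → Ω → 𝒳) (Δ : ℕ → Ω → E) : Prop where
  measurable_sample : ∀ t, Measurable (X t)
  map_sample : ∀ t, P.map (X t) = ρ
  indep : iIndepFun X P
  init : ∃ u, ∀ ω, Δ 0 ω = u
  step : ∀ t ω, Δ (t + 1) ω = Δ t ω - α • (A (X (t + 1) ω) (Δ t ω) - ξ (X (t + 1) ω))

namespace IsErrorProcess

variable (hp : IsErrorProcess P ρ A ξ α X Δ) (h : IsStableNoise ρ A ξ q κ lam v c)

include hp in
lemma ae_sample (t : ℕ) {p : 𝒳 → Prop} (hx : ∀ᵐ x ∂ρ, p x) : ∀ᵐ ω ∂P, p (X t ω) := by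
  rw [← hp.map_sample t] at hx
  exact ae_of_ae_map (hp.measurable_sample t).aemeasurable hx

include hp h

lemma measurable_past_error (t : ℕ) : Measurable[past X t] (Δ t) := by
  induction t with
  | zero =>
    obtain ⟨u, hu⟩ := hp.init
    rw [show Δ 0 = fun _ => u from funext hu]
    exact measurable_const
  | succ t ih =>
    have h1 : Measurable[past X (t + 1)] (Δ t) := ih.mono (past_mono X t.le_succ) le_rfl
    have h2 := measurable_past X (t + 1)
    rw [show Δ (t + 1) = fun ω => _ from funext (hp.step t)]
    exact h1.sub (((h.measurable_op.comp (h2.prodMk h1)).sub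
      (h.measurable_noise.comp h2)).const_smul α)

lemma measurable_error (t : ℕ) : Measurable (Δ t) :=
  (hp.measurable_past_error h t).mono (past_le hp.measurable_sample t) le_rfl

lemma error_bound (t : ℕ) : ∃ R : ℝ, ∀ᵐ ω ∂P, ‖Δ t ω‖ ≤ R := by
  induction t with
  | zero =>
    obtain ⟨u, hu⟩ := hp.init
    exact ⟨‖u‖, .of_forall fun ω => by rw [hu]⟩
  | succ t ih =>
    obtain ⟨R, hR⟩ := ih
    refine ⟨R + |α| * (|c| * R + |c|), ?_⟩
    filter_upwards [hR, hp.ae_sample (t + 1) h.norm_op_le, hp.ae_sample (t + 1) h.norm_noise_le]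
      with ω h0 h1 h2
    rw [hp.step]
    refine (norm_sub_le _ _).trans (add_le_add h0 ?_)
    rw [norm_smul, Real.norm_eq_abs]
    refine mul_le_mul_of_nonneg_left ((norm_sub_le _ _).trans (add_le_add ?_
      (h2.trans (le_abs_self c)))) (abs_nonneg α)
    exact (h1 _).trans ((mul_le_mul_of_nonneg_right (le_abs_self c) (norm_nonneg _)).trans
      (mul_le_mul_of_nonneg_left h0 (abs_nonneg c)))

omit [IsProbabilityMeasure P] hp in
lemma measurable_meanOp : Measurable fun u => ∫ y, A y u ∂ρ := by
  refine StronglyMeasurable.measurable (StronglyMeasurable.integral_prod_right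
    (f := fun u y => A y u) ?_)
  exact (h.measurable_op.comp measurable_swap).stronglyMeasurable

lemma measurable_past_incrementSum (n₀ t : ℕ) :
    Measurable[past X t] (incrementSum ρ A ξ X Δ n₀ t) := by
  refine Finset.measurable_fun_sum _ fun i hi => ?_
  have hit := (Finset.mem_Ico.1 hi).2
  have h1 : Measurable[past X t] (Δ i) :=
    (hp.measurable_past_error h i).mono (past_mono X hit.le) le_rfl
  have h2 : Measurable[past X t] (X (i + 1)) :=
    (measurable_past X (i + 1)).mono (past_mono X hit) le_rfl
  exact (((measurable_meanOp h).comp h1).sub (h.measurable_op.comp (h2.prodMk h1))).add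
    (h.measurable_noise.comp h2)

lemma measurable_incrementSum (n₀ t : ℕ) : Measurable (incrementSum ρ A ξ X Δ n₀ t) :=
  (hp.measurable_past_incrementSum h n₀ t).mono (past_le hp.measurable_sample t) le_rfl

lemma incrementSum_bound (n₀ t : ℕ) :
    ∃ R : ℝ, ∀ᵐ ω ∂P, ‖incrementSum ρ A ξ X Δ n₀ t ω‖ ≤ R := by
  choose R hR using hp.error_bound h
  refine ⟨∑ i ∈ Finset.Ico n₀ t, (|c| * R i + |c| * R i + |c|), ?_⟩
  filter_upwards [ae_all_iff.2 hR, ae_all_iff.2 fun i => hp.ae_sample i h.norm_op_le,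
    ae_all_iff.2 fun i => hp.ae_sample i h.norm_noise_le] with ω h0 h1 h2
  refine norm_sum_le_of_le _ fun i _ => ?_
  have hc : ∀ u : E, c * ‖u‖ ≤ |c| * ‖u‖ := fun u =>
    mul_le_mul_of_nonneg_right (le_abs_self c) (norm_nonneg _)
  have h3 : |c| * ‖Δ i ω‖ ≤ |c| * R i := mul_le_mul_of_nonneg_left (h0 i) (abs_nonneg c)
  refine (norm_add_le _ _).trans (add_le_add ((norm_sub_le _ _).trans (add_le_add ?_ ?_)) ?_)
  · have := norm_integral_le_of_norm_le_const (μ := ρ) (f := fun y => A y (Δ i ω))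
      (C := |c| * R i) (h.norm_op_le.mono fun y hy => (hy _).trans ((hc _).trans h3))
    simpa using this
  · exact (h1 _ _).trans ((hc _).trans h3)
  · exact (h2 _).trans (le_abs_self c)

lemma integrable_form (t : ℕ) (hlam : 0 ≤ lam) : Integrable (fun ω => q (Δ t ω)) P := by
  refine (integrable_norm_sq_of_norm_le (hp.measurable_error h t) (hp.error_bound h t)).mono'
    (h.measurable_form.comp (hp.measurable_error h t)).aestronglyMeasurable (.of_forall fun ω => ?_)
  rw [Real.norm_of_nonneg (le_trans (by positivity) (h.le_form _))]
  exact h.form_le _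

lemma integral_error_sq_succ_le (hα : 0 ≤ α) (hακ : 8 * α ≤ κ) (hlam : 0 ≤ lam) (t : ℕ) :
    ∫ ω, ‖Δ (t + 1) ω‖ ^ 2 ∂P ≤
      ∫ ω, ‖Δ t ω‖ ^ 2 ∂P - α * κ * ∫ ω, q (Δ t ω) ∂P + 2 * α ^ 2 * v := by
  have hi := integrable_norm_sq_of_norm_le (hp.measurable_error h t) (hp.error_bound h t)
  have hq := hp.integrable_form h t hlam
  have hi' := integrable_norm_sq_of_norm_le (hp.measurable_error h (t + 1))
    (hp.error_bound h (t + 1))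
  have key := integral_le_of_indepFun (P := P) (ρ := ρ) (hp.measurable_error h t)
    (hp.measurable_sample (t + 1))
    (indepFun_of_measurable_past hp.measurable_sample hp.indep (hp.measurable_past_error h t))
    (hp.map_sample (t + 1))
    (F := fun p => ‖p.1 - α • (A p.2 p.1 - ξ p.2)‖ ^ 2)
    (((measurable_fst.sub (((h.measurable_op.comp measurable_swap).sub
      (h.measurable_noise.comp measurable_snd)).const_smul α)).norm).pow_const 2)
    (by simpa only [hp.step] using hi')
    (G := fun u => ‖u‖ ^ 2 - α * κ * q u + 2 * α ^ 2 * v)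
    (((measurable_norm.pow_const 2).sub (h.measurable_form.const_mul _)).add_const _)
    ((hi.sub (hq.const_mul _)).add (integrable_const _))
    (fun u => h.integral_step_sq_le hα hακ hlam u)
  simp only [← hp.step] at key
  have e : Integrable (fun ω => ‖Δ t ω‖ ^ 2 - α * κ * q (Δ t ω)) P := hi.sub (hq.const_mul _)
  rw [integral_add e (integrable_const _), integral_sub hi (hq.const_mul _),
    integral_const_mul] at key
  simpa using key

lemma integral_incrementSum_sq_succ_le (hlam : 0 ≤ lam) {n₀ t : ℕ} (hn : n₀ ≤ t) :
    ∫ ω, ‖incrementSum ρ A ξ X Δ n₀ (t + 1) ω‖ ^ 2 ∂P ≤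
      ∫ ω, ‖incrementSum ρ A ξ X Δ n₀ t ω‖ ^ 2 ∂P + 2 * v + 8 * ∫ ω, q (Δ t ω) ∂P := by
  have hS := hp.measurable_incrementSum h n₀ t
  have hi := integrable_norm_sq_of_norm_le hS (hp.incrementSum_bound h n₀ t)
  have hq := hp.integrable_form h t hlam
  have hi' := integrable_norm_sq_of_norm_le (hp.measurable_incrementSum h n₀ (t + 1))
    (hp.incrementSum_bound h n₀ (t + 1))
  have hstep : ∀ ω, incrementSum ρ A ξ X Δ n₀ (t + 1) ω = incrementSum ρ A ξ X Δ n₀ t ω +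
      ((∫ y, A y (Δ t ω) ∂ρ) - A (X (t + 1) ω) (Δ t ω) + ξ (X (t + 1) ω)) := fun ω => by
    unfold incrementSum
    rw [Finset.sum_Ico_succ_top hn]
  have key := integral_le_of_indepFun (P := P) (ρ := ρ)
    ((hp.measurable_error h t).prodMk hS) (hp.measurable_sample (t + 1))
    (indepFun_of_measurable_past hp.measurable_sample hp.indep
      ((hp.measurable_past_error h t).prodMk (hp.measurable_past_incrementSum h n₀ t)))
    (hp.map_sample (t + 1))
    (F := fun p => ‖p.1.2 + ((∫ y, A y p.1.1 ∂ρ) - A p.2 p.1.1 + ξ p.2)‖ ^ 2)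
    (((measurable_fst.snd.add ((((measurable_meanOp h).comp measurable_fst.fst).sub
      (h.measurable_op.comp (measurable_snd.prodMk measurable_fst.fst))).add
      (h.measurable_noise.comp measurable_snd))).norm).pow_const 2)
    (by simpa only [hstep] using hi')
    (G := fun p => ‖p.2‖ ^ 2 + 2 * v + 8 * q p.1)
    (((measurable_snd.norm.pow_const 2).add_const _).add
      ((h.measurable_form.comp measurable_fst).const_mul _))
    ((hi.add (integrable_const _)).add (hq.const_mul _))
    (fun p => h.integral_add_increment_sq_le p.1 p.2)
  simp only [← hstep] at key
  have e : Integrable (fun ω => ‖incrementSum ρ A ξ X Δ n₀ t ω‖ ^ 2 + 2 * v) P :=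
    hi.add (integrable_const _)
  rw [integral_add e (hq.const_mul _), integral_add hi (integrable_const _),
    integral_const_mul (8 : ℝ)] at key
  simpa using key

/-- Summing the recursion expresses the mean operator at the sum of the errors through the two
end points and the martingale part. -/
lemma integral_op_sum (hα : α ≠ 0) (n₀ N : ℕ) (ω : Ω) :
    ∫ y, A y (∑ i ∈ Finset.Ico n₀ (n₀ + N), Δ i ω) ∂ρ =
      α⁻¹ • (Δ n₀ ω - Δ (n₀ + N) ω) + incrementSum ρ A ξ X Δ n₀ (n₀ + N) ω := by
  simp only [map_sum]
  rw [integral_finsetSum _ fun i _ => h.integrable_op _]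
  have h1 : ∑ i ∈ Finset.Ico n₀ (n₀ + N), (Δ (i + 1) ω - Δ i ω) = Δ (n₀ + N) ω - Δ n₀ ω :=
    Finset.sum_Ico_sub (fun i => Δ i ω) (Nat.le_add_right _ _)
  have h2 : ∀ i, (∫ y, A y (Δ i ω) ∂ρ) - A (X (i + 1) ω) (Δ i ω) + ξ (X (i + 1) ω) =
      (∫ y, A y (Δ i ω) ∂ρ) + α⁻¹ • (Δ (i + 1) ω - Δ i ω) := fun i => by
    rw [hp.step, sub_sub_cancel_left, smul_neg, smul_smul, inv_mul_cancel₀ hα, one_smul]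
    abel
  unfold incrementSum
  simp only [h2]
  rw [Finset.sum_add_distrib, ← Finset.smul_sum, h1, ← neg_sub (Δ n₀ ω), smul_neg]
  abel

end IsErrorProcess

end Recursion

section Averaging

/-- Geometric decay of the mean squared error `e` to its stationary level, where `m` is the mean of
the quadratic form. -/
lemma le_geometric_of_recursion {e m : ℕ → ℝ} {α κ lam v : ℝ} (hα : 0 < α) (hκ : 0 < κ)
    (hlam : 0 < lam) (h1 : α * κ * lam ≤ 1)
    (he : ∀ t, e (t + 1) ≤ e t - α * κ * m t + 2 * α ^ 2 * v) (hm : ∀ t, lam * e t ≤ m t) (t : ℕ) :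
    e t ≤ (1 - α * κ * lam) ^ t * e 0 + 2 * α * v / (κ * lam) - 2 * α * v / (κ * lam) *
      (1 - α * κ * lam) ^ t := by
  induction t with
  | zero => simp
  | succ t ih =>
    have h2 := mul_le_mul_of_nonneg_left (hm t) (mul_pos hα hκ).le
    have h3 := mul_le_mul_of_nonneg_left ih (sub_nonneg.2 h1)
    have h4 : α * κ * lam * (2 * α * v / (κ * lam)) = 2 * α ^ 2 * v := by
      field_simp
    have := he t
    rw [pow_succ]
    nlinarith

/-- Growth of the second moment `s` of the martingale. In the combination `α κ s + 8 e` the terms in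
`m`, the mean of the quadratic form, cancel. -/
lemma lyapunov_of_recursion {e m s : ℕ → ℝ} {α κ v : ℝ} (hα : 0 < α) (hκ : 0 < κ) {n₀ : ℕ}
    (he : ∀ t, e (t + 1) ≤ e t - α * κ * m t + 2 * α ^ 2 * v) (hs0 : s n₀ = 0)
    (hs : ∀ t, n₀ ≤ t → s (t + 1) ≤ s t + 2 * v + 8 * m t) (N : ℕ) :
    α * κ * s (n₀ + N) + 8 * e (n₀ + N) ≤ 8 * e n₀ + N * (2 * (α * κ) * v + 16 * α ^ 2 * v) := by
  induction N with
  | zero => simp [hs0]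
  | succ N ih =>
    have h1 := mul_le_mul_of_nonneg_left (hs (n₀ + N) (Nat.le_add_right _ _)) (mul_pos hα hκ).le
    have h2 := he (n₀ + N)
    rw [← add_assoc]
    push_cast
    nlinarith

variable {Ω 𝒳 E : Type*} [MeasurableSpace 𝒳] [NormedAddCommGroup E] [InnerProductSpace ℝ E]
  [CompleteSpace E] [SecondCountableTopology E] [MeasurableSpace E] [BorelSpace E]
  [mΩ : MeasurableSpace Ω] {P : Measure Ω} [IsProbabilityMeasure P]
  {ρ : Measure 𝒳} [IsProbabilityMeasure ρ] {A : 𝒳 → E →ₗ[ℝ] E} {ξ : 𝒳 → E} {q : E → ℝ}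
  {κ lam v c α : ℝ} {X : ℕ → Ω → 𝒳} {Δ : ℕ → Ω → E}

/-- The mean squared error of the averaged iterates: the initial error is forgotten geometrically,
and the stationary fluctuations average out. -/
theorem IsErrorProcess.integral_form_average_le (hp : IsErrorProcess P ρ A ξ α X Δ)
    (h : IsStableNoise ρ A ξ q κ lam v c) (hα : 0 < α) (hακ : 8 * α ≤ κ) (hlam : 0 < lam)
    (h1 : α * κ * lam ≤ 1) {u₀ : E} (hu₀ : ∀ ω, Δ 0 ω = u₀) (n₀ : ℕ) {N : ℕ} (hN : 0 < N) :
    ∫ ω, q ((N : ℝ)⁻¹ • ∑ i ∈ Finset.Ico n₀ (n₀ + N), Δ i ω) ∂P ≤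
      (9 * (1 - α * κ * lam) ^ n₀ * ‖u₀‖ ^ 2 / α ^ 2 + 18 * v / (α * κ * lam) + 12 * N * v) /
        (κ ^ 2 * lam * N ^ 2) := by
  have hκ : 0 < κ := by linarith
  have hv : 0 ≤ v := (integral_nonneg fun _ => by positivity).trans h.integral_noise_sq_le
  have hNpos : (0 : ℝ) < N := by exact_mod_cast hN
  set e : ℕ → ℝ := fun t => ∫ ω, ‖Δ t ω‖ ^ 2 ∂P with he
  set m : ℕ → ℝ := fun t => ∫ ω, q (Δ t ω) ∂P with hm
  set s : ℕ → ℝ := fun t => ∫ ω, ‖incrementSum ρ A ξ X Δ n₀ t ω‖ ^ 2 ∂P with hs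
  have ei : ∀ t, Integrable (fun ω => ‖Δ t ω‖ ^ 2) P := fun t =>
    integrable_norm_sq_of_norm_le (hp.measurable_error h t) (hp.error_bound h t)
  have si : ∀ t, Integrable (fun ω => ‖incrementSum ρ A ξ X Δ n₀ t ω‖ ^ 2) P := fun t =>
    integrable_norm_sq_of_norm_le (hp.measurable_incrementSum h n₀ t) (hp.incrementSum_bound h n₀ t)
  have he1 : ∀ t, e (t + 1) ≤ e t - α * κ * m t + 2 * α ^ 2 * v :=
    hp.integral_error_sq_succ_le h hα.le hακ hlam.le
  have hm1 : ∀ t, lam * e t ≤ m t := fun t => by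
    rw [he, hm, ← integral_const_mul]
    exact integral_mono ((ei t).const_mul _) (hp.integrable_form h t hlam.le) fun ω => h.le_form _
  have hs0 : s n₀ = 0 := by simp [hs, incrementSum]
  have hs1 : ∀ t, n₀ ≤ t → s (t + 1) ≤ s t + 2 * v + 8 * m t := fun t ht =>
    hp.integral_incrementSum_sq_succ_le h hlam.le ht
  have he0 : e 0 = ‖u₀‖ ^ 2 := by simp [he, hu₀]
  have hen : ∀ t, 0 ≤ e t := fun t => integral_nonneg fun _ => by positivity
  set a := 1 - α * κ * lam with ha
  have ha0 : 0 ≤ a := sub_nonneg.2 h1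
  have ha1 : a ≤ 1 := by have : 0 < α * κ * lam := by positivity
                         linarith
  set B := a ^ n₀ * ‖u₀‖ ^ 2 + 2 * α * v / (κ * lam) with hB
  have heB : ∀ t, n₀ ≤ t → e t ≤ B := fun t ht => by
    have h2 := le_geometric_of_recursion hα hκ hlam h1 he1 hm1 t
    rw [he0] at h2
    have h3 : a ^ t * ‖u₀‖ ^ 2 ≤ a ^ n₀ * ‖u₀‖ ^ 2 :=
      mul_le_mul_of_nonneg_right (pow_le_pow_of_le_one ha0 ha1 ht) (sq_nonneg _)
    have h4 : 0 ≤ 2 * α * v / (κ * lam) * a ^ t := by positivity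
    linarith
  -- the martingale part
  have hsB : s (n₀ + N) ≤ B / α ^ 2 + 4 * N * v := by
    have h2 := lyapunov_of_recursion hα hκ he1 hs0 hs1 N
    have h3 := heB n₀ le_rfl
    have h4 := hen (n₀ + N)
    have h5 : α * κ * s (n₀ + N) ≤ α * κ * (B / α ^ 2 + 4 * N * v) := by
      have e1 : α * κ * (B / α ^ 2 + 4 * N * v) = κ / α * B + 4 * (α * κ) * N * v := by
        field_simp
      have h6 : 8 ≤ κ / α := by rw [le_div_iff₀ hα]; linarith
      have h7 : 8 * B ≤ κ / α * B := mul_le_mul_of_nonneg_right h6 ((hen n₀).trans h3)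
      have h8 : 16 * α ^ 2 * (N * v) ≤ 2 * (α * κ) * (N * v) :=
        mul_le_mul_of_nonneg_right (by nlinarith) (by positivity)
      rw [e1]
      linarith
    exact le_of_mul_le_mul_left h5 (by positivity)
  -- the deterministic bound on each trajectory
  have hpt : ∀ ω, κ ^ 2 * lam * N ^ 2 * q ((N : ℝ)⁻¹ • ∑ i ∈ Finset.Ico n₀ (n₀ + N), Δ i ω) ≤
      3 / α ^ 2 * ‖Δ n₀ ω‖ ^ 2 + 3 / α ^ 2 * ‖Δ (n₀ + N) ω‖ ^ 2 +
        3 * ‖incrementSum ρ A ξ X Δ n₀ (n₀ + N) ω‖ ^ 2 := fun ω => by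
    have h2 := h.form_le_norm_sq hκ hlam ((N : ℝ)⁻¹ • ∑ i ∈ Finset.Ico n₀ (n₀ + N), Δ i ω)
    simp only [map_smul] at h2
    rw [integral_smul, hp.integral_op_sum h hα.ne', norm_smul, mul_pow, norm_inv,
      Real.norm_natCast, inv_pow, inv_mul_eq_div, le_div_iff₀ (by positivity)] at h2
    refine (le_of_eq (by ring)).trans (h2.trans ?_)
    set x := Δ n₀ ω
    set y := Δ (n₀ + N) ω
    set z := incrementSum ρ A ξ X Δ n₀ (n₀ + N) ω
    have h3 : ‖α⁻¹ • (x - y) + z‖ ≤ α⁻¹ * ‖x‖ + α⁻¹ * ‖y‖ + ‖z‖ := by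
      refine (norm_add_le _ _).trans (add_le_add ?_ le_rfl)
      rw [norm_smul, norm_inv, Real.norm_of_nonneg hα.le, ← mul_add]
      exact mul_le_mul_of_nonneg_left (norm_sub_le _ _) (by positivity)
    have h4 := pow_le_pow_left₀ (norm_nonneg _) h3 2
    refine h4.trans ?_
    have e1 : 3 / α ^ 2 * ‖x‖ ^ 2 + 3 / α ^ 2 * ‖y‖ ^ 2 + 3 * ‖z‖ ^ 2 =
        3 * (α⁻¹ * ‖x‖) ^ 2 + 3 * (α⁻¹ * ‖y‖) ^ 2 + 3 * ‖z‖ ^ 2 := by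
      rw [mul_pow, mul_pow, inv_pow]; ring
    rw [e1]
    nlinarith [sq_nonneg (α⁻¹ * ‖x‖ - α⁻¹ * ‖y‖), sq_nonneg (α⁻¹ * ‖x‖ - ‖z‖),
      sq_nonneg (α⁻¹ * ‖y‖ - ‖z‖)]
  have i1 : Integrable (fun ω => 3 / α ^ 2 * ‖Δ n₀ ω‖ ^ 2 + 3 / α ^ 2 * ‖Δ (n₀ + N) ω‖ ^ 2) P :=
    ((ei n₀).const_mul _).add ((ei (n₀ + N)).const_mul _)
  have i2 := i1.add ((si (n₀ + N)).const_mul 3)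
  have hint : κ ^ 2 * lam * N ^ 2 *
      ∫ ω, q ((N : ℝ)⁻¹ • ∑ i ∈ Finset.Ico n₀ (n₀ + N), Δ i ω) ∂P ≤
      3 / α ^ 2 * e n₀ + 3 / α ^ 2 * e (n₀ + N) + 3 * s (n₀ + N) := by
    rw [← integral_const_mul]
    refine (integral_mono_of_nonneg (.of_forall fun ω => ?_) i2 (.of_forall hpt)).trans_eq ?_
    · have := (mul_nonneg hlam.le (sq_nonneg _)).trans
        (h.le_form ((N : ℝ)⁻¹ • ∑ i ∈ Finset.Ico n₀ (n₀ + N), Δ i ω))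
      simp only [Pi.zero_apply]
      positivity
    · change ∫ ω, (3 / α ^ 2 * ‖Δ n₀ ω‖ ^ 2 + 3 / α ^ 2 * ‖Δ (n₀ + N) ω‖ ^ 2 +
        3 * ‖incrementSum ρ A ξ X Δ n₀ (n₀ + N) ω‖ ^ 2) ∂P = _
      rw [integral_add i1 ((si _).const_mul 3), integral_add ((ei _).const_mul _)
        ((ei _).const_mul _)]
      simp only [integral_const_mul, he, hs]
  rw [le_div_iff₀ (by positivity), mul_comm]
  refine hint.trans ?_
  have h2 := mul_le_mul_of_nonneg_left (heB n₀ le_rfl) (show 0 ≤ 3 / α ^ 2 by positivity)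
  have h3 := mul_le_mul_of_nonneg_left (heB (n₀ + N) (Nat.le_add_right _ _))
    (show 0 ≤ 3 / α ^ 2 by positivity)
  have e1 : 9 * a ^ n₀ * ‖u₀‖ ^ 2 / α ^ 2 + 18 * v / (α * κ * lam) =
      9 * (B / α ^ 2) := by
    rw [hB]; field_simp; ring
  rw [e1]
  have e2 : 3 / α ^ 2 * B = 3 * (B / α ^ 2) := by ring
  linarith

end Averaging

/-! ### Features and the quadratic form of `I ⊗ Σ_φ` -/

section Features

variable {S : Type*} {d K : ℕ}

/-- The vector `(φ(s)ᵀ θ(k))_{k < K}`. -/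
def score (φ : S → Fin d → ℝ) (v : Fin K × Fin d → ℝ) (s : S) (k : Fin K) : ℝ :=
  φ s ⬝ᵥ fun i => v (k, i)

lemma score_add (φ : S → Fin d → ℝ) (v w : Fin K × Fin d → ℝ) (s : S) (k : Fin K) :
    score φ (v + w) s k = score φ v s k + score φ w s k :=
  dotProduct_add (φ s) (fun i => v (k, i)) (fun i => w (k, i))

lemma score_sub (φ : S → Fin d → ℝ) (v w : Fin K × Fin d → ℝ) (s : S) (k : Fin K) :
    score φ (v - w) s k = score φ v s k - score φ w s k :=
  dotProduct_sub (φ s) (fun i => v (k, i)) (fun i => w (k, i))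

lemma score_smul (φ : S → Fin d → ℝ) (a : ℝ) (v : Fin K × Fin d → ℝ) (s : S) (k : Fin K) :
    score φ (a • v) s k = a * score φ v s k :=
  dotProduct_smul a (φ s) (fun i => v (k, i))

lemma sum_sq_le_one {φ : S → Fin d → ℝ} (hφ : ∀ s, euclNorm (φ s) ≤ 1) (s : S) :
    ∑ i, φ s i ^ 2 ≤ 1 := by
  have h := hφ s
  rw [euclNorm, ← sq_le_one_iff₀ (norm_nonneg _), EuclideanSpace.real_norm_sq_eq] at h
  exact h

lemma abs_feature_le_one {φ : S → Fin d → ℝ} (hφ : ∀ s, euclNorm (φ s) ≤ 1) (s : S) (i : Fin d) :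
    |φ s i| ≤ 1 := by
  rw [← sq_le_one_iff_abs_le_one]
  exact (Finset.single_le_sum (f := fun i => φ s i ^ 2) (fun _ _ => sq_nonneg _)
    (Finset.mem_univ i)).trans (sum_sq_le_one hφ s)

lemma dotProduct_sq_le {φ : S → Fin d → ℝ} (hφ : ∀ s, euclNorm (φ s) ≤ 1) (s : S)
    (w : Fin d → ℝ) : (φ s ⬝ᵥ w) ^ 2 ≤ ∑ i, w i ^ 2 :=
  (Finset.sum_mul_sq_le_sq_mul_sq _ _ _).trans
    (mul_le_of_le_one_left (Finset.sum_nonneg fun _ _ => sq_nonneg _) (sum_sq_le_one hφ s))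

lemma sum_score_sq_le {φ : S → Fin d → ℝ} (hφ : ∀ s, euclNorm (φ s) ≤ 1) (s : S)
    (v : Fin K × Fin d → ℝ) : ∑ k, score φ v s k ^ 2 ≤ ∑ p, v p ^ 2 := by
  rw [Fintype.sum_prod_type]
  exact Finset.sum_le_sum fun k _ => dotProduct_sq_le hφ s _

lemma abs_score_le {φ : S → Fin d → ℝ} (hφ : ∀ s, euclNorm (φ s) ≤ 1) (s : S)
    (v : Fin K × Fin d → ℝ) (k : Fin K) : |score φ v s k| ≤ ∑ i, |v (k, i)| := by
  unfold score dotProduct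
  refine (Finset.abs_sum_le_sum_abs _ _).trans (Finset.sum_le_sum fun i _ => ?_)
  rw [abs_mul]
  exact mul_le_of_le_one_left (abs_nonneg _) (abs_feature_le_one hφ s i)

variable [MeasurableSpace S]

lemma measurable_feature {φ : S → Fin d → ℝ} (hφm : Measurable φ) (i : Fin d) :
    Measurable fun s => φ s i := (measurable_pi_apply i).comp hφm

lemma measurable_score {φ : S → Fin d → ℝ} (hφm : Measurable φ) (k : Fin K) :
    Measurable fun p : S × (Fin K × Fin d → ℝ) => score φ p.2 p.1 k := by
  unfold score dotProduct
  exact Finset.measurable_fun_sum _ fun i _ => ((measurable_feature hφm i).comp measurable_fst).mul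
    ((measurable_pi_apply _).comp measurable_snd)

lemma measurable_score_left {φ : S → Fin d → ℝ} (hφm : Measurable φ) (v : Fin K × Fin d → ℝ)
    (k : Fin K) : Measurable fun s => score φ v s k :=
  (measurable_score hφm k).comp (measurable_id.prodMk measurable_const)

variable {μ : Measure S} [IsProbabilityMeasure μ] {φ : S → Fin d → ℝ}

/-- The quadratic form `E_{s ∼ μ} ∑_k (φ(s)ᵀ v(k))²`, which is that of `I_K ⊗ Σ_φ`. -/
noncomputable def scoreForm (μ : Measure S) (φ : S → Fin d → ℝ) (v : Fin K × Fin d → ℝ) : ℝ :=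
  ∫ s, ∑ k, score φ v s k ^ 2 ∂μ

lemma scoreForm_nonneg (v : Fin K × Fin d → ℝ) : 0 ≤ scoreForm μ φ v :=
  integral_nonneg fun _ => Finset.sum_nonneg fun _ _ => sq_nonneg _

lemma integrable_feature_mul (hφm : Measurable φ) (hφ : ∀ s, euclNorm (φ s) ≤ 1) (i j : Fin d) :
    Integrable (fun s => φ s i * φ s j) μ := by
  refine .of_bound ((measurable_feature hφm i).mul
    (measurable_feature hφm j)).aestronglyMeasurable 1 (.of_forall fun s => ?_)
  rw [norm_mul]
  exact mul_le_one₀ (abs_feature_le_one hφ s i) (norm_nonneg _) (abs_feature_le_one hφ s j)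

lemma featCov_form (hφm : Measurable φ) (hφ : ∀ s, euclNorm (φ s) ≤ 1) (w : Fin d → ℝ) :
    w ⬝ᵥ (featCov μ φ *ᵥ w) = ∫ s, (φ s ⬝ᵥ w) ^ 2 ∂μ := by
  have e : ∀ s, (φ s ⬝ᵥ w) ^ 2 = ∑ i, ∑ j, w i * w j * (φ s i * φ s j) := fun s => by
    rw [sq, dotProduct, Finset.sum_mul_sum]
    exact Finset.sum_congr rfl fun i _ => Finset.sum_congr rfl fun j _ => by ring
  simp only [e]
  rw [integral_finsetSum _ fun i _ => integrable_finsetSum _ fun j _ =>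
    (integrable_feature_mul hφm hφ i j).const_mul _]
  simp only [dotProduct, Matrix.mulVec, featCov, Matrix.of_apply, Finset.mul_sum]
  refine Finset.sum_congr rfl fun i _ => ?_
  rw [integral_finsetSum _ fun j _ => (integrable_feature_mul hφm hφ i j).const_mul _]
  refine Finset.sum_congr rfl fun j _ => ?_
  rw [integral_const_mul]; ring

lemma integrable_dotProduct_sq (hφm : Measurable φ) (hφ : ∀ s, euclNorm (φ s) ≤ 1)
    (w : Fin d → ℝ) : Integrable (fun s => (φ s ⬝ᵥ w) ^ 2) μ := by
  have hm : Measurable fun s => φ s ⬝ᵥ w :=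
    Finset.measurable_fun_sum _ fun i _ => (measurable_feature hφm i).mul_const _
  refine .of_bound (hm.pow_const 2).aestronglyMeasurable (∑ i, w i ^ 2) (.of_forall fun s => ?_)
  rw [Real.norm_of_nonneg (sq_nonneg _)]
  exact dotProduct_sq_le hφ s w

lemma kronecker_form (hφm : Measurable φ) (hφ : ∀ s, euclNorm (φ s) ≤ 1)
    (v : Fin K × Fin d → ℝ) :
    v ⬝ᵥ (((1 : Matrix (Fin K) (Fin K) ℝ) ⊗ₖ featCov μ φ) *ᵥ v) = scoreForm μ φ v := by
  unfold scoreForm score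
  rw [integral_finsetSum _ fun k _ => integrable_dotProduct_sq hφm hφ fun i => v (k, i)]
  simp only [← featCov_form hφm hφ]
  simp only [dotProduct, Matrix.mulVec, Fintype.sum_prod_type, Matrix.kroneckerMap_apply,
    Matrix.one_apply, ite_mul, one_mul, zero_mul, Finset.sum_ite_irrel, Finset.sum_const_zero,
    Finset.sum_ite_eq, Finset.mem_univ, if_true]

lemma normV1_sq {γ : ℝ} (hφm : Measurable φ)
    (hφ : ∀ s, euclNorm (φ s) ≤ 1) (v : Fin K × Fin d → ℝ) :
    normV1 γ μ φ v ^ 2 = scoreForm μ φ v / (K * (1 - γ) ^ 2) := by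
  unfold normV1 weightedNorm
  rw [kronecker_form hφm hφ, mul_pow, Real.sq_sqrt (scoreForm_nonneg v), div_pow, mul_pow,
    Real.sq_sqrt (Nat.cast_nonneg K)]
  ring

lemma normV2_sq {γ : ℝ} (v : Fin K × Fin d → ℝ) :
    normV2 γ v ^ 2 = ‖WithLp.toLp 2 v‖ ^ 2 / (K * (1 - γ) ^ 2) := by
  unfold normV2 euclNorm
  rw [mul_pow, div_pow, mul_pow, Real.sq_sqrt (Nat.cast_nonneg K)]
  ring

lemma lamMin_mul_le (hφm : Measurable φ) (hφ : ∀ s, euclNorm (φ s) ≤ 1) (w : Fin d → ℝ) :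
    lamMin μ φ * ∑ i, w i ^ 2 ≤ ∫ s, (φ s ⬝ᵥ w) ^ 2 ∂μ := by
  have hH : (featCov μ φ).IsHermitian := by
    ext i j
    simp [featCov, Matrix.conjTranspose_apply, mul_comm]
  have hps : (featCov μ φ - algebraMap ℝ _ (lamMin μ φ)).PosSemidef := by
    refine Matrix.posSemidef_iff_isHermitian_and_spectrum_nonneg.2 ⟨?_, ?_⟩
    · refine hH.sub ?_
      rw [Matrix.algebraMap_eq_diagonal]
      exact Matrix.isHermitian_diagonal _
    · rw [← spectrum.sub_singleton_eq]
      rintro _ ⟨a, ha, b, hb, rfl⟩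
      rw [mem_singleton_iff.1 hb]
      exact sub_nonneg.2 (csInf_le Matrix.finite_real_spectrum.bddBelow ha)
  have h := hps.dotProduct_mulVec_nonneg w
  rw [Matrix.sub_mulVec, dotProduct_sub, star_trivial, featCov_form hφm hφ,
    Algebra.algebraMap_eq_smul_one,
    Matrix.smul_mulVec, Matrix.one_mulVec, dotProduct_smul, smul_eq_mul] at h
  have e : w ⬝ᵥ w = ∑ i, w i ^ 2 := Finset.sum_congr rfl fun i _ => (sq _).symm
  rw [← e]; linarith

lemma lamMin_mul_le_scoreForm (hφm : Measurable φ) (hφ : ∀ s, euclNorm (φ s) ≤ 1)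
    (v : Fin K × Fin d → ℝ) : lamMin μ φ * ∑ p, v p ^ 2 ≤ scoreForm μ φ v := by
  unfold scoreForm score
  rw [integral_finsetSum _ fun k _ => integrable_dotProduct_sq hφm hφ fun i => v (k, i),
    Fintype.sum_prod_type, Finset.mul_sum]
  exact Finset.sum_le_sum fun k _ => lamMin_mul_le hφm hφ _

lemma lamMin_le_one (hφm : Measurable φ) (hφ : ∀ s, euclNorm (φ s) ≤ 1)
    (hlam : 0 < lamMin μ φ) : lamMin μ φ ≤ 1 := by
  rcases d with _ | d
  · -- without features the spectrum is empty, so that its infimum is `0`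
    exact absurd hlam (by simp [lamMin, spectrum.of_subsingleton])
  · have h := lamMin_mul_le (μ := μ) hφm hφ (Pi.single 0 1)
    have h1 : ∑ i, (Pi.single 0 1 : Fin (d + 1) → ℝ) i ^ 2 = 1 := by
      rw [Fin.sum_univ_succ]; simp
    rw [h1, mul_one] at h
    refine h.trans ((integral_mono (integrable_dotProduct_sq hφm hφ _) (integrable_const 1)
      fun s => ?_).trans_eq (by simp))
    exact (dotProduct_sq_le hφ s _).trans_eq h1

lemma integrable_sum_score_sq (hφm : Measurable φ) (hφ : ∀ s, euclNorm (φ s) ≤ 1)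
    (v : Fin K × Fin d → ℝ) : Integrable (fun s => ∑ k, score φ v s k ^ 2) μ :=
  integrable_finsetSum _ fun k _ => integrable_dotProduct_sq hφm hφ fun i => v (k, i)

lemma scoreForm_le (hφm : Measurable φ) (hφ : ∀ s, euclNorm (φ s) ≤ 1)
    (v : Fin K × Fin d → ℝ) : scoreForm μ φ v ≤ ∑ p, v p ^ 2 :=
  (integral_mono (integrable_sum_score_sq hφm hφ v) (integrable_const _)
    fun s => sum_score_sq_le hφ s v).trans_eq (by simp)

lemma measurable_scoreForm (hφm : Measurable φ) :
    Measurable (scoreForm (K := K) μ φ) := by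
  refine StronglyMeasurable.measurable (StronglyMeasurable.integral_prod_right
    (f := fun v s => ∑ k, score φ v s k ^ 2) ?_)
  exact (Finset.measurable_fun_sum _ fun k _ => ((measurable_score hφm k).comp
    measurable_swap).pow_const 2).stronglyMeasurable

end Features

/-! ### The law of a sample -/

section SampleLaw

variable {S A : Type*} [MeasurableSpace S] [MeasurableSpace A] (M : MDP S A) (pol : Kernel S A)
  [IsMarkovKernel pol] (μ : Measure S) [IsProbabilityMeasure μ]

instance : IsMarkovKernel (stepKernel M pol) := by unfold stepKernel; infer_instance

instance : IsProbabilityMeasure (sampleLaw M pol μ) := by unfold sampleLaw; infer_instance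

lemma sampleLaw_map_fst : (sampleLaw M pol μ).map (fun x => x.1) = μ :=
  Measure.fst_compProd μ _

lemma sampleLaw_map_step :
    (sampleLaw M pol μ).map (fun x => (x.1, x.2.2)) = μ ⊗ₘ stepKernel M pol := by
  unfold stepKernel
  rw [Kernel.snd_eq, Measure.compProd_map measurable_snd]
  rfl

lemma sampleLaw_map_next (hμ : Kernel.Invariant (stateKernel M pol) μ) :
    (sampleLaw M pol μ).map (fun x => x.2.2.2) = μ := by
  have h1 : (sampleLaw M pol μ).map (fun x => x.2.2.2) =
      ((μ ⊗ₘ stepKernel M pol).map (Prod.map id Prod.snd)).map Prod.snd := by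
    rw [← sampleLaw_map_step, Measure.map_map (by fun_prop) (by fun_prop),
      Measure.map_map (by fun_prop) (by fun_prop)]
    rfl
  rw [h1, ← Measure.compProd_map measurable_snd, ← Kernel.snd_eq]
  exact (Measure.snd_compProd μ _).trans hμ.def

lemma ae_stepKernel_reward (s : S) : ∀ᵐ p ∂(stepKernel M pol s), p.1 ∈ Icc (0 : ℝ) 1 := by
  have hm : MeasurableSet {p : ℝ × S | p.1 ∈ Icc (0 : ℝ) 1} := measurable_fst measurableSet_Icc
  unfold stepKernel
  rw [Kernel.snd_apply, ae_map_iff measurable_snd.aemeasurable hm,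
    Kernel.ae_compProd_iff (p := fun x : A × (ℝ × S) => x.2.1 ∈ Icc (0 : ℝ) 1) (measurable_snd hm)]
  exact .of_forall fun a => M.reward_mem _

lemma ae_sampleLaw_reward : ∀ᵐ x ∂(sampleLaw M pol μ), x.2.2.1 ∈ Icc (0 : ℝ) 1 := by
  have hm : MeasurableSet {p : S × (ℝ × S) | p.2.1 ∈ Icc (0 : ℝ) 1} :=
    measurable_snd.fst measurableSet_Icc
  have h : ∀ᵐ p ∂(μ ⊗ₘ stepKernel M pol), p.2.1 ∈ Icc (0 : ℝ) 1 :=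
    (Measure.ae_compProd_iff hm).2 (.of_forall fun s => ae_stepKernel_reward M pol s)
  rw [← sampleLaw_map_step] at h
  exact ae_of_ae_map (f := fun x : S × (A × (ℝ × S)) => (x.1, x.2.2)) (by fun_prop) h

lemma integral_sampleLaw {f : S × (ℝ × S) → ℝ} (hf : Measurable f)
    (hb : ∃ R : ℝ, ∀ᵐ p ∂(μ ⊗ₘ stepKernel M pol), ‖f p‖ ≤ R) :
    ∫ x, f (x.1, x.2.2) ∂(sampleLaw M pol μ) = ∫ s, ∫ p, f (s, p) ∂(stepKernel M pol s) ∂μ := by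
  obtain ⟨R, hR⟩ := hb
  rw [← Measure.integral_compProd (.of_bound hf.aestronglyMeasurable R hR), ← sampleLaw_map_step,
    integral_map (by fun_prop) hf.aestronglyMeasurable]

variable {d K : ℕ} {φ : S → Fin d → ℝ}

lemma integral_score_fst (hφm : Measurable φ) (v : Fin K × Fin d → ℝ) :
    ∫ x, ∑ k, score φ v x.1 k ^ 2 ∂(sampleLaw M pol μ) = scoreForm μ φ v := by
  have hm : Measurable fun s => ∑ k, score φ v s k ^ 2 :=
    Finset.measurable_fun_sum _ fun k _ => (measurable_score_left hφm v k).pow_const 2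
  unfold scoreForm
  conv_rhs => rw [← sampleLaw_map_fst M pol μ]
  rw [integral_map (by fun_prop) hm.aestronglyMeasurable]

lemma integral_score_next (hμ : Kernel.Invariant (stateKernel M pol) μ) (hφm : Measurable φ)
    (v : Fin K × Fin d → ℝ) :
    ∫ x, ∑ k, score φ v x.2.2.2 k ^ 2 ∂(sampleLaw M pol μ) = scoreForm μ φ v := by
  have hm : Measurable fun s => ∑ k, score φ v s k ^ 2 :=
    Finset.measurable_fun_sum _ fun k _ => (measurable_score_left hφm v k).pow_const 2
  unfold scoreForm
  conv_rhs => rw [← sampleLaw_map_next M pol μ hμ]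
  rw [integral_map (by fun_prop) hm.aestronglyMeasurable]

lemma integrable_score_fst (hφm : Measurable φ) (hφ : ∀ s, euclNorm (φ s) ≤ 1)
    (v : Fin K × Fin d → ℝ) :
    Integrable (fun x => ∑ k, score φ v x.1 k ^ 2) (sampleLaw M pol μ) := by
  have h := integrable_sum_score_sq (μ := μ) hφm hφ v
  rw [← sampleLaw_map_fst M pol μ] at h
  exact h.comp_measurable measurable_fst

lemma integrable_score_next (hμ : Kernel.Invariant (stateKernel M pol) μ) (hφm : Measurable φ)
    (hφ : ∀ s, euclNorm (φ s) ≤ 1) (v : Fin K × Fin d → ℝ) :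
    Integrable (fun x => ∑ k, score φ v x.2.2.2 k ^ 2) (sampleLaw M pol μ) := by
  have h := integrable_sum_score_sq (μ := μ) hφm hφ v
  rw [← sampleLaw_map_next M pol μ hμ] at h
  exact h.comp_measurable (by fun_prop)

end SampleLaw

/-! ### The update matrix and vector -/

section Update

variable {S A : Type*} {d K : ℕ} {φ : S → Fin d → ℝ} {γ : ℝ}

lemma kronecker_vecMulVec_mulVec (Y : Matrix (Fin K) (Fin K) ℝ) (a b : Fin d → ℝ)
    (v : Fin K × Fin d → ℝ) (p : Fin K × Fin d) :
    ((Y ⊗ₖ Matrix.vecMulVec a b) *ᵥ v) p =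
      (Y *ᵥ fun k => b ⬝ᵥ fun i => v (k, i)) p.1 * a p.2 := by
  simp only [Matrix.mulVec, dotProduct, Fintype.sum_prod_type, Matrix.kroneckerMap_apply,
    Matrix.vecMulVec_apply, Finset.mul_sum, Finset.sum_mul]
  exact Finset.sum_congr rfl fun k _ => Finset.sum_congr rfl fun i _ => by ring

lemma updMat_mulVec (x : S × (A × (ℝ × S))) (v : Fin K × Fin d → ℝ) (p : Fin K × Fin d) :
    (updMat γ K φ x *ᵥ v) p = (score φ v x.1 p.1 -
      ((cumMat K * gTilde γ K x.2.2.1 * (cumMat K)⁻¹) *ᵥ score φ v x.2.2.2) p.1) * φ x.1 p.2 := by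
  unfold updMat
  rw [Matrix.sub_mulVec, Pi.sub_apply, kronecker_vecMulVec_mulVec, kronecker_vecMulVec_mulVec,
    Matrix.one_mulVec, sub_mul]
  rfl

lemma sum_mul_updMat_mulVec (x : S × (A × (ℝ × S))) (v : Fin K × Fin d → ℝ) :
    ∑ p, v p * (updMat γ K φ x *ᵥ v) p = ∑ k, score φ v x.1 k * (score φ v x.1 k -
      ((cumMat K * gTilde γ K x.2.2.1 * (cumMat K)⁻¹) *ᵥ score φ v x.2.2.2) k) := by
  rw [Fintype.sum_prod_type]
  refine Finset.sum_congr rfl fun k _ => ?_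
  simp only [updMat_mulVec]
  have e : score φ v x.1 k = ∑ i, φ x.1 i * v (k, i) := rfl
  conv_rhs => rw [e, Finset.sum_mul, ← e]
  exact Finset.sum_congr rfl fun i _ => by ring

/-- The update matrix is bounded by the scores at the current and the next state, as `C G̃(r) C⁻¹`
is a contraction and `φ(s)` is in the unit ball. -/
lemma sum_sq_updMat_mulVec_le (hK : 0 < (K : ℝ) * (1 - γ)) (hγ : 0 ≤ γ) (hγ1 : γ ≤ 1)
    (hφ : ∀ s, euclNorm (φ s) ≤ 1) {x : S × (A × (ℝ × S))} (hr : x.2.2.1 ∈ Icc (0 : ℝ) 1)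
    (v : Fin K × Fin d → ℝ) :
    ∑ p, (updMat γ K φ x *ᵥ v) p ^ 2 ≤
      2 * ∑ k, score φ v x.1 k ^ 2 + 2 * ∑ k, score φ v x.2.2.2 k ^ 2 := by
  have h1 := sum_sq_transMat_mulVec_le hK hγ hr (score φ v x.2.2.2)
  have h2 : 0 ≤ ∑ k, score φ v x.2.2.2 k ^ 2 := Finset.sum_nonneg fun _ _ => sq_nonneg _
  simp only [updMat_mulVec, cumMat_conj_gTilde hK hγ hr.1]
  set y := transMat γ K x.2.2.1 *ᵥ score φ v x.2.2.2
  rw [Fintype.sum_prod_type]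
  calc ∑ k, ∑ i, ((score φ v x.1 k - y k) * φ x.1 i) ^ 2
      ≤ ∑ k, (score φ v x.1 k - y k) ^ 2 := by
        refine Finset.sum_le_sum fun k _ => ?_
        simp only [mul_pow, ← Finset.mul_sum]
        exact mul_le_of_le_one_right (sq_nonneg _) (sum_sq_le_one hφ _)
    _ ≤ ∑ k, (2 * score φ v x.1 k ^ 2 + 2 * y k ^ 2) :=
        Finset.sum_le_sum fun k _ => by nlinarith [sq_nonneg (score φ v x.1 k + y k)]
    _ = 2 * ∑ k, score φ v x.1 k ^ 2 + 2 * ∑ k, y k ^ 2 := by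
        rw [Finset.sum_add_distrib, Finset.mul_sum, Finset.mul_sum]
    _ ≤ _ := by nlinarith

/-- The form of the update matrix, bounded below by Young's inequality with the weight `√γ`, the
operator norm of `C G̃(r) C⁻¹`. The two negative terms are balanced: under a stationary law they
add up to `√γ` times the form of `I ⊗ Σ_φ`. -/
lemma le_sum_mul_updMat_mulVec (hK : 0 < (K : ℝ) * (1 - γ)) (hγ : 0 < γ)
    {x : S × (A × (ℝ × S))} (hr : x.2.2.1 ∈ Icc (0 : ℝ) 1) (v : Fin K × Fin d → ℝ) :
    (1 - √γ / 2) * ∑ k, score φ v x.1 k ^ 2 - √γ / 2 * ∑ k, score φ v x.2.2.2 k ^ 2 ≤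
      ∑ p, v p * (updMat γ K φ x *ᵥ v) p := by
  have h1 := sum_sq_transMat_mulVec_le hK hγ.le hr (score φ v x.2.2.2)
  rw [sum_mul_updMat_mulVec, cumMat_conj_gTilde hK hγ.le hr.1]
  set y := transMat γ K x.2.2.1 *ᵥ score φ v x.2.2.2
  set w := score φ v x.1
  have hg : 0 < √γ := Real.sqrt_pos.2 hγ
  have h2 : ∑ k, w k * y k ≤ √γ / 2 * ∑ k, w k ^ 2 + (√γ)⁻¹ / 2 * ∑ k, y k ^ 2 := by
    rw [Finset.mul_sum, Finset.mul_sum, ← Finset.sum_add_distrib]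
    refine Finset.sum_le_sum fun k _ => ?_
    have e : √γ / 2 * w k ^ 2 + (√γ)⁻¹ / 2 * y k ^ 2 - w k * y k =
        (√γ)⁻¹ / 2 * (√γ * w k - y k) ^ 2 := by
      field_simp; ring
    have : 0 ≤ (√γ)⁻¹ / 2 * (√γ * w k - y k) ^ 2 := by positivity
    linarith
  have h3 : (√γ)⁻¹ / 2 * ∑ k, y k ^ 2 ≤ √γ / 2 * ∑ k, score φ v x.2.2.2 k ^ 2 := by
    refine (mul_le_mul_of_nonneg_left h1 (by positivity)).trans_eq ?_
    have : (√γ)⁻¹ * γ = √γ := by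
      rw [inv_mul_eq_iff_eq_mul₀ hg.ne', Real.mul_self_sqrt hγ.le]
    rw [← mul_assoc, div_mul_eq_mul_div, this]
  simp only [mul_sub, Finset.sum_sub_distrib]
  have e : ∑ k, w k * w k = ∑ k, w k ^ 2 := Finset.sum_congr rfl fun _ _ => (sq _).symm
  rw [e]
  linarith

/-- Each of the `K` blocks of the update vector is at most `2 (1 - γ)` in norm. -/
lemma sum_sq_updVec_le (hK : 1 ≤ (K : ℝ) * (1 - γ)) (hγ : 0 ≤ γ) (hγ1 : γ < 1)
    (hφ : ∀ s, euclNorm (φ s) ≤ 1) {x : S × (A × (ℝ × S))} (hr : x.2.2.1 ∈ Icc (0 : ℝ) 1) :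
    ∑ p, updVec γ K φ x p ^ 2 ≤ 4 * (K * (1 - γ) ^ 2) := by
  rw [Fintype.sum_prod_type]
  calc ∑ k, ∑ i, updVec γ K φ x (k, i) ^ 2 ≤ ∑ k : Fin K, 4 * (1 - γ) ^ 2 := by
        refine Finset.sum_le_sum fun k _ => ?_
        simp only [updVec, mul_pow _ (φ _ _), ← Finset.mul_sum]
        refine (mul_le_of_le_one_right (sq_nonneg _) (sum_sq_le_one hφ _)).trans ?_
        have h := abs_cumMat_mulVec_sum_gVec_le hK hγ hγ1 hr k
        rw [show 4 * (1 - γ) ^ 2 = (2 * (1 - γ)) ^ 2 by ring, sq_le_sq, abs_mul,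
          abs_of_pos (by positivity : (0 : ℝ) < ((K : ℝ) + 1)⁻¹),
          abs_of_pos (by linarith : 0 < 2 * (1 - γ)), inv_mul_le_iff₀ (by positivity)]
        refine h.trans ?_
        nlinarith
    _ = 4 * (K * (1 - γ) ^ 2) := by simp; ring

variable [MeasurableSpace S] [MeasurableSpace A]

lemma measurable_gCoef (j k : ℕ) : Measurable fun r => gCoef γ K r j k := by
  unfold gCoef; fun_prop

lemma measurable_updMat_mulVec (hφm : Measurable φ) {Y : Type*} [MeasurableSpace Y]
    {f : Y → S × (A × (ℝ × S))} (hf : Measurable f) {g : Y → Fin K × Fin d → ℝ}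
    (hg : Measurable g) (p : Fin K × Fin d) :
    Measurable fun y => (updMat γ K φ (f y) *ᵥ g y) p := by
  have h1 : ∀ k l, Measurable fun r => (cumMat K * gTilde γ K r * (cumMat K)⁻¹) k l := fun k l => by
    simp only [Matrix.mul_apply, gTilde, Matrix.of_apply, gVec]
    exact Finset.measurable_fun_sum _ fun i _ => (Finset.measurable_fun_sum _ fun j _ =>
      ((measurable_gCoef _ _).sub (measurable_gCoef _ _)).const_mul _).mul_const _
  simp only [updMat_mulVec]
  refine (((measurable_score hφm p.1).comp (hf.fst.prodMk hg)).sub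
    ?_).mul ((measurable_feature hφm p.2).comp hf.fst)
  simp only [Matrix.mulVec, dotProduct]
  exact Finset.measurable_fun_sum _ fun l _ => ((h1 p.1 l).comp hf.snd.snd.fst).mul
    ((measurable_score hφm l).comp (hf.snd.snd.snd.prodMk hg))

lemma measurable_updVec (hφm : Measurable φ) (p : Fin K × Fin d) :
    Measurable fun x : S × (A × (ℝ × S)) => updVec γ K φ x p := by
  unfold updVec
  refine Measurable.mul (Measurable.const_mul ?_ _)
    ((measurable_feature hφm p.2).comp measurable_fst)
  simp only [Matrix.mulVec, dotProduct, Pi.sub_apply, Finset.sum_apply, gVec]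
  exact Finset.measurable_fun_sum _ fun l _ => ((Finset.measurable_fun_sum _ fun j _ =>
    (measurable_gCoef _ _).comp measurable_snd.snd.fst).sub_const _).const_mul _

/-- The action of the update matrix on Euclidean space. -/
noncomputable def updOp (γ : ℝ) (K : ℕ) (φ : S → Fin d → ℝ) (x : S × (A × (ℝ × S))) :
    EuclideanSpace ℝ (Fin K × Fin d) →ₗ[ℝ] EuclideanSpace ℝ (Fin K × Fin d) :=
  Matrix.toLpLin 2 2 (updMat γ K φ x)

lemma updOp_apply (x : S × (A × (ℝ × S))) (u : EuclideanSpace ℝ (Fin K × Fin d)) :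
    updOp γ K φ x u = WithLp.toLp 2 (updMat γ K φ x *ᵥ u.ofLp) := Matrix.toLpLin_apply _ _ _ _

/-- The residual `b - A θ` of the linear system of the projected Bellman equation. -/
noncomputable def residual (γ : ℝ) (φ : S → Fin d → ℝ) (θ : Fin K × Fin d → ℝ)
    (x : S × (A × (ℝ × S))) : EuclideanSpace ℝ (Fin K × Fin d) :=
  WithLp.toLp 2 (updVec γ K φ x - updMat γ K φ x *ᵥ θ)

lemma measurable_toLp_comp {ι Y : Type*} [Fintype ι] [MeasurableSpace Y] {f : Y → ι → ℝ}
    (hf : ∀ i, Measurable fun y => f y i) :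
    Measurable fun y => (WithLp.toLp 2 (f y) : EuclideanSpace ℝ ι) :=
  (WithLp.measurable_toLp 2 _).comp (measurable_pi_iff.2 hf)

lemma measurable_updOp (hφm : Measurable φ) :
    Measurable fun p : (S × (A × (ℝ × S))) × EuclideanSpace ℝ (Fin K × Fin d) =>
      updOp γ K φ p.1 p.2 := by
  simp only [updOp_apply]
  exact measurable_toLp_comp (measurable_updMat_mulVec hφm measurable_fst
    ((WithLp.measurable_ofLp 2 _).comp measurable_snd))

lemma measurable_updOp_apply (hφm : Measurable φ) (u : EuclideanSpace ℝ (Fin K × Fin d)) :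
    Measurable fun x : S × (A × (ℝ × S)) => updOp γ K φ x u := by
  simp only [updOp_apply]
  exact measurable_toLp_comp (measurable_updMat_mulVec hφm measurable_id measurable_const)

lemma measurable_residual (hφm : Measurable φ) (θ : Fin K × Fin d → ℝ) :
    Measurable (residual (A := A) γ φ θ) :=
  measurable_toLp_comp fun i => (measurable_updVec hφm i).sub
    (measurable_updMat_mulVec hφm measurable_id measurable_const i)

end Update

section Stability

variable {S A : Type*} [MeasurableSpace S] [MeasurableSpace A] {M : MDP S A} {pol : Kernel S A}
  [IsMarkovKernel pol] {μ : Measure S} [IsProbabilityMeasure μ] {d K : ℕ} {φ : S → Fin d → ℝ}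

lemma norm_updOp_le {γ : ℝ} (hK : 0 < (K : ℝ) * (1 - γ)) (hγ : 0 ≤ γ) (hγ1 : γ ≤ 1)
    (hφ : ∀ s, euclNorm (φ s) ≤ 1) {x : S × (A × (ℝ × S))} (hr : x.2.2.1 ∈ Icc (0 : ℝ) 1)
    (u : EuclideanSpace ℝ (Fin K × Fin d)) : ‖updOp γ K φ x u‖ ≤ 2 * ‖u‖ := by
  rw [← sq_le_sq₀ (norm_nonneg _) (by positivity), mul_pow, EuclideanSpace.real_norm_sq_eq,
    EuclideanSpace.real_norm_sq_eq]
  simp only [updOp_apply]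
  have h := sum_sq_updMat_mulVec_le hK hγ hγ1 hφ hr u.ofLp
  have h1 := sum_score_sq_le hφ x.1 u.ofLp
  have h2 := sum_score_sq_le hφ x.2.2.2 u.ofLp
  linarith

lemma norm_residual_sq_le {γ : ℝ} (hK : 1 ≤ (K : ℝ) * (1 - γ)) (hγ : 0 ≤ γ) (hγ1 : γ < 1)
    (hφ : ∀ s, euclNorm (φ s) ≤ 1) {x : S × (A × (ℝ × S))} (hr : x.2.2.1 ∈ Icc (0 : ℝ) 1)
    (θ : Fin K × Fin d → ℝ) : ‖residual γ φ θ x‖ ^ 2 ≤ 8 * (K * (1 - γ) ^ 2) +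
      (4 * ∑ k, score φ θ x.1 k ^ 2 + 4 * ∑ k, score φ θ x.2.2.2 k ^ 2) := by
  have h1 := sum_sq_updMat_mulVec_le (by linarith) hγ hγ1.le hφ hr θ
  have h2 := sum_sq_updVec_le hK hγ hγ1 hφ hr
  rw [EuclideanSpace.real_norm_sq_eq]
  have h3 : ∑ p, (residual γ φ θ x).ofLp p ^ 2 ≤
      2 * ∑ p, updVec γ K φ x p ^ 2 + 2 * ∑ p, (updMat γ K φ x *ᵥ θ) p ^ 2 := by
    rw [Finset.mul_sum, Finset.mul_sum, ← Finset.sum_add_distrib]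
    refine Finset.sum_le_sum fun p _ => ?_
    simp only [residual, Pi.sub_apply]
    nlinarith [sq_nonneg (updVec γ K φ x p + (updMat γ K φ x *ᵥ θ) p)]
  linarith

/-- The samples of `Linear-CTD` fit the hypotheses of averaged stochastic approximation, once the
residual of the target is centred: stationarity makes the current and the next state contribute
equally, so that the mean operator loses only the factor `√γ`. -/
theorem isStableNoise (hμ : Kernel.Invariant (stateKernel M pol) μ) (hφm : Measurable φ)
    (hφ : ∀ s, euclNorm (φ s) ≤ 1) (hK : 1 ≤ (K : ℝ) * (1 - M.γ)) {θ : Fin K × Fin d → ℝ}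
    (hθ : ∫ x, residual M.γ φ θ x ∂(sampleLaw M pol μ) = 0) :
    ∃ c, IsStableNoise (sampleLaw M pol μ) (updOp M.γ K φ) (residual M.γ φ θ)
      (fun u => scoreForm μ φ u.ofLp) (1 - √M.γ) (lamMin μ φ)
      (8 * (K * (1 - M.γ) ^ 2) + 8 * scoreForm μ φ θ) c := by
  have hγ := M.γ_pos
  have hγ1 := M.γ_lt_one
  have hK0 : 0 < (K : ℝ) * (1 - M.γ) := by linarith
  set R := 8 * (K * (1 - M.γ) ^ 2) + (4 * ∑ p, θ p ^ 2 + 4 * ∑ p, θ p ^ 2) with hR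
  have hop : ∀ᵐ x ∂(sampleLaw M pol μ), ∀ u, ‖updOp M.γ K φ x u‖ ≤ 2 * ‖u‖ :=
    (ae_sampleLaw_reward M pol μ).mono fun x hx => norm_updOp_le hK0 hγ.le hγ1.le hφ hx
  have hres : ∀ᵐ x ∂(sampleLaw M pol μ), ‖residual M.γ φ θ x‖ ≤ √R :=
    (ae_sampleLaw_reward M pol μ).mono fun x hx => Real.le_sqrt_of_sq_le
      ((norm_residual_sq_le hK hγ.le hγ1 hφ hx θ).trans (by
        have h1 := sum_score_sq_le hφ x.1 θ
        have h2 := sum_score_sq_le hφ x.2.2.2 θ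
        linarith))
  have mop : ∀ u, Measurable fun x : S × (A × (ℝ × S)) => updOp M.γ K φ x u :=
    measurable_updOp_apply hφm
  have i1 := integrable_score_fst M pol μ (K := K) hφm hφ
  have i2 := integrable_score_next M pol μ (K := K) hμ hφm hφ
  have j1 := integral_score_fst M pol μ (K := K) hφm
  have j2 := integral_score_next M pol μ (K := K) hμ hφm
  refine ⟨max 2 (√R), measurable_updOp hφm, measurable_residual hφm θ,
    hop.mono fun x hx u => (hx u).trans (by gcongr; exact le_max_left _ _),
    hres.mono fun x hx => hx.trans (le_max_right _ _), hθ, ?_,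
    (measurable_scoreForm hφm).comp (WithLp.measurable_ofLp 2 _), fun u => ?_, fun u => ?_,
    fun u => ?_, fun u => ?_⟩
  · have i3 := ((i1 θ).const_mul 4).add ((i2 θ).const_mul 4)
    refine (integral_mono_ae (integrable_norm_sq_of_norm_le (measurable_residual hφm θ) ⟨_, hres⟩)
      ((integrable_const (8 * ((K : ℝ) * (1 - M.γ) ^ 2))).add i3)
      ((ae_sampleLaw_reward M pol μ).mono fun x hx =>
        norm_residual_sq_le hK hγ.le hγ1 hφ hx θ)).trans_eq ?_
    rw [integral_add' (integrable_const _) i3, integral_add' ((i1 θ).const_mul 4)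
      ((i2 θ).const_mul 4), integral_const_mul (4 : ℝ), integral_const_mul (4 : ℝ), j1, j2]
    simp only [integral_const, probReal_univ, one_smul]
    ring
  · rw [EuclideanSpace.real_norm_sq_eq]
    exact scoreForm_le hφm hφ _
  · rw [EuclideanSpace.real_norm_sq_eq]
    exact lamMin_mul_le_scoreForm hφm hφ _
  · have i3 : Integrable (fun x => (1 - √M.γ / 2) * ∑ k, score φ u.ofLp x.1 k ^ 2 -
        √M.γ / 2 * ∑ k, score φ u.ofLp x.2.2.2 k ^ 2) (sampleLaw M pol μ) :=
      ((i1 u.ofLp).const_mul _).sub ((i2 u.ofLp).const_mul _)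
    refine le_trans (le_of_eq ?_) (integral_mono_ae i3
      ((integrable_of_norm_le (mop u) ⟨_, hop.mono fun x hx => hx u⟩).const_inner u)
      ((ae_sampleLaw_reward M pol μ).mono fun x hx => ?_))
    · rw [integral_sub ((i1 u.ofLp).const_mul _) ((i2 u.ofLp).const_mul _), integral_const_mul,
        integral_const_mul, j1, j2]
      ring
    · refine (le_sum_mul_updMat_mulVec hK0 hγ hx u.ofLp).trans_eq ?_
      simp only [updOp_apply, PiLp.inner_apply]
      exact Finset.sum_congr rfl fun p _ => by simp [mul_comm]
  · have i3 := ((i1 u.ofLp).const_mul 2).add ((i2 u.ofLp).const_mul 2)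
    refine (integral_mono_ae (integrable_norm_sq_of_norm_le (mop u) ⟨_, hop.mono fun x hx => hx u⟩)
      i3 ((ae_sampleLaw_reward M pol μ).mono fun x hx => ?_)).trans_eq ?_
    · simp only [EuclideanSpace.real_norm_sq_eq, updOp_apply]
      exact sum_sq_updMat_mulVec_le hK0 hγ.le hγ1.le hφ hx u.ofLp
    · rw [integral_add' ((i1 u.ofLp).const_mul 2) ((i2 u.ofLp).const_mul 2), integral_const_mul,
        integral_const_mul, j1, j2]
      ring

end Stability

/-! ### Distribution functions of the parametrized fields and the loss -/

section Cells

variable {γ : ℝ} {K : ℕ}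

lemma gap_pos (hK : 0 < (K : ℝ) * (1 - γ)) : 0 < gap γ K := inv_pos.2 hK

lemma gridPt_succ (k : ℕ) : gridPt γ K (k + 1) = gridPt γ K k + gap γ K := by
  unfold gridPt; push_cast; ring

lemma gridPt_nonneg (hK : 0 < (K : ℝ) * (1 - γ)) (k : ℕ) : 0 ≤ gridPt γ K k :=
  mul_nonneg (Nat.cast_nonneg k) (gap_pos hK).le

lemma gridPt_le_succ (hK : 0 < (K : ℝ) * (1 - γ)) (k : ℕ) :
    gridPt γ K k ≤ gridPt γ K (k + 1) := by
  rw [gridPt_succ]; linarith [gap_pos hK]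

lemma gridPt_le_iff (hK : 0 < (K : ℝ) * (1 - γ)) {x : ℝ} {m : ℕ}
    (hx : x ∈ Ioo (gridPt γ K m) (gridPt γ K (m + 1))) (k : ℕ) : gridPt γ K k ≤ x ↔ k ≤ m := by
  have hg := gap_pos hK
  refine ⟨fun h => ?_, fun h => ?_⟩
  · have h1 := h.trans_lt hx.2
    unfold gridPt at h1
    exact Nat.lt_succ_iff.1 (by exact_mod_cast lt_of_mul_lt_mul_right h1 hg.le)
  · refine le_trans ?_ hx.1.le
    unfold gridPt
    gcongr

lemma integral_cells (hK : 0 < (K : ℝ) * (1 - γ)) {f : ℝ → ℝ}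
    (hf : ∀ k < K, IntervalIntegrable f volume (gridPt γ K k) (gridPt γ K (k + 1))) :
    ∫ x in (0 : ℝ)..(1 - γ)⁻¹, f x =
      ∑ k : Fin K, ∫ x in gridPt γ K k..gridPt γ K (k + 1), f x := by
  have h := intervalIntegral.sum_integral_adjacent_intervals hf
  have e0 : gridPt γ K 0 = 0 := by simp [gridPt]
  have e1 : gridPt γ K K = (1 - γ)⁻¹ := by
    have : (K : ℝ) ≠ 0 := fun h => by simp [h] at hK
    unfold gridPt gap
    rw [mul_inv, ← mul_assoc, mul_inv_cancel₀ this, one_mul]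
  rw [e0, e1] at h
  rw [← h, Fin.sum_univ_eq_sum_range
    (fun k => ∫ x in gridPt γ K k..gridPt γ K (k + 1), f x) K]

variable {S : Type*} {d : ℕ} {φ : S → Fin d → ℝ}

lemma cdfValue_zero (θ : Fin K × Fin d → ℝ) (s : S) : cdfValue φ θ s 0 = 0 := rfl

lemma cdfValue_succ (θ : Fin K × Fin d → ℝ) (s : S) (k : Fin K) :
    cdfValue φ θ s (k + 1) = score φ θ s k + ((k : ℝ) + 1) / (K + 1) := by
  simp [cdfValue, score]

lemma cdfValue_last (θ : Fin K × Fin d → ℝ) (s : S) : cdfValue φ θ s (K + 1) = 1 := by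
  simp [cdfValue]

lemma etaOf_apply (θ : Fin K × Fin d → ℝ) (s : S) {B : Set ℝ} (hB : MeasurableSet B) :
    etaOf γ φ θ s B = ∑ k ∈ Finset.range (K + 1),
      (cdfValue φ θ s (k + 1) - cdfValue φ θ s k) * B.indicator 1 (gridPt γ K k) := by
  have e : ∀ (t : Finset ℕ) (f : ℕ → SignedMeasure ℝ), (∑ k ∈ t, f k) B = ∑ k ∈ t, f k B :=
    fun t f => by
      classical
      induction t using Finset.induction_on with
      | empty => simp
      | insert a t ha ih => rw [Finset.sum_insert ha, Finset.sum_insert ha, ← ih]; rfl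
  unfold etaOf
  rw [e]
  refine Finset.sum_congr rfl fun k _ => ?_
  rw [FunLike.coe_smul, Pi.smul_apply, smul_eq_mul,
    Measure.toSignedMeasure_apply_measurable hB, Measure.real, Measure.dirac_apply' _ hB]
  by_cases h : gridPt γ K k ∈ B <;> simp [h]

lemma cdf_etaOf (hK : 0 < (K : ℝ) * (1 - γ)) (θ : Fin K × Fin d → ℝ) (s : S) (k : Fin K) {x : ℝ}
    (hx : x ∈ Ioo (gridPt γ K k) (gridPt γ K (k + 1))) :
    cdf (etaOf γ φ θ s) x = score φ θ s k + ((k : ℝ) + 1) / (K + 1) := by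
  have h1 : ∀ j, (Icc (0 : ℝ) x).indicator (1 : ℝ → ℝ) (gridPt γ K j) =
      if j ≤ (k : ℕ) then 1 else 0 := fun j => by
    rw [indicator_apply]
    refine if_congr ?_ rfl rfl
    rw [mem_Icc, gridPt_le_iff hK hx]
    exact and_iff_right (gridPt_nonneg hK j)
  rw [cdf, etaOf_apply θ s measurableSet_Icc]
  simp only [h1, mul_ite, mul_one, mul_zero]
  rw [← Finset.sum_filter, show (Finset.range (K + 1)).filter (· ≤ (k : ℕ)) =
    Finset.range (k + 1) from ?_, Finset.sum_range_sub, cdfValue_zero, sub_zero, cdfValue_succ]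
  ext j
  have := k.2
  simp only [Finset.mem_filter, Finset.mem_range]; omega

lemma wass_etaOf (hK : 0 < (K : ℝ) * (1 - γ)) (θ θ' : Fin K × Fin d → ℝ) (s : S) :
    wass γ (etaOf γ φ θ s) (etaOf γ φ θ' s) = gap γ K * ∑ k, |score φ (θ - θ') s k| := by
  have h1 : ∀ k : Fin K, EqOn (fun _ => |score φ (θ - θ') s k|)
      (fun x => |cdf (etaOf γ φ θ s) x - cdf (etaOf γ φ θ' s) x|)
      (Ioo (gridPt γ K k) (gridPt γ K (k + 1))) := fun k x hx => by
    simp only [cdf_etaOf hK θ s k hx, cdf_etaOf hK θ' s k hx, score_sub, add_sub_add_right_eq_sub]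
  unfold wass
  rw [integral_cells hK, Finset.mul_sum]
  · refine Finset.sum_congr rfl fun k _ => ?_
    rw [← intervalIntegral.integral_congr_Ioo_of_le (gridPt_le_succ hK k) (h1 k),
      intervalIntegral.integral_const, gridPt_succ, add_sub_cancel_left, smul_eq_mul]
  · intro k hk
    refine IntervalIntegrable.congr_uIoo
      (intervalIntegrable_const (c := |score φ (θ - θ') s ⟨k, hk⟩|)) ?_
    rw [uIoo_of_le (gridPt_le_succ hK k)]
    exact h1 ⟨k, hk⟩

end Cells

section Loss

variable {γ : ℝ} {K d : ℕ} {S : Type*} [MeasurableSpace S] {φ : S → Fin d → ℝ} {μ : Measure S}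
  [IsProbabilityMeasure μ]

lemma loss_sq_eq (hK : 0 < (K : ℝ) * (1 - γ)) (θstar θ : Fin K × Fin d → ℝ) :
    loss γ μ φ θstar θ ^ 2 = ∫ s, (gap γ K * ∑ k, |score φ (θ - θstar) s k|) ^ 2 ∂μ := by
  unfold loss wassW
  rw [Real.sq_sqrt (integral_nonneg fun _ => sq_nonneg _)]
  simp only [wass_etaOf hK]

lemma wass_sq_le (hK : 0 < (K : ℝ) * (1 - γ)) (v : Fin K × Fin d → ℝ) (s : S) :
    (gap γ K * ∑ k, |score φ v s k|) ^ 2 ≤ (∑ k, score φ v s k ^ 2) / (K * (1 - γ) ^ 2) := by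
  have h := sq_sum_le_card_mul_sum_sq (s := Finset.univ) (f := fun k => |score φ v s k|)
  simp only [sq_abs, Finset.card_univ, Fintype.card_fin] at h
  have hK0 : (K : ℝ) ≠ 0 := fun h => by simp [h] at hK
  have h1 : (1 - γ) ≠ 0 := fun h => by simp [h] at hK
  rw [mul_pow]
  refine (mul_le_mul_of_nonneg_left h (sq_nonneg _)).trans_eq ?_
  unfold gap
  field_simp

/-- The Wasserstein loss is dominated by the weighted norm, through the Cauchy–Schwarz inequality
on the interval of length `(1 - γ)⁻¹`. -/
lemma loss_sq_le (hK : 0 < (K : ℝ) * (1 - γ)) (hφm : Measurable φ)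
    (hφ : ∀ s, euclNorm (φ s) ≤ 1) (θstar θ : Fin K × Fin d → ℝ) :
    loss γ μ φ θstar θ ^ 2 ≤ scoreForm μ φ (θ - θstar) / (K * (1 - γ) ^ 2) := by
  rw [loss_sq_eq hK, scoreForm, ← integral_div]
  exact integral_mono_of_nonneg (.of_forall fun s => sq_nonneg _)
    ((integrable_sum_score_sq hφm hφ _).div_const _) (.of_forall fun s => wass_sq_le hK _ s)

lemma measurable_loss_sq (hK : 0 < (K : ℝ) * (1 - γ)) (hφm : Measurable φ)
    (θstar : Fin K × Fin d → ℝ) : Measurable fun θ => loss γ μ φ θstar θ ^ 2 := by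
  simp only [loss_sq_eq hK]
  refine StronglyMeasurable.measurable (StronglyMeasurable.integral_prod_right
    (f := fun θ s => (gap γ K * ∑ k, |score φ (θ - θstar) s k|) ^ 2) ?_)
  refine Measurable.stronglyMeasurable (Measurable.pow_const (Measurable.const_mul
    (Finset.measurable_fun_sum _ fun k _ => Measurable.abs ?_) _) 2)
  exact (measurable_score hφm k).comp (measurable_snd.prodMk (measurable_fst.sub_const _))

end Loss

/-! ### The projected Bellman equation -/

section Abel

/-- Summation by parts. -/
lemma sum_sub_mul_eq (V ρ : ℕ → ℝ) (n : ℕ) :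
    ∑ j ∈ Finset.range (n + 1), (V (j + 1) - V j) * ρ j =
      V (n + 1) * ρ n - V 0 * ρ 0 + ∑ j ∈ Finset.range n, V (j + 1) * (ρ j - ρ (j + 1)) := by
  induction n with
  | zero => simp; ring
  | succ n ih => rw [Finset.sum_range_succ, ih, Finset.sum_range_succ]; ring

lemma sum_succ_mul_sub (ρ : ℕ → ℝ) (n : ℕ) :
    ∑ j ∈ Finset.range n, ((j : ℝ) + 1) * (ρ j - ρ (j + 1)) =
      ∑ j ∈ Finset.range n, ρ j - n * ρ n := by
  induction n with
  | zero => simp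
  | succ n ih => rw [Finset.sum_range_succ, ih, Finset.sum_range_succ]; push_cast; ring

end Abel

section Backup

variable {γ : ℝ} {K d : ℕ} {S : Type*} {φ : S → Fin d → ℝ}

/-- The value at `x` of the distribution function of the image of `η_θ(s')` under
`y ↦ r + γ y`, for `q = (r, s')`. -/
noncomputable def backupCdf (γ : ℝ) (φ : S → Fin d → ℝ) (θ : Fin K × Fin d → ℝ) (q : ℝ × S)
    (x : ℝ) : ℝ :=
  ∑ j ∈ Finset.range (K + 1), (cdfValue φ θ q.2 (j + 1) - cdfValue φ θ q.2 j) *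
    (Icc (0 : ℝ) x).indicator 1 (q.1 + γ * gridPt γ K j)

lemma map_etaOf_apply (θ : Fin K × Fin d → ℝ) (q : ℝ × S) (x : ℝ) :
    ((etaOf γ φ θ q.2).map (fun y : ℝ => q.1 + γ * y)) (Icc 0 x) = backupCdf γ φ θ q x := by
  have hm : Measurable fun y : ℝ => q.1 + γ * y := by fun_prop
  rw [VectorMeasure.map_apply _ hm measurableSet_Icc, etaOf_apply θ _ (hm measurableSet_Icc)]
  rfl

/-- The integral over `[a, b]` of the distribution function of `δ_y`. -/
lemma integral_step {a b y : ℝ} (hab : a ≤ b) (hy : 0 ≤ y) :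
    ∫ x in a..b, (Icc (0 : ℝ) x).indicator (1 : ℝ → ℝ) y = b - max a (min b y) := by
  set m := max a (min b y) with hm
  have ham : a ≤ m := le_max_left _ _
  have hmb : m ≤ b := max_le hab (min_le_left _ _)
  have h1 : EqOn (fun _ => (0 : ℝ)) (fun x => (Icc (0 : ℝ) x).indicator (1 : ℝ → ℝ) y)
      (Ioo a m) := fun x hx => by
    have : x < min b y := (lt_max_iff.1 hx.2).resolve_left (not_lt.2 hx.1.le)
    have h : y ∉ Icc (0 : ℝ) x := fun h => absurd (this.trans_le (min_le_right _ _)) (not_lt.2 h.2)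
    simp [indicator_of_notMem h]
  have h2 : EqOn (fun _ => (1 : ℝ)) (fun x => (Icc (0 : ℝ) x).indicator (1 : ℝ → ℝ) y)
      (Ioo m b) := fun x hx => by
    have : min b y < x := (le_max_right _ _).trans_lt hx.1
    have h : y ∈ Icc (0 : ℝ) x := ⟨hy, ((min_lt_iff.1 this).resolve_left (not_lt.2 hx.2.le)).le⟩
    simp [indicator_of_mem h]
  rw [← intervalIntegral.integral_add_adjacent_intervals
    (intervalIntegrable_const.congr_uIoo (by rwa [uIoo_of_le ham]))
    (intervalIntegrable_const.congr_uIoo (by rwa [uIoo_of_le hmb])),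
    ← intervalIntegral.integral_congr_Ioo_of_le ham h1,
    ← intervalIntegral.integral_congr_Ioo_of_le hmb h2]
  simp

lemma intervalIntegrable_step (a b y : ℝ) :
    IntervalIntegrable (fun x => (Icc (0 : ℝ) x).indicator (1 : ℝ → ℝ) y) volume a b := by
  rcases le_or_gt 0 y with hy | hy
  · have : Monotone fun x => (Icc (0 : ℝ) x).indicator (1 : ℝ → ℝ) y := fun x z hxz =>
      indicator_le_indicator_of_subset (Icc_subset_Icc_right hxz) (fun _ => zero_le_one) _
    exact this.intervalIntegrable
  · have e : (fun x => (Icc (0 : ℝ) x).indicator (1 : ℝ → ℝ) y) = fun _ => 0 := by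
      ext x
      exact indicator_of_notMem (fun h => absurd h.1 (not_le.2 hy)) _
    rw [e]
    exact intervalIntegrable_const

/-- The mean over a cell of the distribution function of the shifted support point is the value of
its projection on that cell. -/
lemma integral_cell_step {r : ℝ} (hK : 0 < (K : ℝ) * (1 - γ)) (hγ : 0 ≤ γ) (hr : 0 ≤ r)
    (j k : ℕ) :
    ∫ x in gridPt γ K k..gridPt γ K (k + 1),
      (Icc (0 : ℝ) x).indicator (1 : ℝ → ℝ) (r + γ * gridPt γ K j) =
      gap γ K * ramp (k + 1 - shiftPos γ K r j) := by
  have hg := gap_pos hK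
  have e : r + γ * gridPt γ K j = shiftPos γ K r j * gap γ K := by
    unfold gridPt gap shiftPos
    rw [add_mul, mul_assoc r, mul_inv_cancel₀ hK.ne']
    ring
  rw [integral_step (gridPt_le_succ hK k)
    (add_nonneg hr (mul_nonneg hγ (gridPt_nonneg hK j))), e]
  have e1 : gridPt γ K (k + 1) = (k + 1) * gap γ K := by unfold gridPt; push_cast; rfl
  have e2 : gridPt γ K k = k * gap γ K := rfl
  rw [e1, e2, ← min_mul_of_nonneg _ _ hg.le, ← max_mul_of_nonneg _ _ hg.le, ← sub_mul, mul_comm]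
  congr 1
  unfold ramp
  simp only [max_def, min_def]; split_ifs <;> linarith

/-- The mean over the `k`-th cell of the distribution function of the image of `η_θ(s')`. -/
noncomputable def backupCell (γ : ℝ) (φ : S → Fin d → ℝ) (θ : Fin K × Fin d → ℝ) (q : ℝ × S)
    (k : Fin K) : ℝ :=
  ∑ j ∈ Finset.range (K + 1), (cdfValue φ θ q.2 (j + 1) - cdfValue φ θ q.2 j) *
    ramp (k + 1 - shiftPos γ K q.1 j)

lemma integral_backupCdf (hK : 0 < (K : ℝ) * (1 - γ)) (hγ : 0 ≤ γ) (θ : Fin K × Fin d → ℝ)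
    {q : ℝ × S} (hr : 0 ≤ q.1) (k : Fin K) :
    ∫ x in gridPt γ K k..gridPt γ K (k + 1), backupCdf γ φ θ q x =
      gap γ K * backupCell γ φ θ q k := by
  unfold backupCdf backupCell
  rw [intervalIntegral.integral_finsetSum fun j _ => (intervalIntegrable_step _ _ _).const_mul _,
    Finset.mul_sum]
  refine Finset.sum_congr rfl fun j _ => ?_
  rw [intervalIntegral.integral_const_mul, integral_cell_step hK hγ hr]
  ring

/-- The residual of the linear system is the residual of the projected Bellman equation, by a
summation by parts. -/
lemma residual_apply {A : Type*} (hK : 0 < (K : ℝ) * (1 - γ)) (hγ : 0 ≤ γ)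
    (θ : Fin K × Fin d → ℝ) {x : S × (A × (ℝ × S))} (hr : 0 ≤ x.2.2.1) (p : Fin K × Fin d) :
    (residual γ φ θ x).ofLp p = φ x.1 p.2 * (backupCell γ φ θ x.2.2 p.1 -
      (score φ θ x.1 p.1 + (((p.1 : ℕ) : ℝ) + 1) / (K + 1))) := by
  obtain ⟨k, i⟩ := p
  set ρ : ℕ → ℝ := fun j => ramp (k + 1 - shiftPos γ K x.2.2.1 j) with hρ
  have e1 : (residual γ φ θ x).ofLp (k, i) = updVec γ K φ x (k, i) -
    (updMat γ K φ x *ᵥ θ) (k, i) := rfl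
  have e2 : backupCell γ φ θ x.2.2 k = ρ K + ∑ j : Fin K,
      (score φ θ x.2.2.2 j + ((j : ℝ) + 1) / (K + 1)) * (ρ j - ρ (j + 1)) := by
    have h := sum_sub_mul_eq (cdfValue φ θ x.2.2.2) ρ K
    rw [cdfValue_last, cdfValue_zero, zero_mul, sub_zero, one_mul, ← Fin.sum_univ_eq_sum_range
      (fun j => cdfValue φ θ x.2.2.2 (j + 1) * (ρ j - ρ (j + 1))) K] at h
    simp only [cdfValue_succ] at h
    exact h
  have e3 : ∑ j : Fin K, (((j : ℕ) : ℝ) + 1) / (K + 1) * (ρ j - ρ (j + 1)) =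
      ((K : ℝ) + 1)⁻¹ * (∑ j ∈ Finset.range (K + 1), ρ j) - ρ K := by
    have h := sum_succ_mul_sub ρ K
    rw [← Fin.sum_univ_eq_sum_range (fun j => ((j : ℝ) + 1) * (ρ j - ρ (j + 1))) K] at h
    have hK1 : (K : ℝ) + 1 ≠ 0 := by positivity
    rw [Finset.sum_range_succ]
    calc ∑ j : Fin K, (((j : ℕ) : ℝ) + 1) / (K + 1) * (ρ j - ρ (j + 1))
        = ((K : ℝ) + 1)⁻¹ * ∑ j : Fin K, (((j : ℕ) : ℝ) + 1) * (ρ j - ρ (j + 1)) := by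
          rw [Finset.mul_sum]
          exact Finset.sum_congr rfl fun j _ => by ring
      _ = _ := by rw [h]; field_simp; ring
  have e4 : (transMat γ K x.2.2.1 *ᵥ score φ θ x.2.2.2) k =
      ∑ j : Fin K, score φ θ x.2.2.2 j * (ρ j - ρ (j + 1)) := by
    simp only [Matrix.mulVec, dotProduct, transMat, Matrix.of_apply, hρ]
    exact Finset.sum_congr rfl fun j _ => mul_comm _ _
  rw [e1, updMat_mulVec, updVec, cumMat_mulVec_sum_gVec hK hγ hr, cumMat_conj_gTilde hK hγ hr, e4,
    e2]
  simp only [add_mul, Finset.sum_add_distrib]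
  rw [e3]
  have hρ' : ∑ j ∈ Finset.range (K + 1), ramp (k + 1 - shiftPos γ K x.2.2.1 j) =
    ∑ j ∈ Finset.range (K + 1), ρ j := rfl
  rw [hρ']
  ring

lemma abs_cdfValue_le (hφ : ∀ s, euclNorm (φ s) ≤ 1) (θ : Fin K × Fin d → ℝ) (s : S) (j : ℕ) :
    |cdfValue φ θ s j| ≤ ∑ p, |θ p| + 1 := by
  have h0 : 0 ≤ ∑ p, |θ p| := Finset.sum_nonneg fun _ _ => abs_nonneg _
  rcases j with _ | j
  · rw [cdfValue_zero, abs_zero]; linarith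
  by_cases hj : j < K
  · rw [cdfValue_succ θ s ⟨j, hj⟩]
    refine (abs_add_le _ _).trans (add_le_add ((abs_score_le hφ s θ ⟨j, hj⟩).trans ?_) ?_)
    · rw [Fintype.sum_prod_type]
      exact Finset.single_le_sum (f := fun k => ∑ i, |θ (k, i)|)
        (fun k _ => Finset.sum_nonneg fun _ _ => abs_nonneg _) (Finset.mem_univ _)
    · have : (j : ℝ) + 1 ≤ K := by exact_mod_cast hj
      rw [abs_of_nonneg (by positivity), div_le_one (by positivity)]
      simp only
      linarith
  · have e : cdfValue φ θ s (j + 1) = 1 := by simp [cdfValue, hj]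
    rw [e, abs_one]; linarith

lemma sum_abs_mul_le (hφ : ∀ s, euclNorm (φ s) ≤ 1) (θ : Fin K × Fin d → ℝ) (s : S)
    (c : ℕ → ℝ) (hc : ∀ j, |c j| ≤ 1) :
    |∑ j ∈ Finset.range (K + 1), (cdfValue φ θ s (j + 1) - cdfValue φ θ s j) * c j| ≤
      (K + 1) * (2 * (∑ p, |θ p| + 1)) := by
  refine (Finset.abs_sum_le_sum_abs _ _).trans ((Finset.sum_le_card_nsmul _ _
    (2 * (∑ p, |θ p| + 1)) fun j _ => ?_).trans_eq (by simp))
  rw [abs_mul]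
  have h1 := abs_cdfValue_le hφ θ s (j + 1)
  have h2 := abs_cdfValue_le hφ θ s j
  have h3 := abs_sub (cdfValue φ θ s (j + 1)) (cdfValue φ θ s j)
  refine (mul_le_of_le_one_right (abs_nonneg _) (hc j)).trans ?_
  linarith

lemma abs_backupCdf_le (hφ : ∀ s, euclNorm (φ s) ≤ 1) (θ : Fin K × Fin d → ℝ) (q : ℝ × S)
    (x : ℝ) : |backupCdf γ φ θ q x| ≤ (K + 1) * (2 * (∑ p, |θ p| + 1)) :=
  sum_abs_mul_le hφ θ q.2 _ fun j => by
    rw [indicator_apply]; split_ifs <;> simp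

lemma abs_backupCell_le (hφ : ∀ s, euclNorm (φ s) ≤ 1) (θ : Fin K × Fin d → ℝ) (q : ℝ × S)
    (k : Fin K) : |backupCell γ φ θ q k| ≤ (K + 1) * (2 * (∑ p, |θ p| + 1)) :=
  sum_abs_mul_le hφ θ q.2 _ fun j => by
    rw [abs_of_nonneg (ramp_nonneg _)]; exact ramp_le_one _

variable [MeasurableSpace S]

lemma measurable_cdfValue (hφm : Measurable φ) (θ : Fin K × Fin d → ℝ) (j : ℕ) :
    Measurable fun s => cdfValue φ θ s j := by
  rcases j with _ | j
  · simp only [cdfValue_zero]; exact measurable_const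
  by_cases hj : j < K
  · have e : (fun s => cdfValue φ θ s (j + 1)) = fun s =>
      score φ θ s ⟨j, hj⟩ + ((j : ℝ) + 1) / (K + 1) := funext fun s => cdfValue_succ θ s ⟨j, hj⟩
    rw [e]
    exact (measurable_score_left hφm θ _).add_const _
  · have e : (fun s => cdfValue φ θ s (j + 1)) = fun _ => 1 := by
      ext s; simp [cdfValue, hj]
    rw [e]
    exact measurable_const

lemma measurable_backupCdf (hφm : Measurable φ) (θ : Fin K × Fin d → ℝ) :
    Measurable fun p : (ℝ × S) × ℝ => backupCdf γ φ θ p.1 p.2 := by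
  unfold backupCdf
  refine Finset.measurable_fun_sum _ fun j _ => Measurable.mul ?_ ?_
  · exact ((measurable_cdfValue hφm θ _).comp measurable_fst.snd).sub
      ((measurable_cdfValue hφm θ _).comp measurable_fst.snd)
  · have e : (fun p : (ℝ × S) × ℝ =>
        (Icc (0 : ℝ) p.2).indicator (1 : ℝ → ℝ) (p.1.1 + γ * gridPt γ K j)) =
        fun p =>
        if 0 ≤ p.1.1 + γ * gridPt γ K j ∧ p.1.1 + γ * gridPt γ K j ≤ p.2 then 1 else 0 := by
      ext p; simp [indicator_apply]
    rw [e]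
    have h1 : Measurable fun p : (ℝ × S) × ℝ => p.1.1 + γ * gridPt γ K j :=
      measurable_fst.fst.add_const _
    exact Measurable.ite ((measurableSet_le measurable_const h1).inter
      (measurableSet_le h1 measurable_snd)) measurable_const measurable_const

lemma measurable_backupCell (hφm : Measurable φ) (θ : Fin K × Fin d → ℝ) (k : Fin K) :
    Measurable fun q : ℝ × S => backupCell γ φ θ q k := by
  unfold backupCell
  have hr : Measurable ramp := ramp_mono.measurable
  refine Finset.measurable_fun_sum _ fun j _ => Measurable.mul ?_ (hr.comp ?_)
  · exact ((measurable_cdfValue hφm θ _).comp measurable_snd).sub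
      ((measurable_cdfValue hφm θ _).comp measurable_snd)
  · unfold shiftPos; fun_prop

end Backup

section FirstOrder

lemma measurable_intervalIntegral {S : Type*} [MeasurableSpace S] {f : S → ℝ → ℝ}
    (hf : Measurable fun p : S × ℝ => f p.1 p.2) {a b : ℝ} (hab : a ≤ b) :
    Measurable fun s => ∫ x in a..b, f s x := by
  simp only [intervalIntegral.integral_of_le hab]
  exact (StronglyMeasurable.integral_prod_right (f := f) hf.stronglyMeasurable).measurable

lemma intervalIntegrable_of_abs_le {f : ℝ → ℝ} (hf : Measurable f) {R : ℝ} (hR : ∀ x, |f x| ≤ R)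
    (a b : ℝ) : IntervalIntegrable f volume a b :=
  intervalIntegrable_const (c := R) |>.mono_fun hf.aestronglyMeasurable
    (.of_forall fun x => (hR x).trans (le_abs_self R))

lemma eq_zero_of_forall_quadratic_nonneg {B G : ℝ} (hG : 0 ≤ G)
    (h : ∀ t : ℝ, 0 ≤ t ^ 2 * G - 2 * t * B) : B = 0 := by
  -- The minimizer is at `B / G`; the denominator `G + 1` also covers `G = 0`.
  have h1 := h (B / (G + 1))
  have e : (B / (G + 1)) ^ 2 * G - 2 * (B / (G + 1)) * B = -(B ^ 2 * (G + 2) / (G + 1) ^ 2) := by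
    field_simp; ring
  rw [e] at h1
  by_contra hB
  have : 0 < B ^ 2 * (G + 2) / (G + 1) ^ 2 := by positivity
  linarith

variable {S A : Type*} [MeasurableSpace S] [MeasurableSpace A] {M : MDP S A} {pol : Kernel S A}
  [IsMarkovKernel pol] {μ : Measure S} [IsProbabilityMeasure μ] {d K : ℕ} {φ : S → Fin d → ℝ}

/-- The distribution function of the Bellman image of `η_θ`. -/
noncomputable def bellmanCdf (M : MDP S A) (pol : Kernel S A) (φ : S → Fin d → ℝ)
    (θ : Fin K × Fin d → ℝ) (s : S) (x : ℝ) : ℝ :=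
  ∫ q, backupCdf M.γ φ θ q x ∂(stepKernel M pol s)

lemma measurable_bellmanCdf (hφm : Measurable φ) (θ : Fin K × Fin d → ℝ) :
    Measurable fun p : S × ℝ => bellmanCdf M pol φ θ p.1 p.2 := by
  have h : StronglyMeasurable fun y : (S × ℝ) × (ℝ × S) => backupCdf M.γ φ θ y.2 y.1.2 :=
    ((measurable_backupCdf hφm θ).comp
      (measurable_snd.prodMk measurable_fst.snd)).stronglyMeasurable
  exact (h.integral_kernel_prod_right' (κ := (stepKernel M pol).prodMkRight ℝ)).measurable

lemma abs_bellmanCdf_le (hφ : ∀ s, euclNorm (φ s) ≤ 1) (θ : Fin K × Fin d → ℝ) (s : S) (x : ℝ) :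
    |bellmanCdf M pol φ θ s x| ≤ (K + 1) * (2 * (∑ p, |θ p| + 1)) := by
  have h := norm_integral_le_of_norm_le_const (μ := stepKernel M pol s)
    (f := fun q => backupCdf M.γ φ θ q x) (.of_forall fun q => abs_backupCdf_le hφ θ q x)
  unfold bellmanCdf
  simpa using h

lemma integral_bellmanCdf (hK : 0 < (K : ℝ) * (1 - M.γ)) (hφm : Measurable φ)
    (hφ : ∀ s, euclNorm (φ s) ≤ 1) (θ : Fin K × Fin d → ℝ) (s : S) (k : Fin K) :
    ∫ x in gridPt M.γ K k..gridPt M.γ K (k + 1), bellmanCdf M pol φ θ s x =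
      gap M.γ K * ∫ q, backupCell M.γ φ θ q k ∂(stepKernel M pol s) := by
  have hle := gridPt_le_succ hK k
  rw [intervalIntegral.integral_of_le hle]
  unfold bellmanCdf
  rw [integral_integral_swap, ← integral_const_mul]
  · refine integral_congr_ae ((ae_stepKernel_reward M pol s).mono fun q hq => ?_)
    simp only
    rw [← intervalIntegral.integral_of_le hle, integral_backupCdf hK M.γ_pos.le θ hq.1]
  · refine .of_bound ((measurable_backupCdf hφm θ).comp measurable_swap).aestronglyMeasurable
      ((K + 1) * (2 * (∑ p, |θ p| + 1))) (.of_forall fun p => ?_)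
    exact abs_backupCdf_le hφ θ p.2 p.1

/-- The squared Cramér distance of a bounded function to the distribution function of
`η_{θ + t ν}`, expanded in `t`. -/
lemma cramerSq_add_smul (hK : 0 < (K : ℝ) * (1 - M.γ)) (hφm : Measurable φ)
    (hφ : ∀ s, euclNorm (φ s) ≤ 1) {θ : Fin K × Fin d → ℝ} {ζ : SignedMeasure ℝ} {s : S}
    (hζ : ∀ x, cdf ζ x = bellmanCdf M pol φ θ s x) (ν : Fin K × Fin d → ℝ) (t : ℝ) :
    cramerSq M.γ ζ (etaOf M.γ φ (θ + t • ν) s) =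
      ∑ k : Fin K, (∫ x in gridPt M.γ K k..gridPt M.γ K (k + 1),
        (bellmanCdf M pol φ θ s x - (score φ θ s k + (((k : ℕ) : ℝ) + 1) / (K + 1))) ^ 2) -
      2 * t * (gap M.γ K * ∑ k : Fin K, score φ ν s k *
        (∫ q, backupCell M.γ φ θ q k ∂(stepKernel M pol s) -
          (score φ θ s k + (((k : ℕ) : ℝ) + 1) / (K + 1)))) +
      t ^ 2 * (gap M.γ K * ∑ k : Fin K, score φ ν s k ^ 2) := by
  set f := bellmanCdf M pol φ θ s with hf
  have hfm : Measurable f := (measurable_bellmanCdf hφm θ).comp measurable_prodMk_left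
  have hfb : ∀ x, |f x| ≤ (K + 1) * (2 * (∑ p, |θ p| + 1)) := abs_bellmanCdf_le hφ θ s
  have hsq : ∀ c : ℝ, ∀ a b, IntervalIntegrable (fun x => (f x - c) ^ 2) volume a b := fun c a b =>
    intervalIntegrable_of_abs_le ((hfm.sub_const c).pow_const 2)
      (R := ((K + 1) * (2 * (∑ p, |θ p| + 1)) + |c|) ^ 2) (fun x => by
        rw [abs_pow]
        exact pow_le_pow_left₀ (abs_nonneg _)
          ((abs_sub _ _).trans (add_le_add (hfb x) le_rfl)) 2) a b
  have hi : ∀ a b, IntervalIntegrable f volume a b := intervalIntegrable_of_abs_le hfm hfb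
  set c : Fin K → ℝ := fun k => score φ θ s k + (((k : ℕ) : ℝ) + 1) / (K + 1) with hc
  have h1 : ∀ k : Fin K, EqOn (fun x => (f x - (c k + t * score φ ν s k)) ^ 2)
      (fun x => (cdf ζ x - cdf (etaOf M.γ φ (θ + t • ν) s) x) ^ 2)
      (Ioo (gridPt M.γ K k) (gridPt M.γ K (k + 1))) := fun k x hx => by
    simp only [hζ, cdf_etaOf hK _ s k hx, score_add, score_smul, hc]
    ring
  unfold cramerSq
  rw [integral_cells hK]
  · rw [Finset.mul_sum, Finset.mul_sum, Finset.mul_sum, Finset.mul_sum,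
      ← Finset.sum_sub_distrib, ← Finset.sum_add_distrib]
    refine Finset.sum_congr rfl fun k _ => ?_
    rw [← intervalIntegral.integral_congr_Ioo_of_le (gridPt_le_succ hK k) (h1 k)]
    have e : ∀ x, (f x - (c k + t * score φ ν s k)) ^ 2 =
        (f x - c k) ^ 2 - 2 * t * score φ ν s k * (f x - c k) + (t * score φ ν s k) ^ 2 :=
      fun x => by ring
    simp only [e]
    rw [intervalIntegral.integral_add ((hsq _ _ _).sub
        (((hi _ _).sub intervalIntegrable_const).const_mul _)) intervalIntegrable_const,
      intervalIntegral.integral_sub (hsq _ _ _)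
        (((hi _ _).sub intervalIntegrable_const).const_mul _),
      intervalIntegral.integral_const_mul, intervalIntegral.integral_sub (hi _ _)
        intervalIntegrable_const, intervalIntegral.integral_const, intervalIntegral.integral_const,
      hf, integral_bellmanCdf hK hφm hφ, gridPt_succ, add_sub_cancel_left, smul_eq_mul, smul_eq_mul]
    ring
  · intro k hk
    refine IntervalIntegrable.congr_uIoo (hsq (c ⟨k, hk⟩ + t * score φ ν s ⟨k, hk⟩) _ _) ?_
    rw [uIoo_of_le (gridPt_le_succ hK k)]
    exact h1 ⟨k, hk⟩

/-- The residual of a solution of the projected Bellman equation is centred. This is the first-order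
condition for the minimizer of the quadratic function `θ' ↦ ℓ_2(T η_θ, η_θ')²` at `θ' = θ`. -/
theorem integral_residual_eq_zero (hK : 0 < (K : ℝ) * (1 - M.γ)) (hφm : Measurable φ)
    (hφ : ∀ s, euclNorm (φ s) ≤ 1) {θ : Fin K × Fin d → ℝ}
    (hθ : IsProjectedFixedPoint M pol μ φ θ) :
    ∫ x, residual M.γ φ θ x ∂(sampleLaw M pol μ) = 0 := by
  obtain ⟨ζ, hζ, hmin⟩ := hθ
  have hcdf : ∀ s x, cdf (ζ s) x = bellmanCdf M pol φ θ s x := fun s x => by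
    unfold cdf bellmanCdf
    rw [hζ s _ measurableSet_Icc]
    simp only [map_etaOf_apply]
  set R := ((K : ℝ) + 1) * (2 * (∑ p, |θ p| + 1)) with hR
  set c : S → Fin K → ℝ := fun s k => score φ θ s k + (((k : ℕ) : ℝ) + 1) / (K + 1) with hc
  have hcm : ∀ k, Measurable fun s => c s k := fun k => (measurable_score_left hφm θ k).add_const _
  have hcb : ∀ s k, |c s k| ≤ ∑ p, |θ p| + 1 := fun s k => by
    rw [hc]; simp only; rw [← cdfValue_succ]; exact abs_cdfValue_le hφ θ s _
  have hcellm : ∀ k, Measurable fun s => ∫ q, backupCell M.γ φ θ q k ∂(stepKernel M pol s) :=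
    fun k => (StronglyMeasurable.integral_kernel_prod_right' (κ := stepKernel M pol)
      (f := fun p : S × (ℝ × S) => backupCell M.γ φ θ p.2 k)
      ((measurable_backupCell hφm θ k).comp measurable_snd).stronglyMeasurable).measurable
  have hcelli : ∀ k s, Integrable (fun q => backupCell M.γ φ θ q k) (stepKernel M pol s) :=
    fun k s => .of_bound (measurable_backupCell hφm θ k).aestronglyMeasurable R
      (.of_forall fun q => abs_backupCell_le hφ θ q k)
  have hcellb : ∀ k s, |∫ q, backupCell M.γ φ θ q k ∂(stepKernel M pol s)| ≤ R := fun k s => by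
    have h := norm_integral_le_of_norm_le_const (μ := stepKernel M pol s)
      (f := fun q => backupCell M.γ φ θ q k) (.of_forall fun q => abs_backupCell_le hφ θ q k)
    simpa using h
  -- the first-order condition in the direction `ν`
  have key : ∀ ν : Fin K × Fin d → ℝ, ∫ s, gap M.γ K * ∑ k : Fin K, score φ ν s k *
      (∫ q, backupCell M.γ φ θ q k ∂(stepKernel M pol s) - c s k) ∂μ = 0 := fun ν => by
    have ia : Integrable (fun s => ∑ k : Fin K,
        ∫ x in gridPt M.γ K k..gridPt M.γ K (k + 1), (bellmanCdf M pol φ θ s x - c s k) ^ 2) μ := by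
      refine integrable_finsetSum _ fun k _ => .of_bound (measurable_intervalIntegral
        (((measurable_bellmanCdf hφm θ).sub ((hcm k).comp measurable_fst)).pow_const 2)
        (gridPt_le_succ hK k)).aestronglyMeasurable
        ((R + (∑ p, |θ p| + 1)) ^ 2 * |gridPt M.γ K (k + 1) - gridPt M.γ K k|)
        (.of_forall fun s => ?_)
      refine intervalIntegral.norm_integral_le_of_norm_le_const fun x _ => ?_
      rw [norm_pow]
      exact pow_le_pow_left₀ (norm_nonneg _) ((abs_sub _ _).trans
        (add_le_add (abs_bellmanCdf_le hφ θ s x) (hcb s k))) 2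
    have ib : Integrable (fun s => gap M.γ K * ∑ k : Fin K, score φ ν s k *
        (∫ q, backupCell M.γ φ θ q k ∂(stepKernel M pol s) - c s k)) μ := by
      refine (integrable_finsetSum _ fun k _ => .of_bound ((measurable_score_left hφm ν k).mul
        ((hcellm k).sub (hcm k))).aestronglyMeasurable
        ((∑ i, |ν (k, i)|) * (R + (∑ p, |θ p| + 1))) (.of_forall fun s => ?_)).const_mul _
      refine (norm_mul (score φ ν s k) _).trans_le ?_
      exact mul_le_mul (abs_score_le hφ s ν k) ((abs_sub _ _).trans
        (add_le_add (hcellb k s) (hcb s k))) (norm_nonneg _)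
        (Finset.sum_nonneg fun _ _ => abs_nonneg _)
    have ig : Integrable (fun s => gap M.γ K * ∑ k : Fin K, score φ ν s k ^ 2) μ :=
      (integrable_sum_score_sq hφm hφ ν).const_mul _
    refine eq_zero_of_forall_quadratic_nonneg
      (G := ∫ s, gap M.γ K * ∑ k : Fin K, score φ ν s k ^ 2 ∂μ)
      (integral_nonneg fun s => mul_nonneg (gap_pos hK).le
        (Finset.sum_nonneg fun _ _ => sq_nonneg _)) fun t => ?_
    have hnn : ∀ θ' : Fin K × Fin d → ℝ,
        0 ≤ ∫ s, cramerSq M.γ (ζ s) (etaOf M.γ φ θ' s) ∂μ := fun θ' =>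
      integral_nonneg fun s => intervalIntegral.integral_nonneg
        (inv_nonneg.2 (by linarith [M.γ_lt_one])) fun x _ => sq_nonneg _
    have h := hmin (θ + t • ν)
    unfold cramerW at h
    rw [Real.sqrt_le_sqrt_iff (hnn _)] at h
    have e0 : ∀ s, cramerSq M.γ (ζ s) (etaOf M.γ φ θ s) = ∑ k : Fin K,
        ∫ x in gridPt M.γ K k..gridPt M.γ K (k + 1),
          (bellmanCdf M pol φ θ s x - c s k) ^ 2 := fun s => by
      have := cramerSq_add_smul (t := 0) hK hφm hφ (hcdf s) ν
      simpa using this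
    have e1 : ∀ s, cramerSq M.γ (ζ s) (etaOf M.γ φ (θ + t • ν) s) = ∑ k : Fin K,
        (∫ x in gridPt M.γ K k..gridPt M.γ K (k + 1), (bellmanCdf M pol φ θ s x - c s k) ^ 2) -
        2 * t * (gap M.γ K * ∑ k : Fin K, score φ ν s k *
          (∫ q, backupCell M.γ φ θ q k ∂(stepKernel M pol s) - c s k)) +
        t ^ 2 * (gap M.γ K * ∑ k : Fin K, score φ ν s k ^ 2) := fun s =>
      cramerSq_add_smul hK hφm hφ (hcdf s) ν t
    simp only [e0, e1] at h
    have h2 := integral_sub ia (ib.const_mul (2 * t))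
    have h3 := integral_add (ia.sub (ib.const_mul (2 * t))) (ig.const_mul (t ^ 2))
    simp only [Pi.sub_apply] at h3
    rw [h3, h2, integral_const_mul (2 * t), integral_const_mul (t ^ 2)] at h
    linarith
  -- the coordinates of the residual
  set f : Fin K × Fin d → S × (ℝ × S) → ℝ := fun p y =>
    φ y.1 p.2 * (backupCell M.γ φ θ y.2 p.1 - c y.1 p.1) with hf
  have hfm : ∀ p, Measurable (f p) := fun p => ((measurable_feature hφm p.2).comp
    measurable_fst).mul (((measurable_backupCell hφm θ p.1).comp measurable_snd).sub
      ((hcm p.1).comp measurable_fst))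
  have hfb : ∀ p y, ‖f p y‖ ≤ R + (∑ p, |θ p| + 1) := fun p y => by
    rw [hf, norm_mul]
    refine (mul_le_of_le_one_left (norm_nonneg _) (abs_feature_le_one hφ _ _)).trans ?_
    exact (abs_sub _ _).trans (add_le_add (abs_backupCell_le hφ θ _ _) (hcb _ _))
  have hresf : ∀ p, (fun x => f p (x.1, x.2.2)) =ᵐ[sampleLaw M pol μ]
      fun x => (residual M.γ φ θ x).ofLp p := fun p =>
    (ae_sampleLaw_reward M pol μ).mono fun x hx =>
      (residual_apply hK M.γ_pos.le θ hx.1 p).symm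
  have hres : ∀ p, Integrable (fun x => (residual M.γ φ θ x).ofLp p) (sampleLaw M pol μ) :=
    fun p => Integrable.congr (.of_bound ((hfm p).comp (measurable_fst.prodMk
      measurable_snd.snd)).aestronglyMeasurable _ (.of_forall fun x => hfb p _)) (hresf p)
  ext p
  rw [eval_integral_piLp hres, ← integral_congr_ae (hresf p),
    integral_sampleLaw M pol μ (hfm p) ⟨_, .of_forall (hfb p)⟩]
  obtain ⟨k, i⟩ := p
  have h := key (Pi.single (k, i) 1)
  have hs : ∀ s l, score φ (Pi.single (k, i) 1 : Fin K × Fin d → ℝ) s l =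
      if l = k then φ s i else 0 := fun s l => by
    simp only [score, dotProduct, Pi.single_apply, Prod.mk.injEq, mul_ite, mul_one, mul_zero]
    by_cases hl : l = k <;> simp [hl]
  simp only [hs, ite_mul, zero_mul, Finset.sum_ite_eq', Finset.mem_univ, if_true] at h
  rw [integral_const_mul] at h
  have h1 := (mul_eq_zero.1 h).resolve_left (gap_pos hK).ne'
  have h2 : ∀ s, ∫ q, f (k, i) (s, q) ∂(stepKernel M pol s) =
      φ s i * (∫ q, backupCell M.γ φ θ q k ∂(stepKernel M pol s) - c s k) := fun s => by
    simp only [hf]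
    rw [integral_const_mul, integral_sub (hcelli k s) (integrable_const _)]
    simp
  simp only [h2]
  exact h1

end FirstOrder

/-! ### From the error bound to the sample complexity -/

section Numeric

lemma sq_mul_exp_neg_posLog_le {u : ℝ} (hu : 0 ≤ u) :
    u ^ 2 * Real.exp (-(2 * Real.posLog u)) ≤ 1 := by
  rcases hu.eq_or_lt with rfl | hu
  · simp
  have h1 : Real.log u ≤ Real.posLog u := le_max_right _ _
  have h2 : u ≤ Real.exp (Real.posLog u) := by
    rw [← Real.log_le_iff_le_exp hu]; exact h1
  have h3 : u ^ 2 ≤ Real.exp (2 * Real.posLog u) := by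
    rw [two_mul, Real.exp_add, ← sq]; gcongr
  rw [Real.exp_neg, ← div_eq_mul_inv]
  exact div_le_one_of_le₀ h3 (Real.exp_pos _).le

/-- Square roots of the parameters, in which all the bounds are rational. -/
lemma sqrt_rpow_aux {α g lam : ℝ} (hα : 0 < α) (hg : 0 < g) (hlam : 0 < lam) :
    ∃ a p q : ℝ, 0 < a ∧ 0 < p ∧ 0 < q ∧ α = a ^ 2 ∧ g = p ^ 2 ∧ lam = q ^ 2 ∧ √α = a ∧
      √lam = q ∧ √(g * lam) = p * q ∧ g ^ (3 / 2 : ℝ) = p ^ 3 := by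
  refine ⟨√α, √g, √lam, Real.sqrt_pos.2 hα, Real.sqrt_pos.2 hg, Real.sqrt_pos.2 hlam,
    (Real.sq_sqrt hα.le).symm, (Real.sq_sqrt hg.le).symm, (Real.sq_sqrt hlam.le).symm, rfl, rfl,
    Real.sqrt_mul hg.le _, ?_⟩
  rw [Real.sqrt_eq_rpow, ← Real.rpow_natCast, ← Real.rpow_mul hg.le]
  norm_num

/-- The contribution of the initial error, with `α = a²`, `1 - γ = p²` and `λ_min = q²`. -/
lemma initial_term_le {a p q ε T z : ℝ} (ha : 0 < a) (hp : 0 < p) (hq : 0 < q) (hε : 0 < ε)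
    (hT : 0 < T) (hz : 0 ≤ z)
    (h : 3000 * (1 / (a ^ 2 * p ^ 2 * q ^ 2) * Real.posLog (3000 * (z / ε *
      (1 / (T * a * p ^ 2 * q) * (1 / a + 1 / (p * q)))))) ≤ T) :
    144 * Real.exp (-(a ^ 2 * p ^ 2 * q ^ 2 * T / 4)) * z ^ 2 /
      ((a ^ 2) ^ 2 * (p ^ 2) ^ 2 * q ^ 2 * T ^ 2) ≤ ε ^ 2 / 3 := by
  have hz1 : 3000 * (z / (ε * (T * a ^ 2 * p ^ 2 * q))) ≤
      3000 * (z / ε * (1 / (T * a * p ^ 2 * q) * (1 / a + 1 / (p * q)))) := by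
    have e : 3000 * (z / (ε * (T * a ^ 2 * p ^ 2 * q))) =
      3000 * (z / ε * (1 / (T * a * p ^ 2 * q) * (1 / a))) := by field_simp
    rw [e]
    have : 1 / a ≤ 1 / a + 1 / (p * q) := le_add_of_nonneg_right (by positivity)
    gcongr
  generalize hu : 3000 * (z / ε * (1 / (T * a * p ^ 2 * q) * (1 / a + 1 / (p * q)))) = u at h hz1
  have hu0 : 0 ≤ u := le_trans (by positivity) hz1
  have hL : 0 ≤ Real.posLog u := Real.posLog_nonneg
  rw [← mul_assoc, mul_one_div, div_mul_eq_mul_div, div_le_iff₀ (by positivity)] at h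
  have hexp : Real.exp (-(a ^ 2 * p ^ 2 * q ^ 2 * T / 4)) ≤ Real.exp (-(2 * Real.posLog u)) :=
    Real.exp_le_exp.2 (by linarith)
  have h5 := mul_le_mul (pow_le_pow_left₀ (by positivity) hz1 2) hexp (Real.exp_pos _).le
    (sq_nonneg u)
  have h6 := h5.trans (sq_mul_exp_neg_posLog_le hu0)
  have e : 144 * Real.exp (-(a ^ 2 * p ^ 2 * q ^ 2 * T / 4)) * z ^ 2 /
      ((a ^ 2) ^ 2 * (p ^ 2) ^ 2 * q ^ 2 * T ^ 2) = 144 * ε ^ 2 / 9000000 *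
      ((3000 * (z / (ε * (T * a ^ 2 * p ^ 2 * q)))) ^ 2 *
        Real.exp (-(a ^ 2 * p ^ 2 * q ^ 2 * T / 4))) := by
    field_simp; norm_num
  rw [e]
  refine (mul_le_mul_of_nonneg_left h6 (by positivity)).trans ?_
  rw [mul_one, div_le_div_iff₀ (by norm_num) (by norm_num)]
  have := sq_nonneg ε
  clear * - this
  linarith

/-- The three terms of the error bound are at most `ε² / 3` each. -/
lemma error_bound_le {α g lam ε T b z : ℝ} (hα : 0 < α) (hg : 0 < g) (hlam : 0 < lam)
    (hε : 0 < ε) (hT : 0 < T) (hb : 0 ≤ b) (hz : 0 ≤ z)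
    (h : 3000 * ((b ^ 2 + 1) / (ε ^ 2 * g ^ 2 * lam) * (1 + α / (g * lam)) +
      (b + 1) / (ε * √α * g ^ (3 / 2 : ℝ) * lam) +
      1 / (α * g * lam) * Real.posLog (3000 * (z / ε *
        (1 / (T * √α * g * √lam) * (1 / √α + 1 / √(g * lam)))))) ≤ T) :
    144 * Real.exp (-(α * g * lam * T / 4)) * z ^ 2 / (α ^ 2 * g ^ 2 * lam * T ^ 2) +
      4608 * (b ^ 2 + 1) / (α * g ^ 3 * lam ^ 2 * T ^ 2) +
      768 * (b ^ 2 + 1) / (g ^ 2 * lam * T) ≤ ε ^ 2 := by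
  obtain ⟨a, p, q, ha, hp, hq, eα, eg, elam, e1, e2, e3, e4⟩ := sqrt_rpow_aux hα hg hlam
  rw [e1, e2, e3, e4] at h
  rw [eα, eg, elam] at h ⊢
  set u := 3000 * (z / ε * (1 / (T * a * p ^ 2 * q) * (1 / a + 1 / (p * q)))) with hu
  have hu0 : 0 ≤ u := by positivity
  have hL : 0 ≤ Real.posLog u := Real.posLog_nonneg
  have hp2 : 0 ≤ (b + 1) / (ε * a * p ^ 3 * q ^ 2) := by positivity
  have hp1' : (b ^ 2 + 1) / (ε ^ 2 * (p ^ 2) ^ 2 * q ^ 2) ≤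
      (b ^ 2 + 1) / (ε ^ 2 * (p ^ 2) ^ 2 * q ^ 2) * (1 + a ^ 2 / (p ^ 2 * q ^ 2)) :=
    le_mul_of_one_le_right (by positivity) (by
      have : 0 ≤ a ^ 2 / (p ^ 2 * q ^ 2) := by positivity
      linarith)
  have hp1 : 0 ≤ (b ^ 2 + 1) / (ε ^ 2 * (p ^ 2) ^ 2 * q ^ 2) := by positivity
  have hp3 : 0 ≤ 1 / (a ^ 2 * p ^ 2 * q ^ 2) * Real.posLog u := by positivity
  have t1 : 3000 * ((b ^ 2 + 1) / (ε ^ 2 * (p ^ 2) ^ 2 * q ^ 2)) ≤ T := by linarith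
  have t2 : 3000 * ((b + 1) / (ε * a * p ^ 3 * q ^ 2)) ≤ T := by linarith
  have t3 : 3000 * (1 / (a ^ 2 * p ^ 2 * q ^ 2) * Real.posLog u) ≤ T := by linarith
  have b1 : 768 * (b ^ 2 + 1) / ((p ^ 2) ^ 2 * q ^ 2 * T) ≤ ε ^ 2 / 3 := by
    rw [← mul_div_assoc, div_le_iff₀ (by positivity)] at t1
    rw [div_le_iff₀ (by positivity)]
    nlinarith [sq_nonneg b]
  have b2 : 4608 * (b ^ 2 + 1) / (a ^ 2 * (p ^ 2) ^ 3 * (q ^ 2) ^ 2 * T ^ 2) ≤ ε ^ 2 / 3 := by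
    rw [← mul_div_assoc, div_le_iff₀ (by positivity)] at t2
    have t4 := pow_le_pow_left₀ (by positivity) t2 2
    rw [div_le_iff₀ (by positivity)]
    have e : ε ^ 2 / 3 * (a ^ 2 * (p ^ 2) ^ 3 * (q ^ 2) ^ 2 * T ^ 2) =
      (T * (ε * a * p ^ 3 * q ^ 2)) ^ 2 / 3 := by ring
    rw [e]
    nlinarith [sq_nonneg b]
  have b3 := initial_term_le ha hp hq hε hT hz t3
  linarith

/-- The quantity `(ε⁻² + λ_min⁻¹) (1 - γ)⁻² λ_min⁻¹ (‖θ⋆‖² + 1)`, with `1 - γ = p²` and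
`λ_min = q²`. -/
noncomputable def sampleScale (p q ε b : ℝ) : ℝ :=
  (1 / ε ^ 2 + 1 / q ^ 2) * (1 / (p ^ 2) ^ 2) * (1 / q ^ 2) * (b ^ 2 + 1)

section

variable {a p q ε T b z s c₂ : ℝ} (hp : 0 < p) (hq : 0 < q) (hε : 0 < ε)

include hp hq hε

lemma variance_term_le (h2 : a ^ 2 ≤ c₂ * (p ^ 2 * q ^ 2)) :
    (b ^ 2 + 1) / (ε ^ 2 * (p ^ 2) ^ 2 * q ^ 2) * (1 + a ^ 2 / (p ^ 2 * q ^ 2)) ≤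
      (1 + c₂) * sampleScale p q ε b := by
  have h3 : a ^ 2 / (p ^ 2 * q ^ 2) ≤ c₂ := (div_le_iff₀ (by positivity)).2 h2
  have h4 : (b ^ 2 + 1) / (ε ^ 2 * (p ^ 2) ^ 2 * q ^ 2) ≤ sampleScale p q ε b := by
    have e : (b ^ 2 + 1) / (ε ^ 2 * (p ^ 2) ^ 2 * q ^ 2) =
      1 / ε ^ 2 * (1 / (p ^ 2) ^ 2) * (1 / q ^ 2) * (b ^ 2 + 1) := by field_simp
    have h5 : 1 / ε ^ 2 ≤ 1 / ε ^ 2 + 1 / q ^ 2 := le_add_of_nonneg_right (by positivity)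
    rw [e, sampleScale]
    gcongr
  rw [mul_comm (1 + c₂)]
  exact mul_le_mul h4 (by linarith) (by positivity) (by unfold sampleScale; positivity)

lemma bias_term_le (hb : 0 ≤ b) (hs : 0 < s) (h1 : s * (p * q) ≤ a) :
    (b + 1) / (ε * a * p ^ 3 * q ^ 2) ≤ 2 / s * sampleScale p q ε b := by
  have h5 : (b + 1) / (ε * a * p ^ 3 * q ^ 2) ≤ (b + 1) / (ε * (s * (p * q)) * p ^ 3 * q ^ 2) := by
    gcongr
  have h6 : 1 / (ε * q) ≤ 1 / ε ^ 2 + 1 / q ^ 2 := by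
    have e5 : 1 / (ε * q) = (1 / ε) * (1 / q) := by field_simp
    rw [e5, ← one_div_pow, ← one_div_pow]
    nlinarith [sq_nonneg (1 / ε - 1 / q), sq_nonneg (1 / ε), sq_nonneg (1 / q)]
  have h7 : b + 1 ≤ 2 * (b ^ 2 + 1) := by nlinarith [sq_nonneg (b - 1), sq_nonneg b]
  have e : (b + 1) / (ε * (s * (p * q)) * p ^ 3 * q ^ 2) =
      1 / s * ((1 / (ε * q)) * (1 / (p ^ 2) ^ 2) * (1 / q ^ 2) * (b + 1)) := by
    field_simp
  rw [e] at h5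
  refine h5.trans ?_
  calc 1 / s * ((1 / (ε * q)) * (1 / (p ^ 2) ^ 2) * (1 / q ^ 2) * (b + 1))
      ≤ 1 / s * ((1 / ε ^ 2 + 1 / q ^ 2) * (1 / (p ^ 2) ^ 2) * (1 / q ^ 2) *
          (2 * (b ^ 2 + 1))) := by gcongr
    _ = 2 / s * sampleScale p q ε b := by rw [sampleScale]; ring

lemma le_sampleScale : 1 / ((p ^ 2) ^ 2 * (q ^ 2) ^ 2) ≤ sampleScale p q ε b := by
  have e : 1 / ((p ^ 2) ^ 2 * (q ^ 2) ^ 2) = 1 / q ^ 2 * (1 / (p ^ 2) ^ 2) * (1 / q ^ 2) * 1 := by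
    field_simp
  have h5 : 1 / q ^ 2 ≤ 1 / ε ^ 2 + 1 / q ^ 2 := le_add_of_nonneg_left (by positivity)
  have h6 : 1 ≤ b ^ 2 + 1 := le_add_of_nonneg_left (sq_nonneg b)
  rw [e, sampleScale]
  gcongr

lemma mixing_factor_le (hs : 0 < s) (h1 : s * (p * q) ≤ a) :
    1 / (a ^ 2 * p ^ 2 * q ^ 2) ≤ 1 / s ^ 2 * sampleScale p q ε b := by
  have h2 : 1 / (a ^ 2 * p ^ 2 * q ^ 2) ≤ 1 / ((s * (p * q)) ^ 2 * p ^ 2 * q ^ 2) := by gcongr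
  have e : 1 / ((s * (p * q)) ^ 2 * p ^ 2 * q ^ 2) =
      1 / s ^ 2 * (1 / ((p ^ 2) ^ 2 * (q ^ 2) ^ 2)) := by field_simp
  rw [e] at h2
  exact h2.trans (mul_le_mul_of_nonneg_left (le_sampleScale hp hq hε) (by positivity))

/-- The argument of the logarithm is at most `‖θ₀ - θ⋆‖ / ε`, because `T` is large. -/
lemma log_argument_le (hq1 : q ≤ 1) (hT : 0 < T) (hz : 0 ≤ z) (hs : 0 < s) {C : ℝ} (hC : 0 < C)
    (h1 : s * (p * q) ≤ a)
    (h : C * (1 / s * (1 / s + 1)) * sampleScale p q ε b ≤ T) :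
    C * (z / ε * (1 / (T * a * p ^ 2 * q) * (1 / a + 1 / (p * q)))) ≤ z / ε := by
  have ha : 0 < a := lt_of_lt_of_le (by positivity) h1
  set m := 1 / s * (1 / s + 1) with hm
  have hm0 : 0 < m := by positivity
  have hTlow : C * m ≤ T * ((p ^ 2) ^ 2 * q ^ 2 * q) := by
    have h5 : C * m * (1 / ((p ^ 2) ^ 2 * (q ^ 2) ^ 2)) ≤ T :=
      (mul_le_mul_of_nonneg_left (le_sampleScale hp hq hε) (by positivity)).trans h
    have h7 := mul_le_mul_of_nonneg_right h5 (show 0 ≤ (p ^ 2) ^ 2 * q ^ 2 * q by positivity)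
    refine le_trans ?_ h7
    have e : C * m * (1 / ((p ^ 2) ^ 2 * (q ^ 2) ^ 2)) * ((p ^ 2) ^ 2 * q ^ 2 * q) =
        C * m * (1 / q) := by
      field_simp
    rw [e]
    refine le_mul_of_one_le_right (by positivity) ?_
    rw [le_div_iff₀ hq]; linarith
  have h7 : 1 / (T * a * p ^ 2 * q) * (1 / a + 1 / (p * q)) ≤
      1 / (T * (s * (p * q)) * p ^ 2 * q) * (1 / (s * (p * q)) + 1 / (p * q)) := by gcongr
  have e : 1 / (T * (s * (p * q)) * p ^ 2 * q) * (1 / (s * (p * q)) + 1 / (p * q)) =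
      m / (T * ((p ^ 2) ^ 2 * q ^ 2 * q)) := by
    rw [hm]; field_simp
  rw [e] at h7
  have h8 : C * (1 / (T * a * p ^ 2 * q) * (1 / a + 1 / (p * q))) ≤ 1 := by
    refine (mul_le_mul_of_nonneg_left h7 hC.le).trans ?_
    rw [← mul_div_assoc]
    exact div_le_one_of_le₀ hTlow (by positivity)
  calc _ = z / ε * (C * (1 / (T * a * p ^ 2 * q) * (1 / a + 1 / (p * q)))) := by ring
    _ ≤ z / ε := mul_le_of_le_one_right (by positivity) h8

end

/-- With a step size of order `(1 - γ) λ_min`, the simplified sample size dominates the general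
one. -/
lemma sample_size_le {α g lam ε T b z c₁ c₂ C : ℝ} (hα : 0 < α) (hg : 0 < g)
    (hlam : 0 < lam) (hlam1 : lam ≤ 1) (hε : 0 < ε) (hT : 0 < T) (hb : 0 ≤ b) (hz : 0 ≤ z)
    (hc₁ : 0 < c₁) (hc₂ : 0 < c₂) (hC : 0 < C) (h1 : c₁ * (g * lam) ≤ α)
    (h2 : α ≤ c₂ * (g * lam))
    (h : (C * (2 * ((1 + c₂) + 2 / √c₁ + 1 / c₁ + 1 / √c₁ * (1 / √c₁ + 1)))) *
      ((1 / ε ^ 2 + 1 / lam) * (1 / g ^ 2) * (1 / lam) * (b ^ 2 + 1)) *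
      Real.log (2 + z / ε) ≤ T) :
    C * ((b ^ 2 + 1) / (ε ^ 2 * g ^ 2 * lam) * (1 + α / (g * lam)) +
      (b + 1) / (ε * √α * g ^ (3 / 2 : ℝ) * lam) +
      1 / (α * g * lam) * Real.posLog (C * (z / ε *
        (1 / (T * √α * g * √lam) * (1 / √α + 1 / √(g * lam)))))) ≤ T := by
  obtain ⟨a, p, q, ha, hp, hq, rfl, rfl, rfl, e1, e2, e3, e4⟩ := sqrt_rpow_aux hα hg hlam
  obtain ⟨s, hs, rfl, hs2⟩ : ∃ s : ℝ, 0 < s ∧ c₁ = s ^ 2 ∧ √c₁ = s :=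
    ⟨√c₁, Real.sqrt_pos.2 hc₁, (Real.sq_sqrt hc₁.le).symm, rfl⟩
  rw [e1, e2, e3, e4]
  rw [hs2] at h
  have hq1 : q ≤ 1 := by rw [← sq_le_sq₀ hq.le zero_le_one]; linarith
  have hsa : s * (p * q) ≤ a := by
    rw [← sq_le_sq₀ (by positivity) ha.le]
    exact (le_of_eq (by ring)).trans h1
  have t1 := variance_term_le (b := b) hp hq hε h2
  have t2 := bias_term_le hp hq hε hb hs hsa
  have t3 := mixing_factor_le (b := b) hp hq hε hs hsa
  have h : (C * (2 * ((1 + c₂) + 2 / s + 1 / s ^ 2 + 1 / s * (1 / s + 1)))) *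
      sampleScale p q ε b * Real.log (2 + z / ε) ≤ T := h
  have hW0 : 0 < sampleScale p q ε b := by unfold sampleScale; positivity
  have hY := log_argument_le (b := b) hp hq hε hq1 hT hz hs hC hsa
  generalize sampleScale p q ε b = W at *
  generalize (b ^ 2 + 1) / (ε ^ 2 * (p ^ 2) ^ 2 * q ^ 2) * (1 + a ^ 2 / (p ^ 2 * q ^ 2)) = x₁ at *
  generalize (b + 1) / (ε * a * p ^ 3 * q ^ 2) = x₂ at *
  have hyn : 0 ≤ C * (z / ε * (1 / (T * a * p ^ 2 * q) * (1 / a + 1 / (p * q)))) := by positivity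
  generalize C * (z / ε * (1 / (T * a * p ^ 2 * q) * (1 / a + 1 / (p * q)))) = y at *
  have hx3 : 0 < 1 / (a ^ 2 * p ^ 2 * q ^ 2) := by positivity
  generalize 1 / (a ^ 2 * p ^ 2 * q ^ 2) = x₃ at *
  have hm0 : 0 < 1 / s * (1 / s + 1) := by positivity
  generalize 1 / s * (1 / s + 1) = m at *
  have hs0 : 0 < 2 / s := by positivity
  have hs1 : 0 < 1 / s ^ 2 := by positivity
  generalize 2 / s = k₁ at *
  generalize 1 / s ^ 2 = k₂ at *
  have hzε : 0 ≤ z / ε := by positivity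
  generalize z / ε = w at *
  have hL : 1 / 2 ≤ Real.log (2 + w) := by
    have : Real.log 2 ≤ Real.log (2 + w) := Real.log_le_log (by norm_num) (by linarith)
    linarith [Real.log_two_gt_d9]
  have hlog : y ≤ w → Real.posLog y ≤ Real.log (2 + w) := fun hyw => by
    refine max_le (by linarith) ?_
    rcases hyn.eq_or_lt with h0 | h0
    · rw [← h0, Real.log_zero]; linarith
    · exact Real.log_le_log h0 (by linarith)
  have hpl : 0 ≤ Real.posLog y := Real.posLog_nonneg
  generalize Real.posLog y = ℓ at *
  generalize Real.log (2 + w) = L at *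
  clear * - t1 t2 t3 h hW0 hY hx3 hm0 hs0 hs1 hL hlog hpl hC hc₂
  have hWL : W ≤ 2 * (W * L) := by nlinarith
  have hC1 : 0 < C * W := mul_pos hC hW0
  have hKm : m ≤ 1 + c₂ + k₁ + k₂ + m := by linarith
  have hYT : C * m * W ≤ T := by
    refine le_trans ?_ h
    calc C * m * W ≤ C * m * (2 * (W * L)) :=
          mul_le_mul_of_nonneg_left hWL (mul_pos hC hm0).le
      _ = m * (2 * C * (W * L)) := by ring
      _ ≤ (1 + c₂ + k₁ + k₂ + m) * (2 * C * (W * L)) := by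
          refine mul_le_mul_of_nonneg_right hKm ?_
          have : 0 < W * L := by nlinarith
          positivity
      _ = _ := by ring
  have hl := hlog (hY hYT)
  have hWL0 : 0 < W * L := by nlinarith
  have t4 : x₃ * ℓ ≤ k₂ * W * L := mul_le_mul t3 hl hpl (by positivity)
  have r1 := mul_le_mul_of_nonneg_left hWL (show 0 ≤ 1 + c₂ by linarith)
  have r2 := mul_le_mul_of_nonneg_left hWL hs0.le
  have r3 : 0 ≤ k₂ * (W * L) := by positivity
  have r4 : 0 ≤ m * (W * L) := by positivity
  have r5 : x₁ + x₂ + x₃ * ℓ ≤ 2 * (1 + c₂ + k₁ + k₂ + m) * (W * L) := by linarith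
  refine le_trans (mul_le_mul_of_nonneg_left r5 hC.le) ((le_of_eq (by ring)).trans h)

end Numeric

/-! ### The error of `Linear-CTD` -/

section Algorithm

variable {S A : Type*} [MeasurableSpace S] [MeasurableSpace A] {M : MDP S A} {pol : Kernel S A}
  [IsMarkovKernel pol] {μ : Measure S} [IsProbabilityMeasure μ] {d K : ℕ} {φ : S → Fin d → ℝ}
  {θstar θ₀ : Fin K × Fin d → ℝ} {α : ℝ} {Ω : Type*} [MeasurableSpace Ω] {P : Measure Ω}
  [IsProbabilityMeasure P] {X : ℕ → Ω → S × (A × (ℝ × S))}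

/-- The error `θ_t - θ⋆` of the iterates, in Euclidean space. -/
noncomputable def iterError (γ α : ℝ) (φ : S → Fin d → ℝ) (θ₀ θstar : Fin K × Fin d → ℝ)
    (X : ℕ → Ω → S × (A × (ℝ × S))) (t : ℕ) (ω : Ω) : EuclideanSpace ℝ (Fin K × Fin d) :=
  WithLp.toLp 2 (iterate γ α φ θ₀ (fun t => X t ω) t - θstar)

lemma isErrorProcess_iterError (hX : ∀ t, Measurable (X t))
    (hlaw : ∀ t, P.map (X t) = sampleLaw M pol μ) (hind : iIndepFun X P) (γ : ℝ) :
    IsErrorProcess P (sampleLaw M pol μ) (updOp γ K φ) (residual γ φ θstar) α X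
      (iterError γ α φ θ₀ θstar X) where
  measurable_sample := hX
  map_sample := hlaw
  indep := hind
  init := ⟨WithLp.toLp 2 (θ₀ - θstar), fun _ => rfl⟩
  step t ω := by
    simp only [updOp_apply, iterError, residual, iterate, Matrix.mulVec_sub, ← WithLp.toLp_sub,
      ← WithLp.toLp_smul]
    congr 1
    module

lemma tailAvg_sub_eq {n : ℕ} (γ : ℝ) (ω : Ω) :
    tailAvg γ α φ θ₀ (fun t => X t ω) (n + n) - θstar =
      (((n + 1 : ℕ) : ℝ)⁻¹ • ∑ t ∈ Finset.Ico n (n + (n + 1)),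
        iterError γ α φ θ₀ θstar X t ω).ofLp := by
  have e1 : (((n + n : ℕ) : ℝ) / 2 + 1) = ((n + 1 : ℕ) : ℝ) := by push_cast; ring
  have e2 : Finset.Icc ((n + n) / 2) (n + n) = Finset.Ico n (n + (n + 1)) := by
    ext t; simp only [Finset.mem_Icc, Finset.mem_Ico]; omega
  have hn : ((n + 1 : ℕ) : ℝ) ≠ 0 := by positivity
  unfold tailAvg iterError
  rw [e1, e2, WithLp.ofLp_smul, WithLp.ofLp_sum]
  simp only [Finset.sum_sub_distrib, Finset.sum_const, Nat.card_Ico, add_tsub_cancel_left]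
  rw [smul_sub, ← Nat.cast_smul_eq_nsmul ℝ, smul_smul, inv_mul_cancel₀ hn, one_smul]

lemma one_sub_sqrt_bounds {γ : ℝ} (h0 : 0 < γ) (h1 : γ < 1) :
    (1 - γ) / 2 ≤ 1 - √γ ∧ 1 - √γ ≤ 1 ∧ 0 < 1 - √γ := by
  have h2 : √γ < 1 := by rw [Real.sqrt_lt' one_pos]; simpa using h1
  have h3 := Real.sqrt_nonneg γ
  have h4 := Real.sq_sqrt h0.le
  exact ⟨by nlinarith, by linarith, by linarith⟩

/-- The error bound of averaged stochastic approximation with `κ ≥ g / 2` and a window of length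
`N ≥ T / 2`, divided by the scale `Q = K (1 - γ)²` of the loss. -/
lemma averaged_bound_le {α g lam κ N T E e z B Q : ℝ} (hα : 0 < α) (hg : 0 < g) (hlam : 0 < lam)
    (hκ : g / 2 ≤ κ) (hT : 0 < T) (hN : T / 2 ≤ N) (he : 0 ≤ e) (heE : e ≤ E) (hz : 0 ≤ z)
    (hB : 0 ≤ B) (hQ : 0 ≤ Q) :
    (9 * e * (z * Q) / α ^ 2 + 18 * (8 * B * Q) / (α * κ * lam) + 12 * N * (8 * B * Q)) /
      (κ ^ 2 * lam * N ^ 2) ≤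
    (144 * E * z / (α ^ 2 * g ^ 2 * lam * T ^ 2) + 4608 * B / (α * g ^ 3 * lam ^ 2 * T ^ 2) +
      768 * B / (g ^ 2 * lam * T)) * Q := by
  have hκ0 : 0 < κ := lt_of_lt_of_le (by positivity) hκ
  have hN0 : 0 < N := lt_of_lt_of_le (by positivity) hN
  have e1 : (9 * e * (z * Q) / α ^ 2 + 18 * (8 * B * Q) / (α * κ * lam) + 12 * N * (8 * B * Q)) /
      (κ ^ 2 * lam * N ^ 2) = 9 * e * z * Q / (α ^ 2 * κ ^ 2 * lam * N ^ 2) +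
      144 * B * Q / (α * κ ^ 3 * lam ^ 2 * N ^ 2) + 96 * B * Q / (κ ^ 2 * lam * N) := by
    field_simp; ring
  have e2 : (144 * E * z / (α ^ 2 * g ^ 2 * lam * T ^ 2) +
      4608 * B / (α * g ^ 3 * lam ^ 2 * T ^ 2) + 768 * B / (g ^ 2 * lam * T)) * Q =
      9 * E * z * Q / (α ^ 2 * (g / 2) ^ 2 * lam * (T / 2) ^ 2) +
      144 * B * Q / (α * (g / 2) ^ 3 * lam ^ 2 * (T / 2) ^ 2) +
      96 * B * Q / ((g / 2) ^ 2 * lam * (T / 2)) := by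
    field_simp; ring
  have hE : 0 ≤ E := he.trans heE
  rw [e1, e2]
  gcongr

lemma integrable_loss_sq (hφm : Measurable φ) (hφ : ∀ s, euclNorm (φ s) ≤ 1)
    (hK : 0 < (K : ℝ) * (1 - M.γ))
    {c v lam : ℝ} (h : IsStableNoise (sampleLaw M pol μ) (updOp M.γ K φ) (residual M.γ φ θstar)
      (fun u => scoreForm μ φ u.ofLp) (1 - √M.γ) lam v c)
    (hX : ∀ t, Measurable (X t)) (hlaw : ∀ t, P.map (X t) = sampleLaw M pol μ)
    (hind : iIndepFun X P) (n : ℕ) :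
    Integrable (fun ω => scoreForm μ φ
      (tailAvg M.γ α φ θ₀ (fun t => X t ω) (n + n) - θstar)) P ∧
    Integrable (fun ω => loss M.γ μ φ θstar
      (tailAvg M.γ α φ θ₀ (fun t => X t ω) (n + n)) ^ 2) P := by
  have hp := isErrorProcess_iterError (θstar := θstar) (θ₀ := θ₀) (α := α) (φ := φ)
    hX hlaw hind M.γ
  set Y : Ω → EuclideanSpace ℝ (Fin K × Fin d) := fun ω => ((n + 1 : ℕ) : ℝ)⁻¹ •
    ∑ t ∈ Finset.Ico n (n + (n + 1)), iterError M.γ α φ θ₀ θstar X t ω with hY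
  have hsum : Measurable fun ω => ∑ t ∈ Finset.Ico n (n + (n + 1)),
      iterError M.γ α φ θ₀ θstar X t ω :=
    Finset.measurable_fun_sum _ fun t _ => hp.measurable_error h t
  have hYm : Measurable Y := by rw [hY]; exact hsum.const_smul (((n + 1 : ℕ) : ℝ)⁻¹)
  have hYb : ∃ R : ℝ, ∀ᵐ ω ∂P, ‖Y ω‖ ≤ R := by
    choose R hR using hp.error_bound h
    refine ⟨‖((n + 1 : ℕ) : ℝ)⁻¹‖ * ∑ t ∈ Finset.Ico n (n + (n + 1)), R t, ?_⟩
    filter_upwards [ae_all_iff.2 hR] with ω hω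
    rw [hY, norm_smul]
    exact mul_le_mul_of_nonneg_left (norm_sum_le_of_le _ fun t _ => hω t) (norm_nonneg _)
  have hYi := integrable_norm_sq_of_norm_le hYm hYb
  have e : ∀ ω, tailAvg M.γ α φ θ₀ (fun t => X t ω) (n + n) - θstar = (Y ω).ofLp :=
    fun ω => tailAvg_sub_eq M.γ ω
  have hform : Integrable (fun ω => scoreForm μ φ (Y ω).ofLp) P := by
    refine hYi.mono' ((measurable_scoreForm hφm).comp
      ((WithLp.measurable_ofLp 2 _).comp hYm)).aestronglyMeasurable (.of_forall fun ω => ?_)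
    rw [Real.norm_of_nonneg (scoreForm_nonneg _), EuclideanSpace.real_norm_sq_eq]
    exact scoreForm_le hφm hφ _
  have hloss : Measurable fun ω => loss M.γ μ φ θstar
      (tailAvg M.γ α φ θ₀ (fun t => X t ω) (n + n)) ^ 2 := by
    have e' : ∀ ω, tailAvg M.γ α φ θ₀ (fun t => X t ω) (n + n) = (Y ω).ofLp + θstar :=
      fun ω => by rw [← e, sub_add_cancel]
    simp only [e']
    exact (measurable_loss_sq hK hφm θstar).comp
      (((WithLp.measurable_ofLp 2 _).comp hYm).add_const _)
  refine ⟨by simpa only [e] using hform, (hform.div_const (K * (1 - M.γ) ^ 2)).mono'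
    hloss.aestronglyMeasurable (.of_forall fun ω => ?_)⟩
  rw [Real.norm_of_nonneg (sq_nonneg _), ← e]
  exact loss_sq_le hK hφm hφ θstar _

/-- Mean squared loss of the tail average of `2 n` iterations. -/
theorem integral_loss_sq_le (hμ : Kernel.Invariant (stateKernel M pol) μ) (hφm : Measurable φ)
    (hφ : ∀ s, euclNorm (φ s) ≤ 1) (hlam : 0 < lamMin μ φ) (hK : 1 ≤ (K : ℝ) * (1 - M.γ))
    (hθ : IsProjectedFixedPoint M pol μ φ θstar) (hα : 0 < α) (hα1 : α < (1 - √M.γ) / 76)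
    (hX : ∀ t, Measurable (X t)) (hlaw : ∀ t, P.map (X t) = sampleLaw M pol μ)
    (hind : iIndepFun X P) {n : ℕ} (hn : 0 < n) :
    Integrable (fun ω => loss M.γ μ φ θstar
      (tailAvg M.γ α φ θ₀ (fun t => X t ω) (n + n)) ^ 2) P ∧
    ∫ ω, loss M.γ μ φ θstar (tailAvg M.γ α φ θ₀ (fun t => X t ω) (n + n)) ^ 2 ∂P ≤
      144 * Real.exp (-(α * (1 - M.γ) * lamMin μ φ * ((n + n : ℕ) : ℝ) / 4)) *
        normV2 M.γ (θ₀ - θstar) ^ 2 /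
        (α ^ 2 * (1 - M.γ) ^ 2 * lamMin μ φ * ((n + n : ℕ) : ℝ) ^ 2) +
      4608 * (normV1 M.γ μ φ θstar ^ 2 + 1) /
        (α * (1 - M.γ) ^ 3 * lamMin μ φ ^ 2 * ((n + n : ℕ) : ℝ) ^ 2) +
      768 * (normV1 M.γ μ φ θstar ^ 2 + 1) /
        ((1 - M.γ) ^ 2 * lamMin μ φ * ((n + n : ℕ) : ℝ)) := by
  have hK0 : 0 < (K : ℝ) * (1 - M.γ) := by linarith
  obtain ⟨c, h⟩ := isStableNoise hμ hφm hφ hK (integral_residual_eq_zero hK0 hφm hφ hθ)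
  obtain ⟨hform, hloss⟩ := integrable_loss_sq (α := α) (θ₀ := θ₀) hφm hφ hK0 h hX hlaw hind n
  refine ⟨hloss, ?_⟩
  have hlam1 := lamMin_le_one hφm hφ hlam
  have hg : 0 < 1 - M.γ := by linarith [M.γ_lt_one]
  obtain ⟨hκ1, hκ2, hκ0⟩ := one_sub_sqrt_bounds M.γ_pos M.γ_lt_one
  have hp := isErrorProcess_iterError (θstar := θstar) (θ₀ := θ₀) (α := α) (φ := φ)
    hX hlaw hind M.γ
  have hρ : α * (1 - √M.γ) * lamMin μ φ ≤ 1 := by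
    have h1 : α * (1 - √M.γ) ≤ 1 := mul_le_one₀ (by linarith) hκ0.le hκ2
    exact mul_le_one₀ h1 hlam.le hlam1
  have key := hp.integral_form_average_le h hα (by linarith) hlam hρ
    (u₀ := WithLp.toLp 2 (θ₀ - θstar)) (fun _ => rfl) n n.succ_pos
  simp only [Nat.succ_eq_add_one, ← tailAvg_sub_eq] at key
  have hKne : (K : ℝ) ≠ 0 := fun h0 => by simp [h0] at hK0
  have hQ : 0 < (K : ℝ) * (1 - M.γ) ^ 2 := by
    rw [sq, ← mul_assoc]
    exact mul_pos hK0 hg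
  have h1 : ∫ ω, loss M.γ μ φ θstar (tailAvg M.γ α φ θ₀ (fun t => X t ω) (n + n)) ^ 2 ∂P ≤
      (∫ ω, scoreForm μ φ (tailAvg M.γ α φ θ₀ (fun t => X t ω) (n + n) - θstar) ∂P) /
        (K * (1 - M.γ) ^ 2) := by
    rw [← integral_div]
    exact integral_mono hloss (hform.div_const _) fun ω => loss_sq_le hK0 hφm hφ θstar _
  have hv : 8 * (K * (1 - M.γ) ^ 2) + 8 * scoreForm μ φ θstar =
      8 * (normV1 M.γ μ φ θstar ^ 2 + 1) * (K * (1 - M.γ) ^ 2) := by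
    rw [normV1_sq hφm hφ]; field_simp; ring
  have hz : ‖(WithLp.toLp 2 (θ₀ - θstar) : EuclideanSpace ℝ (Fin K × Fin d))‖ ^ 2 =
      normV2 M.γ (θ₀ - θstar) ^ 2 * (K * (1 - M.γ) ^ 2) := by
    rw [normV2_sq]; field_simp
  have hexp : (1 - α * (1 - √M.γ) * lamMin μ φ) ^ n ≤
      Real.exp (-(α * (1 - M.γ) * lamMin μ φ * ((n + n : ℕ) : ℝ) / 4)) := by
    have h2 : 1 - α * (1 - √M.γ) * lamMin μ φ ≤ Real.exp (-(α * (1 - √M.γ) * lamMin μ φ)) := by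
      linarith [Real.add_one_le_exp (-(α * (1 - √M.γ) * lamMin μ φ))]
    refine (pow_le_pow_left₀ (by linarith) h2 n).trans ?_
    rw [← Real.exp_nat_mul, Real.exp_le_exp]
    have h3 := mul_le_mul_of_nonneg_left hκ1 (show 0 ≤ α * lamMin μ φ * n by positivity)
    push_cast
    linarith
  refine h1.trans ?_
  rw [div_le_iff₀ hQ]
  refine key.trans ?_
  rw [hv, hz]
  have hn' : (0 : ℝ) < n := by exact_mod_cast hn
  exact averaged_bound_le hα hg hlam hκ1 (by push_cast; linarith) (by push_cast; linarith)
    (pow_nonneg (sub_nonneg.2 hρ) n) hexp (sq_nonneg _) (by positivity) hQ.le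

end Algorithm

end LinearCTD

theorem corollary1 :
    ∃ C : ℝ, 0 < C ∧ ∀ c₁ c₂ : ℝ, 0 < c₁ → c₁ ≤ c₂ → ∃ C' : ℝ, 0 < C' ∧
    -- the Markov decision process, the policy and its stationary distribution
    ∀ (S : Type u) [TopologicalSpace S] [PolishSpace S] [MeasurableSpace S] [BorelSpace S]
      (A : Type v) [TopologicalSpace A] [PolishSpace A] [MeasurableSpace A] [BorelSpace A]
      (M : MDP S A) (pol : Kernel S A) [IsMarkovKernel pol]
      (μ : Measure S) [IsProbabilityMeasure μ],
      Kernel.Invariant (stateKernel M pol) μ →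
    -- the features
    ∀ (d : ℕ) (φ : S → Fin d → ℝ), Measurable φ → (∀ s, euclNorm (φ s) ≤ 1) →
      0 < lamMin μ φ →
    -- the categorical parametrization and the solution of the projected Bellman equation
    ∀ (K : ℕ), (1 - M.γ)⁻¹ ≤ (K : ℝ) →
    ∀ θstar : Fin K × Fin d → ℝ, IsProjectedFixedPoint M pol μ φ θstar →
    -- the step size, the initialization and the samples from the generative model
    ∀ α : ℝ, 0 < α → α < (1 - √M.γ) / 76 →
    ∀ (θ₀ : Fin K × Fin d → ℝ) (Ω : Type w) [MeasurableSpace Ω] (Prob : Measure Ω)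
      [IsProbabilityMeasure Prob] (X : ℕ → Ω → S × (A × (ℝ × S))),
      (∀ t, Measurable (X t)) → (∀ t, Prob.map (X t) = sampleLaw M pol μ) → iIndepFun X Prob →
    -- the conclusion, for every (even) number of iterations and every accuracy
    ∀ T : ℕ, Even T → 0 < T →
      Integrable (fun ω =>
        loss M.γ μ φ θstar (tailAvg M.γ α φ θ₀ (fun t => X t ω) T) ^ 2) Prob ∧
      ∀ ε : ℝ, 0 < ε →
        (C * ((normV1 M.γ μ φ θstar ^ 2 + 1) / (ε ^ 2 * (1 - M.γ) ^ 2 * lamMin μ φ) *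
              (1 + α / ((1 - M.γ) * lamMin μ φ)) +
            (normV1 M.γ μ φ θstar + 1) / (ε * √α * (1 - M.γ) ^ (3 / 2 : ℝ) * lamMin μ φ) +
            1 / (α * (1 - M.γ) * lamMin μ φ) *
              Real.posLog (C * (normV2 M.γ (θ₀ - θstar) / ε *
                (1 / (T * √α * (1 - M.γ) * √(lamMin μ φ)) *
                  (1 / √α + 1 / √((1 - M.γ) * lamMin μ φ)))))) ≤ (T : ℝ) →
          √(∫ ω, loss M.γ μ φ θstar (tailAvg M.γ α φ θ₀ (fun t => X t ω) T) ^ 2 ∂Prob) ≤ ε) ∧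
        (c₁ * ((1 - M.γ) * lamMin μ φ) ≤ α → α ≤ c₂ * ((1 - M.γ) * lamMin μ φ) →
          C' * ((1 / ε ^ 2 + 1 / lamMin μ φ) * (1 / (1 - M.γ) ^ 2) * (1 / lamMin μ φ) *
              (normV1 M.γ μ φ θstar ^ 2 + 1)) *
              Real.log (2 + normV2 M.γ (θ₀ - θstar) / ε) ≤ (T : ℝ) →
          √(∫ ω, loss M.γ μ φ θstar (tailAvg M.γ α φ θ₀ (fun t => X t ω) T) ^ 2 ∂Prob) ≤ ε) := by
  -- `3000` exceeds `3 * 768` (variance), `√(3 * 4608)` (bias), and `8` and `√(3 * 144)` (initial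
  -- error).
  refine ⟨3000, by norm_num, fun c₁ c₂ hc₁ hc₁₂ => ?_⟩
  have hc₂ : 0 < c₂ := hc₁.trans_le hc₁₂
  -- The summands bound the variance, bias and mixing terms and the argument of the logarithm; the
  -- factor `2` is from `1 ≤ 2 log (2 + ·)`.
  refine ⟨3000 * (2 * ((1 + c₂) + 2 / √c₁ + 1 / c₁ + 1 / √c₁ * (1 / √c₁ + 1))), by positivity, ?_⟩
  intro S _ _ _ _ A _ _ _ _ M pol _ μ _ hμ d φ hφm hφ hlam K hK θstar hθ α hα hα1 θ₀ Ω _ P _ X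
    hX hlaw hind T hTe hT
  obtain ⟨n, rfl⟩ := hTe
  have hg : 0 < 1 - M.γ := by linarith [M.γ_lt_one]
  have hK1 : 1 ≤ (K : ℝ) * (1 - M.γ) := by
    rwa [inv_eq_one_div, div_le_iff₀ hg] at hK
  obtain ⟨hint, hbound⟩ := integral_loss_sq_le (θ₀ := θ₀) hμ hφm hφ hlam hK1 hθ hα hα1 hX hlaw
    hind (n := n) (by omega)
  have hT' : (0 : ℝ) < ((n + n : ℕ) : ℝ) := by exact_mod_cast hT
  have hb : 0 ≤ normV1 M.γ μ φ θstar :=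
    mul_nonneg (div_nonneg zero_le_one (mul_nonneg (Real.sqrt_nonneg _) hg.le)) (Real.sqrt_nonneg _)
  have hz : 0 ≤ normV2 M.γ (θ₀ - θstar) :=
    mul_nonneg (div_nonneg zero_le_one (mul_nonneg (Real.sqrt_nonneg _) hg.le)) (norm_nonneg _)
  refine ⟨hint, fun ε hε => ?_⟩
  have part1 := fun h => Real.sqrt_le_iff.2
    ⟨hε.le, hbound.trans (error_bound_le hα hg hlam hε hT' hb hz h)⟩
  exact ⟨part1, fun h1 h2 h => part1 (sample_size_le hα hg hlam (lamMin_le_one hφm hφ hlam) hε hT'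
    hb hz hc₁ hc₂ (by norm_num) h1 h2 h)⟩
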